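/- **Setting.** Let $d\ge 1$. In each round $t=1,2,\dots$ a learner chooses $x_t\in\mathbb{R}^d$, then a convex and $1$-Lipschitz loss $f_t:\mathbb{R}^d\to\mathbb{R}$ is revealed through a (sub)gradient $g_t=\nabla f_t(x_t)$. Write $$\mathrm{Reg}_T(u)=\sum_{t=1}^T f_t(x_t)-\sum_{t=1}^T f_t(u),\qquad G_T=\sum_{t=1}^T\|g_t\|_2^2 .$$ **Coin betting with LightONS.Core.** Let $\epsilon_0>0$ (the initial wealth) and $\gamma=\frac{6-\log 7}{18}$. Put $W_0=\epsilon_0$, $v_1=0$, $A_0=dI$. In round $t$ play $x_t=W_{t-1}v_t$, receive $g_t$, and set $W_t=W_{t-1}-g_t^\top x_t$, $z_t=g_t/(1-g_t^\top v_t)$ (the gradient at $v_t$ of $v\mapsto-\log(1-g_t^\top v)$), $A_t=A_{t-1}+z_tz_t^\top$ and $\hat v_{t+1}=v_t-\frac1\gamma A_t^{-1}z_t$. If $\|\hat v_{t+1}\|_2\le\frac34$ let $v_{t+1}=\hat v_{t+1}$; otherwise let $v_{t+1}$ be a point of the ball $\{\|v\|_2\le\frac12\}$ within Euclidean distance $\zeta_t=\frac{\gamma}{3(16t+d)t^2}$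 of the Mahalanobis projection $\operatorname{argmin}_{\|w\|_2\le 1/2}(w-\hat v_{t+1})^\top A_t(w-\hat v_{t+1})$. **Computational model.** Runtime is counted on a uniform machine whose data are binary cells with real numbers at the leaves, and whose programs are finite recursive programs with real constants. Each arithmetic operation, square root, comparison, cell operation and procedure call costs one unit. Vectors and matrices are stored as lists. Let $\omega\ge 2$ be any exponent for which some program multiplies real $n\times n$ matrices in $O(n^\omega)$ steps for all $n\ge1$. **Theorem.** There is an absolute constant $K>0$ such that for every such $\omega$ there are an online program, not depending on $d$, $\epsilon_0$, the losses or the horizon, and a constant $C>0$ depending only on $\omega$ and that program, with the following property. Given $d\ge1$ and $\epsilon_0>0$ as input, and run against any sequence of convex $1$-Lipschitz losses, observing only the (sub)gradients $g_t$, the program never fails, its decisions $x_t$ are those of coin betting with LightONS.Core as above, and for all $T\ge1$: 1. for every $u\in\mathbb{R}^d$, with $L=\log\left(2+G_T+\|u\|_2/\epsilon_0\right)$, $$\mathrm{Reg}_T(u)\le \epsilon_0+K\left(d\|u\|_2L+\sqrt{d\,L\sum_{t=1}^T(g_t^\top u)^2}\right)\le \epsilon_0+K\left(d\|u\|_2L+\|u\|_2\sqrt{d\,G_T\,L}\right),$$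 that is, $\mathrm{Reg}_T(u)\le\tilde O\big(\sqrt{d\sum_t(g_t^\top u)^2}\big)\le\tilde O\big(\|u\|_2\sqrt{dG_T}\big)$ up to the lower-order terms $\epsilon_0$ and $\tilde O(d\|u\|_2)$; 2. the total number of steps over the first $T$ rounds, including the initialization, is at most $C\left(d^2T+d^\omega\sqrt T\,\log(T+1)\right)$. -/

import Mathlib

open Finset

/-! Real-arithmetic machine: a first-order functional language on cons cells holding real
numbers.  Every elementary action (an arithmetic operation, a square root, a comparison, a
constant, building or taking apart one cell, a branch, a procedure call) costs one unit. -/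

namespace RealMachine

/-- Data handled by the machine: binary cells with real numbers at the leaves. -/
inductive Data : Type
  | nil : Data
  | real (r : ℝ) : Data
  | pair (a b : Data) : Data

/-- Programs.  Each program maps one datum to one datum. `fix f` declares a recursive procedure
with body `f`, inside which `self` calls the procedure. -/
inductive Code : Type
  | id : Code
  | nil : Code
  | const (r : ℝ) : Code
  | fst : Code
  | snd : Code
  | pair (f g : Code) : Code
  | comp (g f : Code) : Code
  | add : Code
  | sub : Code
  | mul : Code
  | div : Code
  | sqrt : Code
  | ifLe (f g : Code) : Code
  | ifNil (f g : Code) : Code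
  | fix (f : Code) : Code
  | self : Code

/-- `Eval ρ p x y n`: where `ρ` is the body of the enclosing procedure (if there is one), the
program `p` halts on input `x` with output `y` after exactly `n` steps.  Division by zero and
square roots of negative numbers are not executable. -/
inductive Eval : Option Code → Code → Data → Data → ℕ → Prop
  | id (ρ : Option Code) (x : Data) : Eval ρ Code.id x x 1
  | nil (ρ : Option Code) (x : Data) : Eval ρ Code.nil x Data.nil 1
  | const (ρ : Option Code) (r : ℝ) (x : Data) : Eval ρ (Code.const r) x (Data.real r) 1
  | fst (ρ : Option Code) (a b : Data) : Eval ρ Code.fst (Data.pair a b) a 1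
  | snd (ρ : Option Code) (a b : Data) : Eval ρ Code.snd (Data.pair a b) b 1
  | pair {ρ : Option Code} {f g : Code} {x y z : Data} {m n : ℕ} :
      Eval ρ f x y m → Eval ρ g x z n → Eval ρ (Code.pair f g) x (Data.pair y z) (m + n + 1)
  | comp {ρ : Option Code} {f g : Code} {x y z : Data} {m n : ℕ} :
      Eval ρ f x y m → Eval ρ g y z n → Eval ρ (Code.comp g f) x z (m + n + 1)
  | add (ρ : Option Code) (a b : ℝ) :
      Eval ρ Code.add (Data.pair (Data.real a) (Data.real b)) (Data.real (a + b)) 1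
  | sub (ρ : Option Code) (a b : ℝ) :
      Eval ρ Code.sub (Data.pair (Data.real a) (Data.real b)) (Data.real (a - b)) 1
  | mul (ρ : Option Code) (a b : ℝ) :
      Eval ρ Code.mul (Data.pair (Data.real a) (Data.real b)) (Data.real (a * b)) 1
  | div (ρ : Option Code) (a b : ℝ) (hb : b ≠ 0) :
      Eval ρ Code.div (Data.pair (Data.real a) (Data.real b)) (Data.real (a / b)) 1
  | sqrt (ρ : Option Code) (a : ℝ) (ha : 0 ≤ a) :
      Eval ρ Code.sqrt (Data.real a) (Data.real (Real.sqrt a)) 1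
  | ifLe_true {ρ : Option Code} {f g : Code} {a b : ℝ} {x y : Data} {n : ℕ} (hab : a ≤ b) :
      Eval ρ f x y n →
      Eval ρ (Code.ifLe f g) (Data.pair (Data.pair (Data.real a) (Data.real b)) x) y (n + 1)
  | ifLe_false {ρ : Option Code} {f g : Code} {a b : ℝ} {x y : Data} {n : ℕ} (hab : b < a) :
      Eval ρ g x y n →
      Eval ρ (Code.ifLe f g) (Data.pair (Data.pair (Data.real a) (Data.real b)) x) y (n + 1)
  | ifNil_nil {ρ : Option Code} {f g : Code} {x y : Data} {n : ℕ} :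
      Eval ρ f x y n → Eval ρ (Code.ifNil f g) (Data.pair Data.nil x) y (n + 1)
  | ifNil_pair {ρ : Option Code} {f g : Code} {a b x y : Data} {n : ℕ} :
      Eval ρ g (Data.pair (Data.pair a b) x) y n →
      Eval ρ (Code.ifNil f g) (Data.pair (Data.pair a b) x) y (n + 1)
  | fix {ρ : Option Code} {f : Code} {x y : Data} {n : ℕ} :
      Eval (some f) f x y n → Eval ρ (Code.fix f) x y (n + 1)
  | self {f : Code} {x y : Data} {n : ℕ} :
      Eval (some f) f x y n → Eval (some f) Code.self x y (n + 1)

/-- The machine is deterministic: output and step count are functions of the input. -/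
theorem Eval.deterministic {ρ : Option Code} {p : Code} {x y : Data} {n : ℕ}
    (h : Eval ρ p x y n) : ∀ {y' : Data} {n' : ℕ}, Eval ρ p x y' n' → y = y' ∧ n = n' := by
  induction h with
  | pair _ _ ih₁ ih₂ =>
    intro y' n' h'
    cases h' with
    | pair h₁ h₂ =>
      obtain ⟨rfl, rfl⟩ := ih₁ h₁
      obtain ⟨rfl, rfl⟩ := ih₂ h₂
      exact ⟨rfl, rfl⟩
  | comp _ _ ih₁ ih₂ =>
    intro y' n' h'
    cases h' with
    | comp h₁ h₂ =>
      obtain ⟨rfl, rfl⟩ := ih₁ h₁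
      obtain ⟨rfl, rfl⟩ := ih₂ h₂
      exact ⟨rfl, rfl⟩
  | ifLe_true hab _ ih =>
    intro y' n' h'
    cases h' with
    | ifLe_true _ h₁ =>
      obtain ⟨rfl, rfl⟩ := ih h₁
      exact ⟨rfl, rfl⟩
    | ifLe_false hba _ => exact absurd hab (not_le.mpr hba)
  | ifLe_false hab _ ih =>
    intro y' n' h'
    cases h' with
    | ifLe_true hba _ => exact absurd hba (not_le.mpr hab)
    | ifLe_false _ h₁ =>
      obtain ⟨rfl, rfl⟩ := ih h₁
      exact ⟨rfl, rfl⟩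
  | ifNil_nil _ ih =>
    intro y' n' h'
    cases h' with
    | ifNil_nil h₁ =>
      obtain ⟨rfl, rfl⟩ := ih h₁
      exact ⟨rfl, rfl⟩
  | ifNil_pair _ ih =>
    intro y' n' h'
    cases h' with
    | ifNil_pair h₁ =>
      obtain ⟨rfl, rfl⟩ := ih h₁
      exact ⟨rfl, rfl⟩
  | fix _ ih =>
    intro y' n' h'
    cases h' with
    | fix h₁ =>
      obtain ⟨rfl, rfl⟩ := ih h₁
      exact ⟨rfl, rfl⟩
  | self _ ih =>
    intro y' n' h'
    cases h' with
    | self h₁ =>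
      obtain ⟨rfl, rfl⟩ := ih h₁
      exact ⟨rfl, rfl⟩
  | _ =>
    intro y' n' h'
    cases h'
    exact ⟨rfl, rfl⟩

/-- A list is stored as a chain of cells ending in `nil`. -/
def Data.ofList : List Data → Data
  | [] => Data.nil
  | a :: l => Data.pair a (Data.ofList l)

/-- A vector is stored as the list of its coordinates. -/
def Data.ofVec {n : ℕ} (x : Fin n → ℝ) : Data :=
  Data.ofList (List.ofFn fun i => Data.real (x i))

/-- A matrix is stored as the list of its rows. -/
def Data.ofMatrix {m n : ℕ} (A : Matrix (Fin m) (Fin n) ℝ) : Data :=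
  Data.ofList (List.ofFn fun i => Data.ofVec (A i))

/-- One program multiplies any two real `n × n` matrices within `c * n ^ ω` steps, for all
`n ≥ 1`, with `c` independent of `n`. -/
def MatMulExponent (ω : ℝ) : Prop :=
  ∃ (P : Code) (c : ℝ), ∀ n : ℕ, 1 ≤ n → ∀ A B : Matrix (Fin n) (Fin n) ℝ,
    ∃ k : ℕ, Eval none P (Data.pair (Data.ofMatrix A) (Data.ofMatrix B)) (Data.ofMatrix (A * B)) k ∧
      (k : ℝ) ≤ c * (n : ℝ) ^ ω

/-- An online learning algorithm: `init` maps the parameters to the first decision and the first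
memory content; `step` maps the latest observed gradient and the memory content to the next
decision and the next memory content. -/
structure OnlineAlgorithm where
  init : Code
  step : Code

/-- `P.Run params g x mem cost`: started with the parameters `params` and fed with the gradient
`g t` after its decision `x t`, for `t = 0, 1, 2, …`, the algorithm makes the decisions `x`,
passes through the memory contents `mem`, spends `cost 0` steps on the initialization and
`cost (t + 1)` steps on the update that follows the gradient `g t`. -/
structure OnlineAlgorithm.Run (P : OnlineAlgorithm) (params : Data) {d : ℕ}
    (g x : ℕ → EuclideanSpace ℝ (Fin d)) (mem : ℕ → Data) (cost : ℕ → ℕ) : Prop where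
  init : Eval none P.init params (Data.pair (Data.ofVec fun i => x 0 i) (mem 0)) (cost 0)
  step : ∀ t : ℕ, Eval none P.step (Data.pair (Data.ofVec fun i => g t i) (mem t))
    (Data.pair (Data.ofVec fun i => x (t + 1) i) (mem (t + 1))) (cost (t + 1))

end RealMachine

/-! Online convex optimization, LightONS.Core and coin betting.  Rounds are numbered from `0`,
so that round `t` here is the `(t + 1)`-st round. -/

namespace UnboundedOCO

/-- `g` is a subgradient of `f` at `x`; if `f` is convex and differentiable at `x`, this means
`g = ∇ f(x)`. -/
def IsSubgradient {d : ℕ} (f : EuclideanSpace ℝ (Fin d) → ℝ)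
    (x g : EuclideanSpace ℝ (Fin d)) : Prop :=
  ∀ y, f x + inner ℝ g (y - x) ≤ f y

/-- The regret over the first `T` rounds against the comparator `u`. -/
noncomputable def regret {d : ℕ} (f : ℕ → EuclideanSpace ℝ (Fin d) → ℝ)
    (x : ℕ → EuclideanSpace ℝ (Fin d)) (T : ℕ) (u : EuclideanSpace ℝ (Fin d)) : ℝ :=
  ∑ t ∈ range T, f t (x t) - ∑ t ∈ range T, f t u

/-- The squared Mahalanobis norm `xᵀ M x`. -/
noncomputable def mahalanobisSq {d : ℕ} (M : Matrix (Fin d) (Fin d) ℝ)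
    (x : EuclideanSpace ℝ (Fin d)) : ℝ :=
  inner ℝ x (Matrix.toEuclideanLin M x)

/-- `p` is the Mahalanobis projection of `y` onto the Euclidean ball of radius `R` about `0`. -/
def IsMahalanobisProj {d : ℕ} (M : Matrix (Fin d) (Fin d) ℝ) (R : ℝ)
    (y p : EuclideanSpace ℝ (Fin d)) : Prop :=
  ‖p‖ ≤ R ∧ ∀ w : EuclideanSpace ℝ (Fin d), ‖w‖ ≤ R →
    mahalanobisSq M (p - y) ≤ mahalanobisSq M (w - y)

/-- `v` and `A` are the iterates and the matrices of LightONS.Core on the ball of radius `D / 2`,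
with curvature parameter `γ`, preconditioner coefficient `ε` and hysteresis coefficient `k`, when
it receives the gradients `z`, and when its projection in round `t` returns a point of the ball
within the distance `ζ t` of the exact Mahalanobis projection. -/
structure IsLightONSCore {d : ℕ} (γ ε k D : ℝ) (ζ : ℕ → ℝ)
    (z v : ℕ → EuclideanSpace ℝ (Fin d)) (A : ℕ → Matrix (Fin d) (Fin d) ℝ) : Prop where
  start : v 0 = 0
  matrix : ∀ t, A t = ε • (1 : Matrix (Fin d) (Fin d) ℝ) +
    ∑ s ∈ range (t + 1), Matrix.vecMulVec (fun i => z s i) (fun i => z s i)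
  keep : ∀ t, ‖v t - (1 / γ) • Matrix.toEuclideanLin (A t)⁻¹ (z t)‖ ≤ k * D / 2 →
    v (t + 1) = v t - (1 / γ) • Matrix.toEuclideanLin (A t)⁻¹ (z t)
  project : ∀ t, k * D / 2 < ‖v t - (1 / γ) • Matrix.toEuclideanLin (A t)⁻¹ (z t)‖ →
    ‖v (t + 1)‖ ≤ D / 2 ∧
    ∃ p, IsMahalanobisProj (A t) (D / 2) (v t - (1 / γ) • Matrix.toEuclideanLin (A t)⁻¹ (z t)) p ∧
      ‖v (t + 1) - p‖ ≤ ζ t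

/-- Coin betting: starting from the wealth `ε₀`, the decision of round `t` is the fraction `v t` of
the current wealth `W t`, and the wealth decreases by the linearized loss `⟪g t, x t⟫`. -/
structure IsCoinBetting {d : ℕ} (ε₀ : ℝ) (g v x : ℕ → EuclideanSpace ℝ (Fin d))
    (W : ℕ → ℝ) : Prop where
  start : W 0 = ε₀
  bet : ∀ t, x t = W t • v t
  wealth : ∀ t, W (t + 1) = W t - inner ℝ (g t) (x t)

/-- The curvature parameter: the largest `γ` with `log (1 + s) ≤ s - γ / 2 * s ^ 2` for
`-1 < s ≤ 6`. -/
noncomputable def curvature : ℝ := (6 - Real.log 7) / 18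

/-- The decisions `x` are those of coin betting with initial wealth `ε₀` on the gradients `g`, where
the betting fractions `v` are the iterates of LightONS.Core on the ball of radius `1 / 2`, with
hysteresis coefficient `3 / 2` and preconditioner coefficient `d`, run on the losses
`v ↦ - log (1 - ⟪g t, v⟫)`, whose gradient at `v t` is `(1 - ⟪g t, v t⟫)⁻¹ • g t`. The accuracy of
the projections is that of LightONS, for gradients `z` of norm at most `4`. -/
def IsCoinBettingLightONS {d : ℕ} (ε₀ : ℝ) (g x : ℕ → EuclideanSpace ℝ (Fin d)) : Prop :=
  ∃ (v : ℕ → EuclideanSpace ℝ (Fin d)) (A : ℕ → Matrix (Fin d) (Fin d) ℝ) (W : ℕ → ℝ),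
    IsCoinBetting ε₀ g v x W ∧
    IsLightONSCore curvature d (3 / 2) 1
      (fun t => curvature / (3 * (16 * ((t : ℝ) + 1) + d) * ((t : ℝ) + 1) ^ 2))
      (fun t => (1 - inner ℝ (g t) (v t))⁻¹ • g t) v A

end UnboundedOCO

namespace RealMachine

/-! ### Uniform computability with a cost bound -/

/-! Regret bound. By the subgradient inequality the regret is at most `∑ ⟪g t, x t - u⟫ = ε₀ - W T -
∑ ⟪g t, u⟫`, so a large final wealth forces a small regret. The wealth is a product of factors `1 -
⟪g t, v t⟫`, hence its logarithm is minus the total loss of the fractions `v t` under `v ↦ -log (1 -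
⟪g t, v⟫)`. These losses have curvature `γ` in the gradient direction, and the Online Newton Step
has regret `O(d log (2 + G))` on them against every fixed fraction of norm at most `1 / 2`
(`IsBettingCore.log_regret_le`). A fixed fraction `w` earns log wealth at least `-∑ ⟪g t, w⟫ - 2 ∑
⟪g t, w⟫ ^ 2`. Taking `w` parallel to `u` with norm `β` and passing from log wealth to regret by
convex duality (`mul_log_sub_le`) gives `linear_regret_le`; optimizing `β`, which only the analysis
does, gives `regret_bound`.

Running time. A Newton step costs `O(d ^ 2)`, because the inverse preconditioner is kept in memory
and updated by the Sherman–Morrison formula. Only projections are expensive, and the hysteresis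
makes them rare: iterates may drift out to norm `3 / 4`, whereas a projection brings them back to
norm `1 / 2`, so each projection is paid for by a distance of at least `1 / 4`. The squared lengths
of the Newton directions telescope against the trace of the inverse preconditioner, which starts at
`tr (d I)⁻¹ = 1`. By Cauchy–Schwarz the path has length `O(√T)`, and so there are `O(√T)`
projections (`IsBettingCore.card_projections_le_sqrt`). A projection is a bisection for the Lagrange
multiplier of the ball, each step of which inverts one positive definite matrix in `O(d ^ ω)` by
recursion on Schur complements (`comp_inv`). Since no projection occurs before round `Ω(d)`, the
number of bisection steps in a projecting round is logarithmic in the round number alone, without a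
`log d` (`exists_bisectionLength_le`).

Programs are hardly ever written out. The relation `Comp` asserts that one program, with one
constant, serves a whole family of inputs, and it is closed under composition, branching, folds and
loops. The index type of the family carries the side conditions and makes uniformity in `d`
automatic. -/

theorem Eval.pos {ρ : Option Code} {p : Code} {x y : Data} {n : ℕ} (h : Eval ρ p x y n) :
    1 ≤ n := by
  cases h <;> omega

/-- A program without calls to an enclosing procedure runs in the same way in every context. -/
theorem Eval.of_none {p : Code} {x y : Data} {n : ℕ} (h : Eval none p x y n) (ρ : Option Code) :
    Eval ρ p x y n := by
  generalize hσ : (none : Option Code) = σ at h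
  induction h with
  | id => exact .id _ _
  | nil => exact .nil _ _
  | const => exact .const _ _ _
  | fst => exact .fst _ _ _
  | snd => exact .snd _ _ _
  | pair _ _ ih₁ ih₂ => exact .pair (ih₁ hσ) (ih₂ hσ)
  | comp _ _ ih₁ ih₂ => exact .comp (ih₁ hσ) (ih₂ hσ)
  | add => exact .add _ _ _
  | sub => exact .sub _ _ _
  | mul => exact .mul _ _ _
  | div _ _ _ hb => exact .div _ _ _ hb
  | sqrt _ _ ha => exact .sqrt _ _ ha
  | ifLe_true hab _ ih => exact .ifLe_true hab (ih hσ)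
  | ifLe_false hab _ ih => exact .ifLe_false hab (ih hσ)
  | ifNil_nil _ ih => exact .ifNil_nil (ih hσ)
  | ifNil_pair _ ih => exact .ifNil_pair (ih hσ)
  | fix h _ => exact .fix h
  | self _ _ => exact absurd hσ (by simp)

/-- One program maps every `X i` to `Y i` within `O(c i)` steps. -/
def Comp {I : Type} (X Y : I → Data) (c : I → ℝ) : Prop :=
  ∃ (p : Code) (C : ℝ), 0 ≤ C ∧ ∀ i, ∃ k : ℕ, Eval none p (X i) (Y i) k ∧ (k : ℝ) ≤ C * c i

variable {I J : Type}

namespace Comp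

variable {X Y Z : I → Data} {c c' : I → ℝ}

theorem of_eval (p : Code) (n : ℕ) (hc : ∀ i, 1 ≤ c i) (h : ∀ i, Eval none p (X i) (Y i) n) :
    Comp X Y c :=
  ⟨p, n, by positivity, fun i => ⟨n, h i, le_mul_of_one_le_right (by positivity) (hc i)⟩⟩

theorem mono (h : Comp X Y c) (D : ℝ) (hD : 0 ≤ D) (hc : ∀ i, c i ≤ D * c' i) : Comp X Y c' := by
  obtain ⟨p, C, hC, h⟩ := h
  refine ⟨p, C * D, by positivity, fun i => ?_⟩
  obtain ⟨k, hk, hle⟩ := h i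
  exact ⟨k, hk, by nlinarith [mul_le_mul_of_nonneg_left (hc i) hC]⟩

theorem congr_right (h : Comp X Y c) (hYZ : ∀ i, Y i = Z i) : Comp X Z c := by
  rwa [← funext hYZ]

theorem reindex (h : Comp X Y c) (e : J → I) :
    Comp (fun j => X (e j)) (fun j => Y (e j)) fun j => c (e j) := by
  obtain ⟨p, C, hC, h⟩ := h
  exact ⟨p, C, hC, fun j => h (e j)⟩

theorem trans (h₁ : Comp X Y c) (h₂ : Comp Y Z c) : Comp X Z c := by
  obtain ⟨p, C, hC, h₁⟩ := h₁
  obtain ⟨q, D, hD, h₂⟩ := h₂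
  -- The extra unit of a composition is absorbed by `1 ≤ k`, which is why the first constant is
  -- doubled.
  refine ⟨.comp q p, 2 * C + D, by positivity, fun i => ?_⟩
  obtain ⟨k, hk, hle⟩ := h₁ i
  obtain ⟨l, hl, hle'⟩ := h₂ i
  refine ⟨_, .comp hk hl, ?_⟩
  have : (1 : ℝ) ≤ k := by exact_mod_cast hk.pos
  push_cast
  linarith

theorem pair (h₁ : Comp X Y c) (h₂ : Comp X Z c) :
    Comp X (fun i => Data.pair (Y i) (Z i)) c := by
  obtain ⟨p, C, hC, h₁⟩ := h₁
  obtain ⟨q, D, hD, h₂⟩ := h₂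
  refine ⟨.pair p q, 2 * C + D, by positivity, fun i => ?_⟩
  obtain ⟨k, hk, hle⟩ := h₁ i
  obtain ⟨l, hl, hle'⟩ := h₂ i
  refine ⟨_, .pair hk hl, ?_⟩
  have : (1 : ℝ) ≤ k := by exact_mod_cast hk.pos
  push_cast
  linarith

theorem id (hc : ∀ i, 1 ≤ c i) : Comp X X c :=
  of_eval .id 1 hc fun _ => .id _ _

theorem nil (hc : ∀ i, 1 ≤ c i) : Comp X (fun _ => Data.nil) c :=
  of_eval .nil 1 hc fun _ => .nil _ _

theorem const (r : ℝ) (hc : ∀ i, 1 ≤ c i) : Comp X (fun _ => Data.real r) c :=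
  of_eval (.const r) 1 hc fun _ => .const _ _ _

/-- Running a unit-cost program on a computed datum. -/
theorem then_unit (p : Code) (h : Comp X Y c) (hp : ∀ i, Eval none p (Y i) (Z i) 1) :
    Comp X Z c := by
  obtain ⟨q, C, hC, h⟩ := h
  refine ⟨.comp p q, 3 * C, by positivity, fun i => ?_⟩
  obtain ⟨k, hk, hle⟩ := h i
  refine ⟨_, .comp hk (hp i), ?_⟩
  have : (1 : ℝ) ≤ k := by exact_mod_cast hk.pos
  push_cast
  linarith

theorem fst {a b : I → Data} (h : Comp X (fun i => Data.pair (a i) (b i)) c) : Comp X a c :=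
  h.then_unit .fst fun _ => .fst _ _ _

theorem snd {a b : I → Data} (h : Comp X (fun i => Data.pair (a i) (b i)) c) : Comp X b c :=
  h.then_unit .snd fun _ => .snd _ _ _

theorem add {a b : I → ℝ} (h₁ : Comp X (fun i => Data.real (a i)) c)
    (h₂ : Comp X (fun i => Data.real (b i)) c) : Comp X (fun i => Data.real (a i + b i)) c :=
  (h₁.pair h₂).then_unit .add fun _ => .add _ _ _

theorem sub {a b : I → ℝ} (h₁ : Comp X (fun i => Data.real (a i)) c)
    (h₂ : Comp X (fun i => Data.real (b i)) c) : Comp X (fun i => Data.real (a i - b i)) c :=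
  (h₁.pair h₂).then_unit .sub fun _ => .sub _ _ _

theorem mul {a b : I → ℝ} (h₁ : Comp X (fun i => Data.real (a i)) c)
    (h₂ : Comp X (fun i => Data.real (b i)) c) : Comp X (fun i => Data.real (a i * b i)) c :=
  (h₁.pair h₂).then_unit .mul fun _ => .mul _ _ _

theorem div {a b : I → ℝ} (h₁ : Comp X (fun i => Data.real (a i)) c)
    (h₂ : Comp X (fun i => Data.real (b i)) c) (hb : ∀ i, b i ≠ 0) :
    Comp X (fun i => Data.real (a i / b i)) c :=
  (h₁.pair h₂).then_unit .div fun i => .div _ _ _ (hb i)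

theorem sqrt {a : I → ℝ} (h : Comp X (fun i => Data.real (a i)) c) (ha : ∀ i, 0 ≤ a i) :
    Comp X (fun i => Data.real (Real.sqrt (a i))) c :=
  h.then_unit .sqrt fun i => .sqrt _ _ (ha i)

/-- Calling a program that is uniform in another index. -/
theorem call {U V : J → Data} {cJ : J → ℝ} (h : Comp U V cJ) (e : I → J)
    (hX : Comp X (fun i => U (e i)) c) (D : ℝ) (hD : 0 ≤ D) (hc : ∀ i, cJ (e i) ≤ D * c i) :
    Comp X (fun i => V (e i)) c :=
  hX.trans ((h.reindex e).mono D hD hc)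

/-- Each branch is indexed by the inputs that reach it, so it may use the outcome of the comparison
as a hypothesis. -/
theorem ite_le {a b : I → ℝ} (ha : Comp X (fun i => Data.real (a i)) c)
    (hb : Comp X (fun i => Data.real (b i)) c) (hX : Comp X X c)
    (h₁ : Comp (I := {i // a i ≤ b i}) (fun i => X i) (fun i => Y i) fun i => c i)
    (h₂ : Comp (I := {i // b i < a i}) (fun i => X i) (fun i => Y i) fun i => c i) :
    Comp X Y c := by
  obtain ⟨t, C, hC, ht⟩ := (ha.pair hb).pair hX
  obtain ⟨p, P, hP, hp⟩ := h₁
  obtain ⟨q, Q, hQ, hq⟩ := h₂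
  refine ⟨.comp (.ifLe p q) t, 3 * C + P + Q, by positivity, fun i => ?_⟩
  obtain ⟨k, hk, hle⟩ := ht i
  have hk1 : (1 : ℝ) ≤ k := by exact_mod_cast hk.pos
  -- Every run takes at least one step, so `c i` cannot be nonpositive; this allows the constant of
  -- the branch not taken to be added.
  have hci : 0 < c i := by
    by_contra hneg
    nlinarith
  rcases le_or_gt (a i) (b i) with hab | hab
  · obtain ⟨l, hl, hle'⟩ := hp ⟨i, hab⟩
    refine ⟨_, .comp hk (.ifLe_true hab hl), ?_⟩
    push_cast
    nlinarith [mul_nonneg hQ hci.le]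
  · obtain ⟨l, hl, hle'⟩ := hq ⟨i, hab⟩
    refine ⟨_, .comp hk (.ifLe_false hab hl), ?_⟩
    push_cast
    nlinarith [mul_nonneg hP hci.le]

end Comp

/-! ### Loops -/

theorem ofList_ofFn_succ {n : ℕ} (a : Fin (n + 1) → Data) :
    Data.ofList (List.ofFn a) = Data.pair (a 0) (Data.ofList (List.ofFn fun j => a j.succ)) := by
  rw [List.ofFn_succ]
  rfl

/-- Body of the procedure folding `p` from the right over two lists of the same length. -/
def foldBody (p : Code) : Code :=
  .ifNil (.comp .fst .snd)
    (.comp p (.pair (.comp .fst .fst) (.pair (.comp .fst (.comp .fst .snd)) (.pair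
      (.comp .self (.pair (.comp .snd .fst)
        (.pair (.comp .snd (.comp .fst .snd)) (.comp .snd .snd))))
      (.comp .snd (.comp .snd .snd))))))

/-- The fold runs from the right: `s (Fin.last n)` is the initial state, `s 0` the result, and `p`
leads from `s j.succ` to `s j.castSucc`. The number `33` covers what one layer spends outside `p`
and the recursive call. -/
theorem eval_foldBody {p : Code} {env : Data} {K : ℕ} : ∀ {n : ℕ} (a b : Fin n → Data)
    (s : Fin (n + 1) → Data),
    (∀ j : Fin n, ∃ k ≤ K, Eval none p (.pair (a j) (.pair (b j) (.pair (s j.succ) env)))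
      (s j.castSucc) k) →
    ∃ k ≤ (n + 1) * (K + 33), Eval (some (foldBody p)) (foldBody p)
      (.pair (Data.ofList (List.ofFn a)) (.pair (Data.ofList (List.ofFn b))
        (.pair (s (Fin.last n)) env))) (s 0) k := by
  intro n
  induction n with
  | zero =>
    intro a b s _
    exact ⟨_, by omega, .ifNil_nil (.comp (.snd _ _ _) (.fst _ _ _))⟩
  | succ n ih =>
    intro a b s h
    obtain ⟨k, hk, hev⟩ := ih (fun j => a j.succ) (fun j => b j.succ) (fun j => s j.succ)
      fun j => h j.succ
    obtain ⟨l, hl, hp⟩ := h 0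
    rw [ofList_ofFn_succ, ofList_ofFn_succ]
    refine ⟨_, ?_, .ifNil_pair (.comp (.pair (.comp (.fst _ _ _) (.fst _ _ _))
      (.pair (.comp (.comp (.snd _ _ _) (.fst _ _ _)) (.fst _ _ _)) (.pair
        (.comp (.pair (.comp (.fst _ _ _) (.snd _ _ _))
          (.pair (.comp (.comp (.snd _ _ _) (.fst _ _ _)) (.snd _ _ _))
            (.comp (.snd _ _ _) (.snd _ _ _)))) (.self hev))
        (.comp (.comp (.snd _ _ _) (.snd _ _ _)) (.snd _ _ _))))) (hp.of_none _))⟩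
    have : (n + 1 + 1) * (K + 33) = (n + 1) * (K + 33) + (K + 33) := by ring
    omega

/-- Body of the procedure repeating `p` as long as `t` yields a positive number. -/
def whileBody (t p : Code) : Code :=
  .comp (.ifLe .id (.comp .self p)) (.pair (.pair t (.const 0)) .id)

/-- The procedure does not know `n`: it stops at the first state whose test value is not positive.
One bound `K` serves both the test and the body. -/
theorem eval_whileBody {t p : Code} {K : ℕ} : ∀ (n : ℕ) (s : ℕ → Data) (τ : ℕ → ℝ),
    (∀ j ≤ n, ∃ k ≤ K, Eval none t (s j) (.real (τ j)) k) → (∀ j < n, 0 < τ j) → τ n ≤ 0 →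
    (∀ j < n, ∃ k ≤ K, Eval none p (s j) (s (j + 1)) k) →
    ∃ k ≤ (n + 1) * (2 * K + 9), Eval (some (whileBody t p)) (whileBody t p) (s 0) (s n) k := by
  intro n
  induction n with
  | zero =>
    intro s τ ht _ h0 _
    obtain ⟨k, hk, hev⟩ := ht 0 le_rfl
    exact ⟨_, by omega, .comp (.pair (.pair (hev.of_none _) (.const _ _ _)) (.id _ _))
      (.ifLe_true h0 (.id _ _))⟩
  | succ n ih =>
    intro s τ ht hpos h0 hp
    obtain ⟨k, hk, hev⟩ := ht 0 (by omega)
    obtain ⟨l, hl, hpe⟩ := hp 0 (by omega)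
    obtain ⟨m, hm, hrec⟩ := ih (fun j => s (j + 1)) (fun j => τ (j + 1))
      (fun j hj => ht (j + 1) (by omega)) (fun j hj => hpos (j + 1) (by omega)) h0
      fun j hj => hp (j + 1) (by omega)
    refine ⟨_, ?_, .comp (.pair (.pair (hev.of_none _) (.const _ _ _)) (.id _ _))
      (.ifLe_false (hpos 0 (by omega)) (.comp (hpe.of_none _) (.self hrec)))⟩
    have : (n + 1 + 1) * (2 * K + 9) = (n + 1) * (2 * K + 9) + (2 * K + 9) := by ring
    omega

namespace Comp

variable {X Y Z : I → Data} {c cb : I → ℝ}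

/-- The body is a family over all pairs of an input and a position, so a single program serves every
iteration on every input. It receives the original input as an environment. -/
theorem fold {n : I → ℕ} (a b : ∀ i, Fin (n i) → Data) (s : ∀ i, Fin (n i + 1) → Data)
    (ha : Comp X (fun i => Data.ofList (List.ofFn (a i))) c)
    (hb : Comp X (fun i => Data.ofList (List.ofFn (b i))) c)
    (hs : Comp X (fun i => s i (Fin.last _)) c) (hX : Comp X X c) (hcb : ∀ i, 1 ≤ cb i)
    (hbody : Comp (I := Σ i, Fin (n i))
      (fun q => .pair (a q.1 q.2) (.pair (b q.1 q.2) (.pair (s q.1 q.2.succ) (X q.1))))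
      (fun q => s q.1 q.2.castSucc) fun q => cb q.1)
    (D : ℝ) (hD : 0 ≤ D) (hc : ∀ i, ((n i : ℝ) + 1) * cb i ≤ D * c i) :
    Comp X (fun i => s i 0) c := by
  refine (ha.pair (hb.pair (hs.pair hX))).trans ?_
  obtain ⟨p, C, hC, hp⟩ := hbody
  refine ⟨.fix (foldBody p), (C + 34) * D, by positivity, fun i => ?_⟩
  obtain ⟨k, hk, hev⟩ := eval_foldBody (p := p) (env := X i) (K := ⌊C * cb i⌋₊) (a i) (b i) (s i)
    fun j => by
      obtain ⟨k, hk, hle⟩ := hp ⟨i, j⟩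
      exact ⟨k, Nat.le_floor hle, hk⟩
  refine ⟨_, .fix hev, ?_⟩
  have h1 : ((⌊C * cb i⌋₊ : ℕ) : ℝ) ≤ C * cb i :=
    Nat.floor_le (mul_nonneg hC (zero_le_one.trans (hcb i)))
  have h2 : (k : ℝ) ≤ ((n i : ℝ) + 1) * (⌊C * cb i⌋₊ + 33) := by exact_mod_cast hk
  have h3 : ((n i : ℝ) + 1) * (⌊C * cb i⌋₊ + 33) ≤ ((n i : ℝ) + 1) * ((C + 33) * cb i) := by
    gcongr
    linarith [hcb i]
  have h4 : (1 : ℝ) ≤ ((n i : ℝ) + 1) * cb i := by nlinarith [hcb i, Nat.cast_nonneg (α := ℝ) (n i)]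
  push_cast
  calc (k : ℝ) + 1 ≤ ((n i : ℝ) + 1) * ((C + 33) * cb i) + ((n i : ℝ) + 1) * cb i := by linarith
    _ = (C + 34) * (((n i : ℝ) + 1) * cb i) := by ring
    _ ≤ (C + 34) * (D * c i) := mul_le_mul_of_nonneg_left (hc i) (by positivity)
    _ = _ := by ring

/-- Entrywise combination of two lists; the body also sees the environment. -/
theorem map₂ {n : I → ℕ} (a b w : ∀ i, Fin (n i) → Data)
    (ha : Comp X (fun i => Data.ofList (List.ofFn (a i))) c)
    (hb : Comp X (fun i => Data.ofList (List.ofFn (b i))) c) (hX : Comp X X c)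
    (hc1 : ∀ i, 1 ≤ c i) (hcb : ∀ i, 1 ≤ cb i)
    (hbody : Comp (I := Σ i, Fin (n i)) (fun q => .pair (a q.1 q.2) (.pair (b q.1 q.2) (X q.1)))
      (fun q => w q.1 q.2) fun q => cb q.1)
    (D : ℝ) (hD : 0 ≤ D) (hc : ∀ i, ((n i : ℝ) + 1) * cb i ≤ D * c i) :
    Comp X (fun i => Data.ofList (List.ofFn (w i))) c := by
  -- The state at position `j` is the tail of the result from `j` on; each iteration puts one entry
  -- in front of it.
  have key := fold (X := X) (c := c) (cb := cb) a b
    (fun i j => Data.ofList ((List.ofFn (w i)).drop j)) ha hb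
    (by
      have h0 : ∀ i, List.drop (n i) (List.ofFn (w i)) = [] := fun i =>
        List.drop_eq_nil_of_le (by simp)
      simpa only [Fin.val_last, h0, Data.ofList] using nil hc1) hX hcb ?_ D hD hc
  · simpa using key
  · have hid := id (X := fun q : Σ i, Fin (n i) => Data.pair (a q.1 q.2) (.pair (b q.1 q.2) (.pair
      (Data.ofList ((List.ofFn (w q.1)).drop q.2.succ)) (X q.1)))) (c := fun q => cb q.1)
      fun q => hcb q.1
    have h1 := ((hid.fst.pair (hid.snd.fst.pair hid.snd.snd.snd)).trans hbody).pair hid.snd.snd.fst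
    have : ∀ q : Σ i, Fin (n i), Data.ofList ((List.ofFn (w q.1)).drop q.2.castSucc) =
        .pair (w q.1 q.2) (Data.ofList ((List.ofFn (w q.1)).drop q.2.succ)) := by
      intro q
      rw [Fin.val_castSucc, Fin.val_succ, List.drop_eq_getElem_cons (by simp)]
      simp [Data.ofList]
    simpa only [this] using h1

/-- The iteration count `n i` occurs in the specification and in the cost only; the program sees
nothing but the sign of `τ`. -/
theorem loop {n : I → ℕ} (s : I → ℕ → Data) (τ : I → ℕ → ℝ)
    (hs : Comp X (fun i => s i 0) c) (hcb : ∀ i, 1 ≤ cb i)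
    (htest : Comp (I := Σ i, Fin (n i + 1)) (fun q => s q.1 q.2) (fun q => .real (τ q.1 q.2))
      fun q => cb q.1)
    (hbody : Comp (I := Σ i, Fin (n i)) (fun q => s q.1 q.2) (fun q => s q.1 (q.2 + 1))
      fun q => cb q.1)
    (hpos : ∀ i, ∀ j < n i, 0 < τ i j) (hnonpos : ∀ i, τ i (n i) ≤ 0)
    (D : ℝ) (hD : 0 ≤ D) (hc : ∀ i, ((n i : ℝ) + 1) * cb i ≤ D * c i) :
    Comp X (fun i => s i (n i)) c := by
  refine hs.trans ?_
  obtain ⟨t, B, hB, ht⟩ := htest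
  obtain ⟨p, C, hC, hp⟩ := hbody
  refine ⟨.fix (whileBody t p), (2 * (B + C) + 10) * D, by positivity, fun i => ?_⟩
  have hcb0 : 0 ≤ cb i := zero_le_one.trans (hcb i)
  obtain ⟨k, hk, hev⟩ := eval_whileBody (t := t) (p := p) (K := ⌊(B + C) * cb i⌋₊) (n i) (s i) (τ i)
    (fun j hj => by
      obtain ⟨k, hk, hle⟩ := ht ⟨i, ⟨j, by omega⟩⟩
      exact ⟨k, Nat.le_floor (hle.trans (by nlinarith)), hk⟩) (hpos i) (hnonpos i)
    (fun j hj => by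
      obtain ⟨k, hk, hle⟩ := hp ⟨i, ⟨j, hj⟩⟩
      exact ⟨k, Nat.le_floor (hle.trans (by nlinarith)), hk⟩)
  refine ⟨_, .fix hev, ?_⟩
  have h1 : ((⌊(B + C) * cb i⌋₊ : ℕ) : ℝ) ≤ (B + C) * cb i := Nat.floor_le (by positivity)
  have h2 : (k : ℝ) ≤ ((n i : ℝ) + 1) * (2 * ⌊(B + C) * cb i⌋₊ + 9) := by exact_mod_cast hk
  have h3 : ((n i : ℝ) + 1) * (2 * ⌊(B + C) * cb i⌋₊ + 9) ≤
      ((n i : ℝ) + 1) * ((2 * (B + C) + 9) * cb i) := by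
    gcongr
    linarith [hcb i]
  have h4 : (1 : ℝ) ≤ ((n i : ℝ) + 1) * cb i := by nlinarith [hcb i, Nat.cast_nonneg (α := ℝ) (n i)]
  push_cast
  calc (k : ℝ) + 1 ≤ ((n i : ℝ) + 1) * ((2 * (B + C) + 9) * cb i) + ((n i : ℝ) + 1) * cb i := by
        linarith
    _ = (2 * (B + C) + 10) * (((n i : ℝ) + 1) * cb i) := by ring
    _ ≤ (2 * (B + C) + 10) * (D * c i) := mul_le_mul_of_nonneg_left (hc i) (by positivity)
    _ = _ := by ring

end Comp

variable {I J : Type}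

namespace Comp

variable {X Y Z : I → Data} {c cb : I → ℝ}

/-! ### Vectors -/

/-- Scalar multiples, sums and differences are all special cases. The factor `4` in the size
conditions, here and below, is slack: `(d + 1) ^ 2 ≤ 4 * d ^ 2` for `1 ≤ d`, so a budget of `d ^ 2`
qualifies for matrix operations. -/
theorem vlin {n : I → ℕ} {a b : I → ℝ} {u v : ∀ i, Fin (n i) → ℝ}
    (ha : Comp X (fun i => .real (a i)) c) (hb : Comp X (fun i => .real (b i)) c)
    (hu : Comp X (fun i => .ofVec (u i)) c) (hv : Comp X (fun i => .ofVec (v i)) c)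
    (hc1 : ∀ i, 1 ≤ c i) (hn : ∀ i, (n i : ℝ) + 1 ≤ 4 * c i) :
    Comp X (fun i => .ofVec (a i • u i + b i • v i)) c := by
  refine (ha.pair (hb.pair (hu.pair hv))).trans ?_
  have hid := id (X := fun i => Data.pair (.real (a i)) (.pair (.real (b i))
    (.pair (.ofVec (u i)) (.ofVec (v i))))) (c := c) hc1
  refine map₂ (cb := fun _ => 1) (fun i j => .real (u i j)) (fun i j => .real (v i j))
    (fun i j => .real ((a i • u i + b i • v i) j)) hid.snd.snd.fst hid.snd.snd.snd hid hc1
    (fun _ => le_rfl) ?_ 4 (by norm_num) (by simpa using hn)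
  have hq := id (X := fun q : Σ i, Fin (n i) => Data.pair (.real (u q.1 q.2)) (.pair
    (.real (v q.1 q.2)) (Data.pair (.real (a q.1)) (.pair (.real (b q.1))
    (.pair (.ofVec (u q.1)) (.ofVec (v q.1))))))) (c := fun _ => 1) fun _ => le_rfl
  exact (hq.snd.snd.fst.mul hq.fst).add (hq.snd.snd.snd.fst.mul hq.snd.fst)

theorem dot {n : I → ℕ} {u v : ∀ i, Fin (n i) → ℝ}
    (hu : Comp X (fun i => .ofVec (u i)) c) (hv : Comp X (fun i => .ofVec (v i)) c)
    (hc1 : ∀ i, 1 ≤ c i) (hn : ∀ i, (n i : ℝ) + 1 ≤ 4 * c i) :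
    Comp X (fun i => .real (u i ⬝ᵥ v i)) c := by
  refine (hu.pair hv).trans ?_
  have hid := id (X := fun i => Data.pair (.ofVec (u i)) (.ofVec (v i))) (c := c) hc1
  have key := fold (X := fun i => Data.pair (.ofVec (u i)) (.ofVec (v i))) (c := c)
    (cb := fun _ => 1) (fun i j => .real (u i j)) (fun i j => .real (v i j))
    (fun i j => .real ((List.ofFn fun k => u i k * v i k).drop j).sum)
    hid.fst hid.snd ?_ hid (fun _ => le_rfl) ?_ 4 (by norm_num) (by simpa using hn)
  · simpa [dotProduct, List.sum_ofFn] using key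
  · have h0 : ∀ i, List.drop (n i) (List.ofFn fun k => u i k * v i k) = [] := fun i =>
      List.drop_eq_nil_of_le (by simp)
    simpa only [Fin.val_last, h0, List.sum_nil] using const 0 hc1
  · have hq := id (X := fun q : Σ i, Fin (n i) => Data.pair (.real (u q.1 q.2)) (.pair
      (.real (v q.1 q.2)) (.pair (.real ((List.ofFn fun k => u q.1 k * v q.1 k).drop q.2.succ).sum)
      (.pair (.ofVec (u q.1)) (.ofVec (v q.1)))))) (c := fun _ => 1) fun _ => le_rfl
    have : ∀ q : Σ i, Fin (n i), ((List.ofFn fun k => u q.1 k * v q.1 k).drop q.2.castSucc).sum =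
        u q.1 q.2 * v q.1 q.2 + ((List.ofFn fun k => u q.1 k * v q.1 k).drop q.2.succ).sum := by
      intro q
      rw [Fin.val_castSucc, Fin.val_succ, List.drop_eq_getElem_cons (by simp)]
      simp
    simpa only [this] using (hq.fst.mul hq.snd.fst).add hq.snd.snd.fst

/-- The vector `(0, 1, …, n - 1)` is built from the number `n`. -/
theorem index {n : I → ℕ} (hn : Comp X (fun i => .real (n i)) c) (hc1 : ∀ i, 1 ≤ c i)
    (hnc : ∀ i, (n i : ℝ) + 1 ≤ 4 * c i) :
    Comp X (fun i => .ofVec fun j : Fin (n i) => (j : ℝ)) c := by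
  have key := loop (X := X) (c := c) (cb := fun _ => 1) (n := n)
    (fun i j => .pair (.real ((n i : ℝ) - j))
      (.ofVec fun k : Fin j => (n i : ℝ) - j + (k : ℝ))) (fun i j => (n i : ℝ) - j)
    ?_ (fun _ => le_rfl) ?_ ?_ (fun i j hj => by simpa using hj) (by simp) 4 (by norm_num)
    (by simpa using hnc)
  · simpa using key.snd
  · exact (hn.pair (nil hc1)).congr_right fun i => by simp [Data.ofVec, Data.ofList]
  · exact (id fun _ => le_rfl).fst
  · have hq := id (X := fun q : Σ i, Fin (n i) => Data.pair (.real ((n q.1 : ℝ) - (q.2 : ℕ)))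
      (.ofVec fun k : Fin q.2 => (n q.1 : ℝ) - (q.2 : ℕ) + (k : ℝ))) (c := fun _ => 1) fun _ => le_rfl
    have h1 := hq.fst.sub (const 1 fun _ => le_rfl)
    have h2 := h1.pair (h1.pair hq.snd)
    have e1 : ∀ q : Σ i, Fin (n i),
        (Data.ofVec fun k : Fin (q.2 + 1) => (n q.1 : ℝ) - ((q.2 : ℕ) + 1 : ℕ) + (k : ℝ)) =
        .pair (.real ((n q.1 : ℝ) - (q.2 : ℕ) - 1))
          (.ofVec fun k : Fin q.2 => (n q.1 : ℝ) - (q.2 : ℕ) + (k : ℝ)) := by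
      intro q
      rw [Data.ofVec, ofList_ofFn_succ, Data.ofVec]
      congr 1
      · congr 1
        simp
        ring
      · congr 2
        ext k
        congr 1
        simp
        ring
    have e2 : ∀ q : Σ i, Fin (n i), (n q.1 : ℝ) - ((q.2 : ℕ) + 1 : ℕ) =
        (n q.1 : ℝ) - (q.2 : ℕ) - 1 := by
      intro q
      push_cast
      ring
    exact h2.congr_right fun q => by rw [e1 q, e2 q]

/-- Any list of the right length will do; the index vector is combined with itself with coefficients
`0`. -/
theorem zeroVec {n : I → ℕ} (hn : Comp X (fun i => .real (n i)) c) (hc1 : ∀ i, 1 ≤ c i)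
    (hnc : ∀ i, (n i : ℝ) + 1 ≤ 4 * c i) :
    Comp X (fun i => .ofVec (0 : Fin (n i) → ℝ)) c := by
  have h := hn.index hc1 hnc
  simpa using vlin (const 0 hc1) (const 0 hc1) h h hc1 hnc

theorem append {m n : I → ℕ} {a : ∀ i, Fin (m i) → Data} {b : ∀ i, Fin (n i) → Data}
    (ha : Comp X (fun i => .ofList (List.ofFn (a i))) c)
    (hb : Comp X (fun i => .ofList (List.ofFn (b i))) c) (hc1 : ∀ i, 1 ≤ c i)
    (hm : ∀ i, (m i : ℝ) + 1 ≤ 4 * c i) :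
    Comp X (fun i => .ofList (List.ofFn (Fin.append (a i) (b i)))) c := by
  refine (ha.pair hb).trans ?_
  have hid := id (X := fun i => Data.pair (.ofList (List.ofFn (a i))) (.ofList (List.ofFn (b i))))
    (c := c) hc1
  have key := fold (X := fun i => Data.pair (.ofList (List.ofFn (a i))) (.ofList (List.ofFn (b i))))
    (c := c) (cb := fun _ => 1) a a
    (fun i j => .ofList ((List.ofFn (a i)).drop j ++ List.ofFn (b i)))
    hid.fst hid.fst ?_ hid (fun _ => le_rfl) ?_ 4 (by norm_num) (by simpa using hm)
  · simpa [List.ofFn_fin_append] using key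
  · have h0 : ∀ i, List.drop (m i) (List.ofFn (a i)) = [] := fun i =>
      List.drop_eq_nil_of_le (by simp)
    simpa only [Fin.val_last, h0, List.nil_append] using hid.snd
  · have hq := id (X := fun q : Σ i, Fin (m i) => Data.pair (a q.1 q.2) (.pair
      (a q.1 q.2) (.pair (.ofList ((List.ofFn (a q.1)).drop q.2.succ ++ List.ofFn (b q.1)))
      (.pair (.ofList (List.ofFn (a q.1))) (.ofList (List.ofFn (b q.1)))))))
      (c := fun _ => 1) fun _ => le_rfl
    have : ∀ q : Σ i, Fin (m i),
        Data.ofList ((List.ofFn (a q.1)).drop q.2.castSucc ++ List.ofFn (b q.1)) =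
        .pair (a q.1 q.2) (.ofList ((List.ofFn (a q.1)).drop q.2.succ ++ List.ofFn (b q.1))) := by
      intro q
      rw [Fin.val_castSucc, Fin.val_succ, List.drop_eq_getElem_cons (by simp)]
      simp [Data.ofList]
    simpa only [this] using hq.fst.pair hq.snd.snd.fst

end Comp

/-- Body of the procedure splitting a list after as many entries as a given list has. -/
def splitBody : Code :=
  .ifNil (.pair .nil .id)
    (.comp (.pair (.pair .fst (.comp .fst .snd)) (.comp .snd .snd))
      (.pair (.comp .fst .snd) (.comp .self (.pair (.comp .snd .fst) (.comp .snd .snd)))))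

theorem eval_splitBody {n : ℕ} (b : Fin n → Data) : ∀ {m : ℕ} (t a : Fin m → Data),
    ∃ k ≤ (m + 1) * 30, Eval (some splitBody) splitBody
      (.pair (.ofList (List.ofFn t)) (.ofList (List.ofFn (Fin.append a b))))
      (.pair (.ofList (List.ofFn a)) (.ofList (List.ofFn b))) k := by
  intro m
  induction m with
  | zero =>
    intro t a
    have : Data.ofList (List.ofFn (Fin.append a b)) = .ofList (List.ofFn b) := by
      simp only [List.ofFn_fin_append, List.ofFn_zero, List.nil_append]
    rw [this]
    exact ⟨_, by omega, .ifNil_nil (.pair (.nil _ _) (.id _ _))⟩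
  | succ m ih =>
    intro t a
    obtain ⟨k, hk, hev⟩ := ih (fun j => t j.succ) (fun j => a j.succ)
    have e : Data.ofList (List.ofFn (Fin.append a b)) =
        .pair (a 0) (.ofList (List.ofFn (Fin.append (fun j => a j.succ) b))) := by
      simp only [List.ofFn_fin_append, List.ofFn_succ]
      rfl
    rw [ofList_ofFn_succ t, ofList_ofFn_succ a, e]
    refine ⟨_, ?_, .ifNil_pair (.comp (.pair (.comp (.snd _ _ _) (.fst _ _ _))
      (.comp (.pair (.comp (.fst _ _ _) (.snd _ _ _)) (.comp (.snd _ _ _) (.snd _ _ _)))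
        (.self hev))) (.pair (.pair (.fst _ _ _) (.comp (.snd _ _ _) (.fst _ _ _)))
        (.comp (.snd _ _ _) (.snd _ _ _))))⟩
    omega

namespace Comp

variable {X Y Z : I → Data} {c cb : I → ℝ}

/-- The list `t` is a unary counter that marks where to cut; its entries play no role. -/
theorem split {m n : I → ℕ} {t a : ∀ i, Fin (m i) → Data} {b : ∀ i, Fin (n i) → Data}
    (ht : Comp X (fun i => .ofList (List.ofFn (t i))) c)
    (hab : Comp X (fun i => .ofList (List.ofFn (Fin.append (a i) (b i)))) c)
    (hm : ∀ i, (m i : ℝ) + 1 ≤ 4 * c i) :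
    Comp X (fun i => .pair (.ofList (List.ofFn (a i))) (.ofList (List.ofFn (b i)))) c := by
  refine (ht.pair hab).trans ⟨.fix splitBody, 124, by norm_num, fun i => ?_⟩
  obtain ⟨k, hk, hev⟩ := eval_splitBody (b i) (t i) (a i)
  refine ⟨_, .fix hev, ?_⟩
  have : (k : ℝ) ≤ ((m i : ℝ) + 1) * 30 := by exact_mod_cast hk
  push_cast
  nlinarith [hm i, Nat.cast_nonneg (α := ℝ) (m i)]

/-! ### Matrices -/

theorem mulVec {m n : I → ℕ} {A : ∀ i, Matrix (Fin (m i)) (Fin (n i)) ℝ} {v : ∀ i, Fin (n i) → ℝ}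
    (hA : Comp X (fun i => .ofMatrix (A i)) c) (hv : Comp X (fun i => .ofVec (v i)) c)
    (hc1 : ∀ i, 1 ≤ c i) (hmn : ∀ i, ((m i : ℝ) + 1) * (n i + 1) ≤ 4 * c i) :
    Comp X (fun i => .ofVec ((A i).mulVec (v i))) c := by
  refine (hA.pair hv).trans ?_
  have hid := id (X := fun i => Data.pair (.ofMatrix (A i)) (.ofVec (v i))) (c := c) hc1
  refine map₂ (cb := fun i => (n i : ℝ) + 1) (fun i j => .ofVec (A i j)) (fun i j => .ofVec (A i j))
    (fun i j => .real ((A i).mulVec (v i) j)) hid.fst hid.fst hid hc1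
    (fun i => by linarith [Nat.cast_nonneg (α := ℝ) (n i)]) ?_ 4 (by norm_num) hmn
  have hq1 : ∀ q : Σ i, Fin (m i), (1 : ℝ) ≤ (n q.1 : ℝ) + 1 := fun q => by
    linarith [Nat.cast_nonneg (α := ℝ) (n q.1)]
  have hq := id (X := fun q : Σ i, Fin (m i) => Data.pair (.ofVec (A q.1 q.2)) (.pair
    (.ofVec (A q.1 q.2)) (.pair (.ofMatrix (A q.1)) (.ofVec (v q.1)))))
    (c := fun q => (n q.1 : ℝ) + 1) hq1
  exact dot hq.fst hq.snd.snd.snd hq1 fun q => by linarith [hq1 q]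

/-- `A + a u vᵀ`. -/
theorem rankOne {m n : I → ℕ} {A : ∀ i, Matrix (Fin (m i)) (Fin (n i)) ℝ} {a : I → ℝ}
    {u : ∀ i, Fin (m i) → ℝ} {v : ∀ i, Fin (n i) → ℝ}
    (hA : Comp X (fun i => .ofMatrix (A i)) c) (ha : Comp X (fun i => .real (a i)) c)
    (hu : Comp X (fun i => .ofVec (u i)) c) (hv : Comp X (fun i => .ofVec (v i)) c)
    (hc1 : ∀ i, 1 ≤ c i) (hmn : ∀ i, ((m i : ℝ) + 1) * (n i + 1) ≤ 4 * c i) :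
    Comp X (fun i => .ofMatrix (A i + a i • Matrix.vecMulVec (u i) (v i))) c := by
  refine (hA.pair (ha.pair (hu.pair hv))).trans ?_
  have hid := id (X := fun i => Data.pair (.ofMatrix (A i)) (.pair (.real (a i)) (.pair
    (.ofVec (u i)) (.ofVec (v i))))) (c := c) hc1
  refine map₂ (cb := fun i => (n i : ℝ) + 1) (fun i j => .ofVec (A i j)) (fun i j => .real (u i j))
    (fun i j => .ofVec ((A i + a i • Matrix.vecMulVec (u i) (v i)) j)) hid.fst hid.snd.snd.fst hid
    hc1 (fun i => by linarith [Nat.cast_nonneg (α := ℝ) (n i)]) ?_ 4 (by norm_num) hmn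
  have hq1 : ∀ q : Σ i, Fin (m i), (1 : ℝ) ≤ (n q.1 : ℝ) + 1 := fun q => by
    linarith [Nat.cast_nonneg (α := ℝ) (n q.1)]
  have hq := id (X := fun q : Σ i, Fin (m i) => Data.pair (.ofVec (A q.1 q.2)) (.pair
    (.real (u q.1 q.2)) (.pair (.ofMatrix (A q.1)) (.pair (.real (a q.1)) (.pair
    (.ofVec (u q.1)) (.ofVec (v q.1)))))))
    (c := fun q => (n q.1 : ℝ) + 1) hq1
  have h := vlin (const 1 hq1) (hq.snd.snd.snd.fst.mul hq.snd.fst) hq.fst hq.snd.snd.snd.snd.snd hq1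
    fun q => by linarith [hq1 q]
  have e : ∀ q : Σ i, Fin (m i), (A q.1 + a q.1 • Matrix.vecMulVec (u q.1) (v q.1)) q.2 =
      (1 : ℝ) • A q.1 q.2 + (a q.1 * u q.1 q.2) • v q.1 := by
    intro q
    ext k
    simp [Matrix.vecMulVec_apply, mul_assoc]
  simpa only [e] using h

theorem mlin {m n : I → ℕ} {a b : I → ℝ} {A B : ∀ i, Matrix (Fin (m i)) (Fin (n i)) ℝ}
    (ha : Comp X (fun i => .real (a i)) c) (hb : Comp X (fun i => .real (b i)) c)
    (hA : Comp X (fun i => .ofMatrix (A i)) c) (hB : Comp X (fun i => .ofMatrix (B i)) c)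
    (hc1 : ∀ i, 1 ≤ c i) (hmn : ∀ i, ((m i : ℝ) + 1) * (n i + 1) ≤ 4 * c i) :
    Comp X (fun i => .ofMatrix (a i • A i + b i • B i)) c := by
  refine (ha.pair (hb.pair (hA.pair hB))).trans ?_
  have hid := id (X := fun i => Data.pair (.real (a i)) (.pair (.real (b i)) (.pair
    (.ofMatrix (A i)) (.ofMatrix (B i))))) (c := c) hc1
  refine map₂ (cb := fun i => (n i : ℝ) + 1) (fun i j => .ofVec (A i j)) (fun i j => .ofVec (B i j))
    (fun i j => .ofVec (a i • A i j + b i • B i j)) hid.snd.snd.fst hid.snd.snd.snd hid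
    hc1 (fun i => by linarith [Nat.cast_nonneg (α := ℝ) (n i)]) ?_ 4 (by norm_num) hmn
  have hq1 : ∀ q : Σ i, Fin (m i), (1 : ℝ) ≤ (n q.1 : ℝ) + 1 := fun q => by
    linarith [Nat.cast_nonneg (α := ℝ) (n q.1)]
  have hq := id (X := fun q : Σ i, Fin (m i) => Data.pair (.ofVec (A q.1 q.2)) (.pair
    (.ofVec (B q.1 q.2)) (.pair (.real (a q.1)) (.pair (.real (b q.1)) (.pair
    (.ofMatrix (A q.1)) (.ofMatrix (B q.1)))))))
    (c := fun q => (n q.1 : ℝ) + 1) hq1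
  exact vlin hq.snd.snd.fst hq.snd.snd.snd.fst hq.fst hq.snd.fst hq1 fun q => by linarith [hq1 q]

theorem zeroMatrix {m n : I → ℕ} (hm : Comp X (fun i => .real (m i)) c)
    (hn : Comp X (fun i => .real (n i)) c) (hc1 : ∀ i, 1 ≤ c i)
    (hmn : ∀ i, ((m i : ℝ) + 1) * (n i + 1) ≤ 4 * c i) :
    Comp X (fun i => .ofMatrix (0 : Matrix (Fin (m i)) (Fin (n i)) ℝ)) c := by
  have hm' : ∀ i, (m i : ℝ) + 1 ≤ 4 * c i := fun i => by
    nlinarith [hmn i, Nat.cast_nonneg (α := ℝ) (n i), Nat.cast_nonneg (α := ℝ) (m i)]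
  have hn' : ∀ i, (n i : ℝ) + 1 ≤ 4 * c i := fun i => by
    nlinarith [hmn i, Nat.cast_nonneg (α := ℝ) (n i), Nat.cast_nonneg (α := ℝ) (m i)]
  refine ((hm.zeroVec hc1 hm').pair (hn.zeroVec hc1 hn')).trans ?_
  have hid := id (X := fun i => Data.pair (.ofVec (0 : Fin (m i) → ℝ))
    (.ofVec (0 : Fin (n i) → ℝ))) (c := c) hc1
  refine map₂ (cb := fun i => 1) (fun i j => .real 0) (fun i j => .real 0)
    (fun i j => .ofVec ((0 : Matrix (Fin (m i)) (Fin (n i)) ℝ) j)) hid.fst hid.fst hid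
    hc1 (fun i => le_rfl) ?_ 4 (by norm_num) (by simpa using hm')
  exact (id fun _ => le_rfl).snd.snd.snd

/-- The machine can only test `≤`, so the diagonal is recognized by comparing the row and column
indices in both directions. -/
theorem oneMatrix {n : I → ℕ} (hn : Comp X (fun i => .real (n i)) c) (hc1 : ∀ i, 1 ≤ c i)
    (hmn : ∀ i, ((n i : ℝ) + 1) * (n i + 1) ≤ 4 * c i) :
    Comp X (fun i => .ofMatrix (1 : Matrix (Fin (n i)) (Fin (n i)) ℝ)) c := by
  have hn' : ∀ i, (n i : ℝ) + 1 ≤ 4 * c i := fun i => by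
    nlinarith [hmn i, Nat.cast_nonneg (α := ℝ) (n i)]
  refine (hn.index hc1 hn').trans ?_
  have hid := id (X := fun i => Data.ofVec fun j : Fin (n i) => (j : ℝ)) (c := c) hc1
  refine map₂ (cb := fun i => (n i : ℝ) + 1) (fun i j => .real (j : ℝ)) (fun i j => .real (j : ℝ))
    (fun i j => .ofVec ((1 : Matrix (Fin (n i)) (Fin (n i)) ℝ) j)) hid hid hid
    hc1 (fun i => by linarith [Nat.cast_nonneg (α := ℝ) (n i)]) ?_ 4 (by norm_num) hmn
  have hq1 : ∀ q : Σ i, Fin (n i), (1 : ℝ) ≤ (n q.1 : ℝ) + 1 := fun q => by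
    linarith [Nat.cast_nonneg (α := ℝ) (n q.1)]
  have hq := id (X := fun q : Σ i, Fin (n i) => Data.pair (.real (q.2 : ℝ)) (.pair
    (.real (q.2 : ℝ)) (Data.ofVec fun j : Fin (n q.1) => (j : ℝ))))
    (c := fun q => (n q.1 : ℝ) + 1) hq1
  refine map₂ (cb := fun _ => 1) (fun q j => .real (j : ℝ)) (fun q j => .real (j : ℝ))
    (fun q j => .real ((1 : Matrix (Fin (n q.1)) (Fin (n q.1)) ℝ) q.2 j)) hq.snd.snd hq.snd.snd hq
    hq1 (fun _ => le_rfl) ?_ 4 (by norm_num) fun q => by linarith [hq1 q]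
  have hr := id (X := fun r : Σ q : (Σ i, Fin (n i)), Fin (n q.1) => Data.pair (.real (r.2 : ℝ))
    (.pair (.real (r.2 : ℝ)) (Data.pair (.real (r.1.2 : ℝ)) (.pair (.real (r.1.2 : ℝ))
    (Data.ofVec fun j : Fin (n r.1.1) => (j : ℝ)))))) (c := fun _ => 1) fun _ => le_rfl
  refine ite_le hr.fst hr.snd.snd.fst hr ?_ ?_
  · have h1 := hr.reindex fun r : {r : Σ q : (Σ i, Fin (n i)), Fin (n q.1) //
      (r.2 : ℝ) ≤ (r.1.2 : ℝ)} => r.1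
    refine ite_le h1.snd.snd.fst h1.fst h1 ?_ ?_
    · refine (const 1 fun _ => le_rfl).congr_right ?_
      rintro ⟨⟨r, h⟩, h'⟩
      have : r.1.2 = r.2 := Fin.ext (by exact_mod_cast le_antisymm h' h)
      change Data.real 1 = Data.real ((1 : Matrix (Fin (n r.1.1)) (Fin (n r.1.1)) ℝ) r.1.2 r.2)
      rw [this, Matrix.one_apply_eq]
    · refine (const 0 fun _ => le_rfl).congr_right ?_
      rintro ⟨⟨r, h⟩, h'⟩
      have : r.1.2 ≠ r.2 := fun e => by simp [e] at h'
      simp [this]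
  · refine (const 0 fun _ => le_rfl).congr_right ?_
    rintro ⟨r, h⟩
    have : r.1.2 ≠ r.2 := fun e => by simp [e] at h
    simp [this]

/-- The one place where the assumed multiplication program is run. The constant in `MatMulExponent`
may have any sign, hence the absolute value. -/
theorem matMul {ω : ℝ} (hω : MatMulExponent ω) {n : I → ℕ}
    {A B : ∀ i, Matrix (Fin (n i)) (Fin (n i)) ℝ}
    (hA : Comp X (fun i => .ofMatrix (A i)) c) (hB : Comp X (fun i => .ofMatrix (B i)) c)
    (hn : ∀ i, 1 ≤ n i) (D : ℝ) (hD : 0 ≤ D) (hc : ∀ i, (n i : ℝ) ^ ω ≤ D * c i) :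
    Comp X (fun i => .ofMatrix (A i * B i)) c := by
  refine (hA.pair hB).trans ?_
  obtain ⟨P, K, hP⟩ := hω
  refine ⟨P, |K| * D, by positivity, fun i => ?_⟩
  obtain ⟨k, hk, hle⟩ := hP (n i) (hn i) (A i) (B i)
  refine ⟨k, hk, hle.trans ?_⟩
  calc K * (n i : ℝ) ^ ω ≤ |K| * (n i : ℝ) ^ ω := by gcongr; exact le_abs_self K
    _ ≤ |K| * (D * c i) := by gcongr; exact hc i
    _ = _ := by ring

end Comp

/-! ### Block matrices -/

/-- The matrix with blocks `P Q` above `R S`. -/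
def blockMatrix {m n : ℕ} (P : Matrix (Fin m) (Fin m) ℝ) (Q : Matrix (Fin m) (Fin n) ℝ)
    (R : Matrix (Fin n) (Fin m) ℝ) (S : Matrix (Fin n) (Fin n) ℝ) :
    Matrix (Fin (m + n)) (Fin (m + n)) ℝ :=
  fun i => Fin.append (fun i => Fin.append (P i) (Q i)) (fun i => Fin.append (R i) (S i)) i

section blockMatrix

variable {m n : ℕ} (P : Matrix (Fin m) (Fin m) ℝ) (Q : Matrix (Fin m) (Fin n) ℝ)
  (R : Matrix (Fin n) (Fin m) ℝ) (S : Matrix (Fin n) (Fin n) ℝ)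

theorem blockMatrix_eq_submatrix : blockMatrix P Q R S =
    (Matrix.fromBlocks P Q R S).submatrix finSumFinEquiv.symm finSumFinEquiv.symm := by
  ext i j
  refine Fin.addCases (fun i => ?_) (fun i => ?_) i <;>
    refine Fin.addCases (fun j => ?_) (fun j => ?_) j <;> simp [blockMatrix]

theorem submatrix_blockMatrix :
    (blockMatrix P Q R S).submatrix finSumFinEquiv finSumFinEquiv = Matrix.fromBlocks P Q R S := by
  rw [blockMatrix_eq_submatrix]
  simp

theorem exists_blockMatrix (M : Matrix (Fin (m + n)) (Fin (m + n)) ℝ) :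
    ∃ P Q R S, M = blockMatrix (m := m) (n := n) P Q R S := by
  let N := M.submatrix finSumFinEquiv finSumFinEquiv
  refine ⟨N.toBlocks₁₁, N.toBlocks₁₂, N.toBlocks₂₁, N.toBlocks₂₂, ?_⟩
  rw [blockMatrix_eq_submatrix, Matrix.fromBlocks_toBlocks]
  simp [N]

variable {P Q R S}

theorem posDef_blockMatrix_iff :
    (blockMatrix P Q R S).PosDef ↔ (Matrix.fromBlocks P Q R S).PosDef := by
  constructor
  · intro h
    rw [← submatrix_blockMatrix]
    exact h.submatrix finSumFinEquiv.injective
  · intro h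
    rw [blockMatrix_eq_submatrix]
    exact h.submatrix finSumFinEquiv.symm.injective

theorem posDef_of_blockMatrix (h : (blockMatrix P Q R S).PosDef) : P.PosDef := by
  rw [posDef_blockMatrix_iff] at h
  exact h.submatrix (e := Sum.inl) Sum.inl_injective

/-- Semidefiniteness passes to the Schur complement, and invertibility of the whole matrix and of
`P` makes the complement invertible; a semidefinite invertible matrix is definite. -/
theorem posDef_schur (h : (blockMatrix P Q R S).PosDef) : (S - R * P⁻¹ * Q).PosDef := by
  have hP := posDef_of_blockMatrix h
  rw [posDef_blockMatrix_iff] at h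
  have hR : R = Q.conjTranspose := by
    have := h.1
    rw [Matrix.isHermitian_fromBlocks_iff] at this
    exact this.2.1.symm
  subst hR
  have := hP.isUnit.invertible
  have h1 : (S - Q.conjTranspose * P⁻¹ * Q).PosSemidef :=
    (hP.fromBlocks₁₁ Q S).1 h.posSemidef
  refine h1.posDef_iff_isUnit.2 ?_
  have h2 := Matrix.isUnit_fromBlocks_iff_of_invertible₁₁.1 h.isUnit
  rwa [Matrix.invOf_eq_nonsing_inv] at h2

/-- Two inversions of half the size, of `P` and of the Schur complement, suffice. The products are
bracketed so that only `P⁻¹ * Q` and `R * P⁻¹` have to be remembered between them. -/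
theorem inv_blockMatrix (h : (blockMatrix P Q R S).PosDef) {W : Matrix (Fin n) (Fin n) ℝ}
    (hW : W = (S - R * (P⁻¹ * Q))⁻¹) :
    (blockMatrix P Q R S)⁻¹ = blockMatrix (P⁻¹ + P⁻¹ * Q * W * (R * P⁻¹)) (-(P⁻¹ * Q * W))
      (-(W * (R * P⁻¹))) W := by
  have hP := posDef_of_blockMatrix h
  have hS := posDef_schur h
  rw [Matrix.mul_assoc] at hS
  rw [posDef_blockMatrix_iff] at h
  have := hP.isUnit.invertible
  have := hS.isUnit.invertible
  have := h.isUnit.invertible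
  have : Invertible (S - R * ⅟P * Q) := by
    rw [Matrix.invOf_eq_nonsing_inv, Matrix.mul_assoc]
    infer_instance
  rw [blockMatrix_eq_submatrix, blockMatrix_eq_submatrix, Matrix.inv_submatrix_equiv]
  congr 1
  rw [← Matrix.invOf_eq_nonsing_inv, Matrix.invOf_fromBlocks₁₁_eq]
  simp only [Matrix.invOf_eq_nonsing_inv, hW, Matrix.mul_assoc]

end blockMatrix

variable {I J : Type}

namespace Comp

variable {X Y Z : I → Data} {c cb : I → ℝ} {m n : I → ℕ}

/-- Lists with the entries `Fin.append (a j) (b j)`, all of them lists. -/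
theorem appendRows {r : I → ℕ} {A : ∀ i, Matrix (Fin (r i)) (Fin (m i)) ℝ}
    {B : ∀ i, Matrix (Fin (r i)) (Fin (n i)) ℝ}
    (hA : Comp X (fun i => .ofMatrix (A i)) c) (hB : Comp X (fun i => .ofMatrix (B i)) c)
    (hc1 : ∀ i, 1 ≤ c i) (hc : ∀ i, ((r i : ℝ) + 1) * (m i + 1) ≤ 4 * c i) :
    Comp X (fun i => .ofList (List.ofFn fun j => .ofVec (Fin.append (A i j) (B i j)))) c := by
  refine (hA.pair hB).trans ?_
  have hid := id (X := fun i => Data.pair (.ofMatrix (A i)) (.ofMatrix (B i))) (c := c) hc1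
  refine map₂ (cb := fun i => (m i : ℝ) + 1) (fun i j => .ofVec (A i j)) (fun i j => .ofVec (B i j))
    (fun i j => .ofVec (Fin.append (A i j) (B i j))) hid.fst hid.snd hid
    hc1 (fun i => by linarith [Nat.cast_nonneg (α := ℝ) (m i)]) ?_ 4 (by norm_num) hc
  have hq1 : ∀ q : Σ i, Fin (r i), (1 : ℝ) ≤ (m q.1 : ℝ) + 1 := fun q => by
    linarith [Nat.cast_nonneg (α := ℝ) (m q.1)]
  have hq := id (X := fun q : Σ i, Fin (r i) => Data.pair (.ofVec (A q.1 q.2)) (.pair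
    (.ofVec (B q.1 q.2)) (.pair (.ofMatrix (A q.1)) (.ofMatrix (B q.1)))))
    (c := fun q => (m q.1 : ℝ) + 1) hq1
  refine (append (a := fun q : Σ i, Fin (r i) => fun k => .real (A q.1 q.2 k))
    (b := fun q => fun k => .real (B q.1 q.2 k)) hq.fst hq.snd.fst hq1
    fun q => by linarith [hq1 q]).congr_right fun q => ?_
  rw [Data.ofVec]
  congr 2
  ext k
  refine Fin.addCases (fun k => ?_) (fun k => ?_) k <;> simp

theorem blockMatrix {P : ∀ i, Matrix (Fin (m i)) (Fin (m i)) ℝ}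
    {Q : ∀ i, Matrix (Fin (m i)) (Fin (n i)) ℝ} {R : ∀ i, Matrix (Fin (n i)) (Fin (m i)) ℝ}
    {S : ∀ i, Matrix (Fin (n i)) (Fin (n i)) ℝ}
    (hP : Comp X (fun i => .ofMatrix (P i)) c) (hQ : Comp X (fun i => .ofMatrix (Q i)) c)
    (hR : Comp X (fun i => .ofMatrix (R i)) c) (hS : Comp X (fun i => .ofMatrix (S i)) c)
    (hc1 : ∀ i, 1 ≤ c i) (hc : ∀ i, ((m i : ℝ) + n i + 1) * (m i + n i + 1) ≤ 4 * c i) :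
    Comp X (fun i => .ofMatrix (blockMatrix (P i) (Q i) (R i) (S i))) c := by
  have hm : ∀ i, (0 : ℝ) ≤ m i := fun i => by positivity
  have hn : ∀ i, (0 : ℝ) ≤ n i := fun i => by positivity
  refine ((hP.appendRows hQ hc1 fun i => ?_).append (hR.appendRows hS hc1 fun i => ?_) hc1
    fun i => ?_).congr_right fun i => ?_
  · nlinarith [hc i, hm i, hn i, mul_nonneg (hm i) (hn i)]
  · nlinarith [hc i, hm i, hn i, mul_nonneg (hm i) (hn i)]
  · nlinarith [hc i, hm i, hn i, mul_nonneg (hm i) (hn i)]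
  · rw [Data.ofMatrix]
    congr 2
    ext k
    refine Fin.addCases (fun k => ?_) (fun k => ?_) k <;> simp [RealMachine.blockMatrix]

theorem splitRows {r : I → ℕ} {t : ∀ i, Fin (m i) → ℝ} {A : ∀ i, Matrix (Fin (r i)) (Fin (m i)) ℝ}
    {B : ∀ i, Matrix (Fin (r i)) (Fin (n i)) ℝ}
    (ht : Comp X (fun i => .ofVec (t i)) c)
    (h : Comp X (fun i => .ofList (List.ofFn fun j => .ofVec (Fin.append (A i j) (B i j)))) c)
    (hc1 : ∀ i, 1 ≤ c i) (hc : ∀ i, ((r i : ℝ) + 1) * (m i + 1) ≤ 4 * c i) :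
    Comp X (fun i => .pair (.ofMatrix (A i)) (.ofMatrix (B i))) c := by
  refine (ht.pair h).trans ?_
  have hid := id (X := fun i => Data.pair (.ofVec (t i))
    (.ofList (List.ofFn fun j => .ofVec (Fin.append (A i j) (B i j))))) (c := c) hc1
  have h1 := map₂ (cb := fun i => (m i : ℝ) + 1)
    (fun i j => .ofVec (Fin.append (A i j) (B i j))) (fun i j => .ofVec (Fin.append (A i j) (B i j)))
    (fun i j => .pair (.ofVec (A i j)) (.ofVec (B i j))) hid.snd hid.snd hid
    hc1 (fun i => by linarith [Nat.cast_nonneg (α := ℝ) (m i)]) ?_ 4 (by norm_num) hc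
  · refine h1.trans ?_
    have hid := id (X := fun i => Data.ofList (List.ofFn fun j =>
      Data.pair (.ofVec (A i j)) (.ofVec (B i j)))) (c := c) hc1
    have hr : ∀ i, ((r i : ℝ) + 1) * 1 ≤ 4 * c i := fun i => by
      nlinarith [hc i, Nat.cast_nonneg (α := ℝ) (m i), Nat.cast_nonneg (α := ℝ) (r i)]
    refine pair ?_ ?_
    · exact map₂ (cb := fun i => 1) (fun i j => .pair (.ofVec (A i j)) (.ofVec (B i j)))
        (fun i j => .pair (.ofVec (A i j)) (.ofVec (B i j))) (fun i j => .ofVec (A i j)) hid hid hid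
        hc1 (fun i => le_rfl) (id fun _ => le_rfl).fst.fst 4 (by norm_num) hr
    · exact map₂ (cb := fun i => 1) (fun i j => .pair (.ofVec (A i j)) (.ofVec (B i j)))
        (fun i j => .pair (.ofVec (A i j)) (.ofVec (B i j))) (fun i j => .ofVec (B i j)) hid hid hid
        hc1 (fun i => le_rfl) (id fun _ => le_rfl).fst.snd 4 (by norm_num) hr
  · have hq1 : ∀ q : Σ i, Fin (r i), (1 : ℝ) ≤ (m q.1 : ℝ) + 1 := fun q => by
      linarith [Nat.cast_nonneg (α := ℝ) (m q.1)]
    have hq := id (X := fun q : Σ i, Fin (r i) => Data.pair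
      (.ofVec (Fin.append (A q.1 q.2) (B q.1 q.2))) (.pair
      (.ofVec (Fin.append (A q.1 q.2) (B q.1 q.2))) (.pair (.ofVec (t q.1))
      (.ofList (List.ofFn fun j => .ofVec (Fin.append (A q.1 j) (B q.1 j)))))))
      (c := fun q => (m q.1 : ℝ) + 1) hq1
    refine split (t := fun q : Σ i, Fin (r i) => fun k => .real (t q.1 k))
      (a := fun q => fun k => .real (A q.1 q.2 k)) (b := fun q => fun k => .real (B q.1 q.2 k))
      hq.snd.snd.fst (hq.fst.congr_right fun q => ?_) fun q => by linarith [hq1 q]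
    rw [Data.ofVec]
    congr 2
    ext k
    refine Fin.addCases (fun k => ?_) (fun k => ?_) k <;> simp

theorem splitBlocks {t : ∀ i, Fin (m i) → ℝ} {P : ∀ i, Matrix (Fin (m i)) (Fin (m i)) ℝ}
    {Q : ∀ i, Matrix (Fin (m i)) (Fin (n i)) ℝ} {R : ∀ i, Matrix (Fin (n i)) (Fin (m i)) ℝ}
    {S : ∀ i, Matrix (Fin (n i)) (Fin (n i)) ℝ} (ht : Comp X (fun i => .ofVec (t i)) c)
    (h : Comp X (fun i => .ofMatrix (RealMachine.blockMatrix (P i) (Q i) (R i) (S i))) c)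
    (hc1 : ∀ i, 1 ≤ c i) (hc : ∀ i, ((m i : ℝ) + n i + 1) * (m i + n i + 1) ≤ 4 * c i) :
    Comp X (fun i => .pair (.pair (.ofMatrix (P i)) (.ofMatrix (Q i)))
      (.pair (.ofMatrix (R i)) (.ofMatrix (S i)))) c := by
  have hm : ∀ i, (0 : ℝ) ≤ m i := fun i => by positivity
  have hn : ∀ i, (0 : ℝ) ≤ n i := fun i => by positivity
  have h1 := split (t := fun i k => .real (t i k))
    (a := fun i j => .ofVec (Fin.append (P i j) (Q i j)))
    (b := fun i j => .ofVec (Fin.append (R i j) (S i j))) ht (h.congr_right fun i => by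
      rw [Data.ofMatrix]
      congr 2
      ext k
      refine Fin.addCases (fun k => ?_) (fun k => ?_) k <;> simp [RealMachine.blockMatrix])
      fun i => by nlinarith [hc i, hm i, hn i, mul_nonneg (hm i) (hn i)]
  refine pair (splitRows ht h1.fst hc1 fun i => ?_) (splitRows ht h1.snd hc1 fun i => ?_)
  · nlinarith [hc i, hm i, hn i, mul_nonneg (hm i) (hn i)]
  · nlinarith [hc i, hm i, hn i, mul_nonneg (hm i) (hn i)]

end Comp

/-! ### Inversion of positive definite matrices -/

/-- `2 ^ k`, in a form for which `twoPow (k + 1)` is a sum by definition. -/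
def twoPow : ℕ → ℕ
  | 0 => 1
  | k + 1 => twoPow k + twoPow k

theorem twoPow_pos (k : ℕ) : 1 ≤ twoPow k := by
  induction k with
  | zero => exact le_rfl
  | succ k ih => exact ih.trans (Nat.le_add_right _ _)

theorem lt_twoPow (k : ℕ) : k < twoPow k := by
  induction k with
  | zero => exact Nat.one_pos
  | succ k ih =>
    have := twoPow_pos k
    rw [twoPow]
    omega

/-- The list of the vectors of lengths `2 ^ (k - 1), …, 2, 1`. -/
def halvings : ℕ → Data
  | 0 => .nil
  | k + 1 => .pair (.ofVec (0 : Fin (twoPow k) → ℝ)) (halvings k)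

/-- Body of the recursive block inversion. -/
def invBody (pre mid post : Code) : Code :=
  .ifNil (.pair (.pair (.comp .div (.pair (.const 1) (.comp .fst .fst))) .nil) .nil)
    (.comp post (.comp (.pair (.comp .self .fst) .snd) (.comp mid
      (.comp (.pair (.comp .self .fst) .snd) pre))))

/-- Four square blocks of the same size. -/
abbrev Blocks (k : ℕ) : Type :=
  Matrix (Fin (twoPow k)) (Fin (twoPow k)) ℝ × Matrix (Fin (twoPow k)) (Fin (twoPow k)) ℝ ×
    Matrix (Fin (twoPow k)) (Fin (twoPow k)) ℝ × Matrix (Fin (twoPow k)) (Fin (twoPow k)) ℝ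

theorem one_le_rpow_nat {n : ℕ} (hn : 1 ≤ n) {ω : ℝ} (hω : 2 ≤ ω) : (1 : ℝ) ≤ (n : ℝ) ^ ω :=
  Real.one_le_rpow (by exact_mod_cast hn) (by linarith)

theorem sq_le_rpow_nat {n : ℕ} (hn : 1 ≤ n) {ω : ℝ} (hω : 2 ≤ ω) : (n : ℝ) ^ 2 ≤ (n : ℝ) ^ ω := by
  rw [← Real.rpow_two]
  exact Real.rpow_le_rpow_of_exponent_le (by exact_mod_cast hn) hω

theorem twoPow_succ_rpow (k : ℕ) (ω : ℝ) :
    (twoPow (k + 1) : ℝ) ^ ω = 2 ^ ω * (twoPow k : ℝ) ^ ω := by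
  rw [← Real.mul_rpow (by norm_num) (by positivity), twoPow]
  push_cast
  ring_nf

theorem four_mul_twoPow_rpow_le (k : ℕ) {ω : ℝ} (hω : 2 ≤ ω) :
    4 * (twoPow k : ℝ) ^ ω ≤ (twoPow (k + 1) : ℝ) ^ ω := by
  rw [twoPow_succ_rpow]
  gcongr
  calc (4 : ℝ) = 2 ^ (2 : ℝ) := by norm_num
    _ ≤ 2 ^ ω := Real.rpow_le_rpow_of_exponent_le (by norm_num) hω

theorem twoPow_dim (k : ℕ) {ω : ℝ} (hω : 2 ≤ ω) :
    ((twoPow k : ℝ) + twoPow k + 1) * (twoPow k + twoPow k + 1) ≤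
      4 * (twoPow (k + 1) : ℝ) ^ ω := by
  have h1 := sq_le_rpow_nat (twoPow_pos (k + 1)) hω
  have h2 : (1 : ℝ) ≤ twoPow k := by exact_mod_cast twoPow_pos k
  have h3 : (twoPow (k + 1) : ℝ) = twoPow k + twoPow k := by rw [twoPow]; push_cast; rfl
  rw [h3] at h1 ⊢
  nlinarith

theorem twoPow_dim' (k : ℕ) {ω : ℝ} (hω : 2 ≤ ω) :
    ((twoPow k : ℝ) + 1) * (twoPow k + 1) ≤ 4 * (twoPow (k + 1) : ℝ) ^ ω := by
  have h1 := twoPow_dim k hω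
  have h2 : (1 : ℝ) ≤ twoPow k := by exact_mod_cast twoPow_pos k
  nlinarith

section

variable {ω : ℝ}

/-- The head of the list of halvings measures where to cut the matrix; the tail is kept for both
recursive calls, the first of which is prepared here. -/
theorem comp_inv_pre (hω : 2 ≤ ω) : Comp (I := Σ k, Blocks k)
    (fun q => .pair (halvings (q.1 + 1))
      (.ofMatrix (blockMatrix q.2.1 q.2.2.1 q.2.2.2.1 q.2.2.2.2)))
    (fun q => .pair (.pair (halvings q.1) (.ofMatrix q.2.1)) (.pair (halvings q.1)
      (.pair (.ofMatrix q.2.2.1) (.pair (.ofMatrix q.2.2.2.1) (.ofMatrix q.2.2.2.2)))))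
    fun q => (twoPow (q.1 + 1) : ℝ) ^ ω := by
  have hc1 : ∀ q : Σ k, Blocks k, (1 : ℝ) ≤ (twoPow (q.1 + 1) : ℝ) ^ ω := fun q =>
    one_le_rpow_nat (twoPow_pos _) hω
  have hid := Comp.id (X := fun q : Σ k, Blocks k => Data.pair
    (.pair (.ofVec (0 : Fin (twoPow q.1) → ℝ)) (halvings q.1))
    (.ofMatrix (blockMatrix q.2.1 q.2.2.1 q.2.2.2.1 q.2.2.2.2))) hc1
  have h := Comp.splitBlocks hid.fst.fst hid.snd hc1 fun q => twoPow_dim q.1 hω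
  exact (hid.fst.snd.pair h.fst.fst).pair (hid.fst.snd.pair (h.fst.snd.pair h.snd))

/-- In its use the first of the four blocks is `P⁻¹`, already returned by the first recursive call.
The second call is prepared on the Schur complement. -/
theorem comp_inv_mid (hω : 2 ≤ ω) (hM : MatMulExponent ω) : Comp (I := Σ k, Blocks k)
    (fun q => .pair (.ofMatrix q.2.1) (.pair (halvings q.1)
      (.pair (.ofMatrix q.2.2.1) (.pair (.ofMatrix q.2.2.2.1) (.ofMatrix q.2.2.2.2)))))
    (fun q => .pair (.pair (halvings q.1)
        (.ofMatrix (q.2.2.2.2 - q.2.2.2.1 * (q.2.1 * q.2.2.1))))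
      (.pair (.ofMatrix q.2.1) (.pair (.ofMatrix (q.2.1 * q.2.2.1))
        (.ofMatrix (q.2.2.2.1 * q.2.1)))))
    fun q => (twoPow (q.1 + 1) : ℝ) ^ ω := by
  have hc1 : ∀ q : Σ k, Blocks k, (1 : ℝ) ≤ (twoPow (q.1 + 1) : ℝ) ^ ω := fun q =>
    one_le_rpow_nat (twoPow_pos _) hω
  have hle : ∀ q : Σ k, Blocks k, (twoPow q.1 : ℝ) ^ ω ≤ 1 * (twoPow (q.1 + 1) : ℝ) ^ ω := fun q =>
    by nlinarith [four_mul_twoPow_rpow_le q.1 hω, one_le_rpow_nat (twoPow_pos q.1) hω]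
  have hid := Comp.id (X := fun q : Σ k, Blocks k => Data.pair (.ofMatrix q.2.1)
    (.pair (halvings q.1) (.pair (.ofMatrix q.2.2.1) (.pair (.ofMatrix q.2.2.2.1)
      (.ofMatrix q.2.2.2.2))))) hc1
  have hV := Comp.matMul hM hid.fst hid.snd.snd.fst (fun q => twoPow_pos q.1) 1 zero_le_one hle
  have hU := Comp.matMul hM hid.snd.snd.snd.fst hid.fst (fun q => twoPow_pos q.1) 1 zero_le_one hle
  have hRV := Comp.matMul hM hid.snd.snd.snd.fst hV (fun q => twoPow_pos q.1) 1 zero_le_one hle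
  have hS := Comp.mlin (Comp.const 1 hc1) (Comp.const (-1) hc1) hid.snd.snd.snd.snd hRV hc1
    fun q => twoPow_dim' q.1 hω
  refine (hid.snd.fst.pair (hS.congr_right fun q => ?_)).pair (hid.fst.pair (hV.pair hU))
  congr 1
  simp [sub_eq_add_neg]

/-- In its use the four blocks are the inverse `W` of the Schur complement, `P⁻¹`, `P⁻¹ * Q` and `R
* P⁻¹`, so that the result is the inverse given by `inv_blockMatrix`. -/
theorem comp_inv_post (hω : 2 ≤ ω) (hM : MatMulExponent ω) : Comp (I := Σ k, Blocks k)
    (fun q => .pair (.ofMatrix q.2.1) (.pair (.ofMatrix q.2.2.1)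
      (.pair (.ofMatrix q.2.2.2.1) (.ofMatrix q.2.2.2.2))))
    (fun q => .ofMatrix (blockMatrix (q.2.2.1 + q.2.2.2.1 * q.2.1 * q.2.2.2.2)
      (-(q.2.2.2.1 * q.2.1)) (-(q.2.1 * q.2.2.2.2)) q.2.1))
    fun q => (twoPow (q.1 + 1) : ℝ) ^ ω := by
  have hc1 : ∀ q : Σ k, Blocks k, (1 : ℝ) ≤ (twoPow (q.1 + 1) : ℝ) ^ ω := fun q =>
    one_le_rpow_nat (twoPow_pos _) hω
  have hle : ∀ q : Σ k, Blocks k, (twoPow q.1 : ℝ) ^ ω ≤ 1 * (twoPow (q.1 + 1) : ℝ) ^ ω := fun q =>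
    by nlinarith [four_mul_twoPow_rpow_le q.1 hω, one_le_rpow_nat (twoPow_pos q.1) hω]
  have hid := Comp.id (X := fun q : Σ k, Blocks k => Data.pair (.ofMatrix q.2.1)
    (.pair (.ofMatrix q.2.2.1) (.pair (.ofMatrix q.2.2.2.1) (.ofMatrix q.2.2.2.2)))) hc1
  have hVW := Comp.matMul hM hid.snd.snd.fst hid.fst (fun q => twoPow_pos q.1) 1 zero_le_one hle
  have hWU := Comp.matMul hM hid.fst hid.snd.snd.snd (fun q => twoPow_pos q.1) 1 zero_le_one hle
  have hVWU := Comp.matMul hM hVW hid.snd.snd.snd (fun q => twoPow_pos q.1) 1 zero_le_one hle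
  have hdim := fun q : Σ k, Blocks k => twoPow_dim' q.1 hω
  have h1 := Comp.mlin (Comp.const 1 hc1) (Comp.const 1 hc1) hid.snd.fst hVWU hc1 hdim
  have h2 := Comp.mlin (Comp.const (-1) hc1) (Comp.const 0 hc1) hVW hVW hc1 hdim
  have h3 := Comp.mlin (Comp.const (-1) hc1) (Comp.const 0 hc1) hWU hWU hc1 hdim
  refine (Comp.blockMatrix h1 h2 h3 hid.fst hc1 fun q => twoPow_dim q.1 hω).congr_right fun q => ?_
  congr 1
  simp

theorem ofMatrix_one_inv (A : Matrix (Fin 1) (Fin 1) ℝ) : Data.ofMatrix A⁻¹ =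
    .pair (.pair (.real (1 / A 0 0)) .nil) .nil := by
  have : A⁻¹ = fun _ _ => 1 / A 0 0 := by
    ext i j
    fin_cases i
    fin_cases j
    simp
  rw [this]
  rfl

/-- Positive definite matrices of size `2 ^ k` can be inverted within `O((2 ^ k) ^ ω)` steps. -/
theorem comp_inv_twoPow (hω : 2 ≤ ω) (hM : MatMulExponent ω) :
    Comp (I := Σ k, {A : Matrix (Fin (twoPow k)) (Fin (twoPow k)) ℝ // A.PosDef})
    (fun q => .pair (halvings q.1) (.ofMatrix q.2.1)) (fun q => .ofMatrix q.2.1⁻¹)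
    fun q => (twoPow q.1 : ℝ) ^ ω := by
  obtain ⟨pre, C₁, hC₁, h₁⟩ := comp_inv_pre hω
  obtain ⟨mid, C₂, hC₂, h₂⟩ := comp_inv_mid hω hM
  obtain ⟨post, C₃, hC₃, h₃⟩ := comp_inv_post hω hM
  -- As `4 * n ^ ω ≤ (2 * n) ^ ω`, the two recursive calls use at most half of the bound; the other
  -- half pays for the three phases and `15` steps of bookkeeping.
  have key : ∀ (k : ℕ) (A : Matrix (Fin (twoPow k)) (Fin (twoPow k)) ℝ), A.PosDef →
      ∃ l : ℕ, Eval (some (invBody pre mid post)) (invBody pre mid post)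
        (.pair (halvings k) (.ofMatrix A)) (.ofMatrix A⁻¹) l ∧
        (l : ℝ) ≤ 2 * (C₁ + C₂ + C₃ + 15) * (twoPow k : ℝ) ^ ω := by
    intro k
    induction k with
    | zero =>
      intro (A : Matrix (Fin 1) (Fin 1) ℝ) hA
      have hA0 : A 0 0 ≠ 0 := (Matrix.PosDef.diag_pos (A := A) hA (i := 0)).ne'
      have e := ofMatrix_one_inv A
      have ev : Eval (some (invBody pre mid post)) (invBody pre mid post)
          (.pair .nil (.pair (.pair (.real (A 0 0)) .nil) .nil))
          (.pair (.pair (.real (1 / A 0 0)) .nil) .nil) 12 :=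
        .ifNil_nil (.pair (.pair (.comp (.pair (.const _ _ _)
          (.comp (.fst _ (.pair (.real (A 0 0)) .nil) .nil) (.fst _ _ _))) (.div _ _ _ hA0))
          (.nil _ _)) (.nil _ _))
      refine ⟨12, ?_, ?_⟩
      · erw [e]
        exact ev
      · simp only [twoPow, Nat.cast_one, Real.one_rpow]
        push_cast
        linarith
    | succ k ih =>
      intro (A : Matrix (Fin (twoPow k + twoPow k)) (Fin (twoPow k + twoPow k)) ℝ) hA
      change ∃ l : ℕ, Eval (some (invBody pre mid post)) (invBody pre mid post)
        (.pair (halvings (k + 1)) (.ofMatrix A)) (.ofMatrix A⁻¹) l ∧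
        (l : ℝ) ≤ 2 * (C₁ + C₂ + C₃ + 15) * (twoPow (k + 1) : ℝ) ^ ω
      obtain ⟨P, Q, R, S, rfl⟩ := exists_blockMatrix (m := twoPow k) (n := twoPow k) A
      have hS := posDef_schur hA
      rw [Matrix.mul_assoc] at hS
      obtain ⟨l₁, e₁, hl₁⟩ := h₁ ⟨k, P, Q, R, S⟩
      obtain ⟨m₁, f₁, hm₁⟩ := ih P (posDef_of_blockMatrix hA)
      obtain ⟨l₂, e₂, hl₂⟩ := h₂ ⟨k, P⁻¹, Q, R, S⟩
      obtain ⟨m₂, f₂, hm₂⟩ := ih _ hS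
      obtain ⟨l₃, e₃, hl₃⟩ := h₃ ⟨k, (S - R * (P⁻¹ * Q))⁻¹, P⁻¹, P⁻¹ * Q, R * P⁻¹⟩
      rw [inv_blockMatrix hA rfl]
      refine ⟨_, .ifNil_pair (.comp (.comp (.comp (.comp (e₁.of_none _)
        (.pair (.comp (.fst _ _ _) (.self f₁)) (.snd _ _ _))) (e₂.of_none _))
        (.pair (.comp (.fst _ _ _) (.self f₂)) (.snd _ _ _))) (e₃.of_none _)), ?_⟩
      · have h4 := four_mul_twoPow_rpow_le k hω
        have h1 := one_le_rpow_nat (twoPow_pos (k + 1)) hω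
        dsimp only at hl₁ hl₂ hl₃
        push_cast
        have h5 : 2 * (C₁ + C₂ + C₃ + 15) * (4 * (twoPow k : ℝ) ^ ω) ≤
          2 * (C₁ + C₂ + C₃ + 15) * (twoPow (k + 1) : ℝ) ^ ω := by gcongr
        linarith
  refine ⟨.fix (invBody pre mid post), 2 * (C₁ + C₂ + C₃ + 15) + 1, by positivity, ?_⟩
  rintro ⟨k, A, hA⟩
  obtain ⟨l, hl, hle⟩ := key k A hA
  refine ⟨_, .fix hl, ?_⟩
  have h1 := one_le_rpow_nat (twoPow_pos k) hω
  dsimp only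
  push_cast
  linarith

end

theorem exists_le_twoPow (d : ℕ) : ∃ k, d ≤ twoPow k := ⟨d, (lt_twoPow d).le⟩

/-- The least `k` with `d ≤ 2 ^ k`. -/
def padExponent (d : ℕ) : ℕ := Nat.find (exists_le_twoPow d)

theorem le_twoPow_padExponent (d : ℕ) : d ≤ twoPow (padExponent d) :=
  Nat.find_spec (exists_le_twoPow d)

theorem twoPow_lt_of_lt_padExponent {d k : ℕ} (h : k < padExponent d) : twoPow k < d :=
  not_le.1 (Nat.find_min (exists_le_twoPow d) h)

theorem twoPow_padExponent_le {d : ℕ} (hd : 1 ≤ d) : twoPow (padExponent d) ≤ 2 * d := by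
  rcases h : padExponent d with _ | k
  · simp only [twoPow]
    omega
  · have := twoPow_lt_of_lt_padExponent (d := d) (k := k) (by omega)
    simp only [twoPow]
    omega

theorem padExponent_le {d : ℕ} (hd : 1 ≤ d) : padExponent d ≤ d := by
  rcases h : padExponent d with _ | k
  · omega
  · have := twoPow_lt_of_lt_padExponent (d := d) (k := k) (by omega)
    have := lt_twoPow k
    omega

/-- A power of two is doubled until it reaches `d`. The crude count of at most `d` rounds, each
writing a vector shorter than `d`, already fits into `d ^ 2`. -/
theorem comp_halvings : Comp (I := {d : ℕ // 1 ≤ d}) (fun d => .real (d : ℕ))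
    (fun d => .pair (.real (twoPow (padExponent d) : ℕ)) (halvings (padExponent d)))
    fun d => ((d : ℕ) : ℝ) ^ 2 := by
  have hd1 : ∀ d : {d : ℕ // 1 ≤ d}, (1 : ℝ) ≤ ((d : ℕ) : ℝ) := fun d => by exact_mod_cast d.2
  have hc1 : ∀ d : {d : ℕ // 1 ≤ d}, (1 : ℝ) ≤ ((d : ℕ) : ℝ) ^ 2 := fun d => by
    nlinarith [hd1 d]
  have key := Comp.loop (I := {d : ℕ // 1 ≤ d}) (X := fun d => .real (d : ℕ))
    (c := fun d => ((d : ℕ) : ℝ) ^ 2) (cb := fun d => ((d : ℕ) : ℝ)) (n := fun d => padExponent d)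
    (fun d j => .pair (.real (d : ℕ)) (.pair (.real (twoPow j : ℕ)) (halvings j)))
    (fun d j => ((d : ℕ) : ℝ) - (twoPow j : ℕ)) ?_ hd1 ?_ ?_ ?_ ?_ 2 (by norm_num) ?_
  · exact key.snd
  · refine (Comp.id hc1).pair (.pair ?_ (.nil hc1))
    simpa [twoPow] using Comp.const (X := fun d : {d : ℕ // 1 ≤ d} => .real (d : ℕ)) 1 hc1
  · have hid := Comp.id (X := fun q : Σ d : {d : ℕ // 1 ≤ d}, Fin (padExponent d + 1) =>
      Data.pair (.real (q.1 : ℕ)) (.pair (.real (twoPow q.2 : ℕ)) (halvings q.2)))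
      (c := fun q => ((q.1 : ℕ) : ℝ)) fun q => hd1 q.1
    exact hid.fst.sub hid.snd.fst
  · have hid := Comp.id (X := fun q : Σ d : {d : ℕ // 1 ≤ d}, Fin (padExponent d) =>
      Data.pair (.real (q.1 : ℕ)) (.pair (.real (twoPow q.2 : ℕ)) (halvings q.2)))
      (c := fun q => ((q.1 : ℕ) : ℝ)) fun q => hd1 q.1
    have hz := Comp.zeroVec hid.snd.fst (fun q => hd1 q.1) fun q => by
      have h1 : (twoPow q.2 : ℝ) < ((q.1 : ℕ) : ℝ) := by
        exact_mod_cast twoPow_lt_of_lt_padExponent q.2.2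
      linarith [hd1 q.1]
    refine hid.fst.pair (.pair ?_ (hz.pair hid.snd.snd))
    simpa [twoPow] using hid.snd.fst.add hid.snd.fst
  · intro d j hj
    simpa using twoPow_lt_of_lt_padExponent hj
  · intro d
    simpa using le_twoPow_padExponent d
  · intro d
    have h1 : (padExponent d : ℝ) ≤ ((d : ℕ) : ℝ) := by exact_mod_cast padExponent_le d.2
    nlinarith [hd1 d]

/-- Padding with an identity block reaches a power of two while keeping definiteness. -/
theorem posDef_pad {d e : ℕ} {A : Matrix (Fin d) (Fin d) ℝ} (hA : A.PosDef) :
    (blockMatrix A 0 0 (1 : Matrix (Fin e) (Fin e) ℝ)).PosDef := by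
  rw [posDef_blockMatrix_iff]
  have := hA.isUnit.invertible
  have h1 : (Matrix.fromBlocks A 0 (0 : Matrix (Fin d) (Fin e) ℝ).conjTranspose
      (1 : Matrix (Fin e) (Fin e) ℝ)).PosSemidef := by
    rw [hA.fromBlocks₁₁]
    simpa using Matrix.PosSemidef.one
  rw [Matrix.conjTranspose_zero] at h1
  refine h1.posDef_iff_isUnit.2 ?_
  rw [Matrix.isUnit_fromBlocks_iff_of_invertible₁₁]
  simp

theorem inv_pad {d e : ℕ} {A : Matrix (Fin d) (Fin d) ℝ} (hA : A.PosDef) :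
    (blockMatrix A 0 0 (1 : Matrix (Fin e) (Fin e) ℝ))⁻¹ = blockMatrix A⁻¹ 0 0 1 := by
  rw [inv_blockMatrix (posDef_pad hA) rfl]
  simp

/-- A padded size `d + e` equals a power of two only propositionally; carrying the equation as a
hypothesis avoids casting matrices. -/
theorem comp_inv_of_eq_twoPow {ω : ℝ} (hω : 2 ≤ ω) (hM : MatMulExponent ω) :
    Comp (I := {q : Σ n : ℕ, ℕ × Matrix (Fin n) (Fin n) ℝ // q.1 = twoPow q.2.1 ∧ q.2.2.PosDef})
    (fun q => .pair (halvings q.1.2.1) (.ofMatrix q.1.2.2)) (fun q => .ofMatrix q.1.2.2⁻¹)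
    fun q => (q.1.1 : ℝ) ^ ω := by
  obtain ⟨p, C, hC, h⟩ := comp_inv_twoPow hω hM
  refine ⟨p, C, hC, ?_⟩
  rintro ⟨⟨n, k, A⟩, hn, hA⟩
  dsimp only at hn hA
  subst hn
  exact h ⟨k, A, hA⟩

/-- Positive definite matrices of size `d` can be inverted within `O(d ^ ω)` steps. -/
theorem comp_inv {ω : ℝ} (hω : 2 ≤ ω) (hM : MatMulExponent ω) :
    Comp (I := {q : Σ d : ℕ, Matrix (Fin d) (Fin d) ℝ // 1 ≤ q.1 ∧ q.2.PosDef})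
    (fun q => .pair (.real (q.1.1 : ℕ)) (.ofMatrix q.1.2)) (fun q => .ofMatrix q.1.2⁻¹)
    fun q => (q.1.1 : ℝ) ^ ω := by
  let Q := {q : Σ d : ℕ, Matrix (Fin d) (Fin d) ℝ // 1 ≤ q.1 ∧ q.2.PosDef}
  -- The padded size is at most `2 * d`, so the size conditions need a budget larger than `d ^ ω`;
  -- the factor is removed at the end by `mono`.
  let c : Q → ℝ := fun q => 4 * (q.1.1 : ℝ) ^ ω
  let k : Q → ℕ := fun q => padExponent q.1.1
  let e : Q → ℕ := fun q => twoPow (k q) - q.1.1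
  have hd1 : ∀ q : Q, (1 : ℝ) ≤ (q.1.1 : ℝ) := fun q => by exact_mod_cast q.2.1
  have hdω : ∀ q : Q, (1 : ℝ) ≤ (q.1.1 : ℝ) ^ ω := fun q => one_le_rpow_nat q.2.1 hω
  have hd2 : ∀ q : Q, (q.1.1 : ℝ) ^ 2 ≤ (q.1.1 : ℝ) ^ ω := fun q => sq_le_rpow_nat q.2.1 hω
  have hc1 : ∀ q, 1 ≤ c q := fun q => by
    simp only [c]
    linarith [hdω q]
  have hde : ∀ q, q.1.1 + e q = twoPow (k q) := fun q =>
    Nat.add_sub_of_le (le_twoPow_padExponent q.1.1)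
  have hed : ∀ q, (e q : ℝ) ≤ q.1.1 := fun q => by
    have := hde q
    have : twoPow (k q) ≤ 2 * q.1.1 := twoPow_padExponent_le q.2.1
    exact_mod_cast (by omega : e q ≤ q.1.1)
  have he0 : ∀ q, (0 : ℝ) ≤ e q := fun q => Nat.cast_nonneg _
  have hdim : ∀ q : Q, ((q.1.1 : ℝ) + e q + 1) * (q.1.1 + e q + 1) ≤ 4 * c q := fun q => by
    simp only [c]
    nlinarith [hd1 q, hd2 q, hed q, he0 q]
  have hdd : ∀ q : Q, ((q.1.1 : ℝ) + 1) * (q.1.1 + 1) ≤ 4 * c q := fun q => by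
    nlinarith [hd1 q, hdim q, he0 q, mul_nonneg (he0 q) (he0 q)]
  have hee : ∀ q : Q, ((e q : ℝ) + 1) * (e q + 1) ≤ 4 * c q := fun q => by
    nlinarith [hd1 q, hdim q, he0 q]
  have hdde : ∀ q : Q, ((q.1.1 : ℝ) + 1) * (e q + 1) ≤ 4 * c q := fun q => by
    nlinarith [hd1 q, hdim q, he0 q]
  have hed' : ∀ q : Q, ((e q : ℝ) + 1) * (q.1.1 + 1) ≤ 4 * c q := fun q => by
    nlinarith [hd1 q, hdim q, he0 q]
  have hid := Comp.id (X := fun q : Q => Data.pair (.real (q.1.1 : ℕ)) (.ofMatrix q.1.2)) hc1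
  have hh := Comp.call comp_halvings (fun q : Q => ⟨q.1.1, q.2.1⟩) hid.fst 1 zero_le_one fun q => by
    simp only [c]
    nlinarith [hd2 q, hdω q]
  have hke : Comp (fun q : Q => Data.pair (.real (q.1.1 : ℕ)) (.ofMatrix q.1.2))
      (fun q => .real (e q)) c := by
    refine (hh.fst.sub hid.fst).congr_right fun q => ?_
    rw [← hde q]
    push_cast
    ring_nf
  have h0 := Comp.zeroMatrix hid.fst hke hc1 hdde
  have h0' := Comp.zeroMatrix hke hid.fst hc1 hed'
  have h1 := Comp.oneMatrix hke hc1 hee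
  have hpad := Comp.blockMatrix hid.snd h0 h0' h1 hc1 hdim
  have hinv := Comp.call (comp_inv_of_eq_twoPow hω hM) (fun q : Q => ⟨⟨q.1.1 + e q, k q,
    blockMatrix q.1.2 0 0 1⟩, hde q, posDef_pad q.2.2⟩) (hh.snd.pair hpad) (2 ^ ω) (by positivity)
    fun q => by
      have h2 : ((q.1.1 + e q : ℕ) : ℝ) ≤ 2 * q.1.1 := by
        push_cast
        linarith [hed q]
      calc ((q.1.1 + e q : ℕ) : ℝ) ^ ω ≤ (2 * (q.1.1 : ℝ)) ^ ω := by gcongr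
        _ = 2 ^ ω * (q.1.1 : ℝ) ^ ω := Real.mul_rpow (by norm_num) (by positivity)
        _ ≤ 2 ^ ω * c q := by
          gcongr
          simp only [c]
          linarith [hdω q]
  have hinv' := hinv.congr_right fun q => congrArg Data.ofMatrix (inv_pad (e := e q) q.2.2)
  have hz := Comp.zeroVec hid.fst hc1 fun q => by nlinarith [hdd q, hd1 q]
  exact (Comp.splitBlocks hz hinv' hc1 hdim).fst.fst.mono 4 (by norm_num) fun q => le_rfl

end RealMachine

namespace UnboundedOCO

/-! ### Projections in the norm of a positive definite operator -/

section Projection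

variable {E : Type*} [NormedAddCommGroup E] [InnerProductSpace ℝ E] {T : E →ₗ[ℝ] E} {a : ℝ}

/-- The equation says `T (p - y) = -l • p`. Expanding the quadratic form around `p`, the cross term
is `-2 * l * ⟪w - p, p⟫`, which is nonnegative by Cauchy–Schwarz because `p` lies on the sphere. -/
theorem quadratic_le_of_kkt (hT : T.IsSymmetric) (hT0 : ∀ x, 0 ≤ inner ℝ x (T x)) {l R : ℝ}
    (hl : 0 ≤ l) {p y w : E} (hp : ‖p‖ = R) (hkkt : T p + l • p = T y) (hw : ‖w‖ ≤ R) :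
    inner ℝ (p - y) (T (p - y)) ≤ inner ℝ (w - y) (T (w - y)) := by
  have h1 : w - y = (w - p) + (p - y) := by abel
  have h2 : T (p - y) = -(l • p) := by
    rw [map_sub, ← hkkt]
    abel
  have h3 : inner ℝ (p - y) (T (w - p)) = inner ℝ (w - p) (T (p - y)) := by
    rw [← hT, real_inner_comm]
  have h4 : inner ℝ (w - p) p ≤ 0 := by
    rw [inner_sub_left, real_inner_self_eq_norm_sq]
    have := real_inner_le_norm w p
    nlinarith [norm_nonneg p]
  have h5 : inner ℝ (w - p) (T (p - y)) = -(l * inner ℝ (w - p) p) := by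
    rw [h2, inner_neg_right, inner_smul_right]
  rw [h1, map_add, inner_add_left, inner_add_right, inner_add_right, h3, h5]
  nlinarith [hT0 (w - p), mul_nonneg hl (neg_nonneg.2 h4)]

/-- Pair the equation with `x` itself and divide by `‖x‖`. -/
theorem norm_le_of_coercive (hT : ∀ x, a * ‖x‖ ^ 2 ≤ inner ℝ x (T x)) {l : ℝ} {x b : E}
    (h : T x + l • x = b) : (a + l) * ‖x‖ ≤ ‖b‖ := by
  rcases (norm_nonneg x).eq_or_lt with h0 | h0
  · rw [← h0, mul_zero]
    exact norm_nonneg b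
  · have h1 : inner ℝ x b = inner ℝ x (T x) + l * ‖x‖ ^ 2 := by
      rw [← h, inner_add_right, inner_smul_right, real_inner_self_eq_norm_sq]
    have h2 := real_inner_le_norm x b
    have h3 := hT x
    refine le_of_mul_le_mul_left ?_ h0
    nlinarith

/-- The difference `p - q` solves the same kind of equation with right-hand side `(m - l) • q`, so
the solution depends on the multiplier in a Lipschitz way. -/
theorem norm_sub_le_of_coercive (hT : ∀ x, a * ‖x‖ ^ 2 ≤ inner ℝ x (T x))
    {l m : ℝ} {p q b : E} (hl : 0 ≤ l) (hp : T p + l • p = b) (hq : T q + m • q = b) :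
    a * ‖p - q‖ ≤ |m - l| * ‖q‖ := by
  have h1 : T (p - q) + l • (p - q) = (m - l) • q := by
    have : T p + l • p = T q + m • q := hp.trans hq.symm
    rw [map_sub, smul_sub, sub_smul]
    linear_combination (norm := module) this
  have h2 := norm_le_of_coercive hT h1
  rw [norm_smul, Real.norm_eq_abs] at h2
  nlinarith [norm_nonneg (p - q)]

/-- If the norm of the solution `p l` of `T p + l p = T y` crosses `R` between `lo` and `hi`, then
`p hi` is close to the projection of `y` onto the ball of radius `R`. -/
theorem exists_projection_near (ha : 0 < a) (hsym : T.IsSymmetric)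
    (hT : ∀ x, a * ‖x‖ ^ 2 ≤ inner ℝ x (T x)) {p : ℝ → E} {y : E}
    (hp : ∀ l, 0 ≤ l → T (p l) + l • p l = T y) {lo hi R : ℝ} (h0 : 0 ≤ lo) (hlh : lo ≤ hi)
    (hlo : R ≤ ‖p lo‖) (hhi : ‖p hi‖ ≤ R) :
    ∃ q, ‖q‖ ≤ R ∧ (∀ w, ‖w‖ ≤ R →
      inner ℝ (q - y) (T (q - y)) ≤ inner ℝ (w - y) (T (w - y))) ∧
      a * ‖p hi - q‖ ≤ (hi - lo) * R := by
  -- Continuity yields a multiplier in `[lo, hi]` whose solution has norm exactly `R`; by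
  -- `quadratic_le_of_kkt` that solution is the projection.
  have hcont : ContinuousOn (fun l => ‖p l‖) (Set.Icc lo hi) := by
    refine ContinuousOn.norm ?_
    have hlip : LipschitzOnWith (Real.toNNReal (‖T y‖ / a / a)) p (Set.Icc lo hi) := by
      refine LipschitzOnWith.of_dist_le_mul fun l hl m hm => ?_
      have hl0 := h0.trans hl.1
      have hm0 := h0.trans hm.1
      have h1 := norm_sub_le_of_coercive hT hl0 (hp l hl0) (hp m hm0)
      have h2 := norm_le_of_coercive hT (hp m hm0)
      have h3 : ‖p m‖ ≤ ‖T y‖ / a := by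
        rw [le_div_iff₀ ha]
        nlinarith [norm_nonneg (p m)]
      rw [Real.coe_toNNReal _ (by positivity), dist_eq_norm, Real.dist_eq, abs_sub_comm l m]
      rw [div_mul_eq_mul_div, le_div_iff₀ ha]
      nlinarith [abs_nonneg (m - l)]
    exact hlip.continuousOn
  obtain ⟨l, hl, hlR⟩ := intermediate_value_Icc' hlh hcont ⟨hhi, hlo⟩
  have hl0 := h0.trans hl.1
  have hT0 : ∀ x, 0 ≤ inner ℝ x (T x) := fun x => le_trans (by positivity) (hT x)
  refine ⟨p l, hlR.le, fun w hw => quadratic_le_of_kkt hsym hT0 hl0 hlR (hp l hl0) hw, ?_⟩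
  have h1 := norm_sub_le_of_coercive hT (hl0.trans hl.2) (hp hi (hl0.trans hl.2)) (hp l hl0)
  have h2 : |l - hi| ≤ hi - lo := by
    rw [abs_le]
    constructor <;> linarith [hl.1, hl.2]
  dsimp only at hlR
  rw [hlR] at h1
  refine h1.trans (mul_le_mul_of_nonneg_right h2 ?_)
  rw [← hlR]
  exact norm_nonneg _

/-- A point near the projection is almost as close to a point of the ball as `y`. -/
theorem quadratic_near_projection_le (hsym : T.IsSymmetric) (hT0 : ∀ x, 0 ≤ inner ℝ x (T x))
    {R b δ : ℝ} (hb : ∀ x, ‖T x‖ ≤ b * ‖x‖) {q y v u : E} (hq : ‖q‖ ≤ R)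
    (hmin : ∀ w, ‖w‖ ≤ R → inner ℝ (q - y) (T (q - y)) ≤ inner ℝ (w - y) (T (w - y)))
    (hu : ‖u‖ ≤ R) (hv : ‖v‖ ≤ R) (hvq : ‖v - q‖ ≤ δ) (hb0 : 0 ≤ b) :
    inner ℝ (v - u) (T (v - u)) ≤ inner ℝ (y - u) (T (y - u)) + b * δ * (4 * R) := by
  -- The first-order optimality condition at `q`, obtained by moving from `q` towards `u` inside the
  -- ball.
  have hvar : 0 ≤ inner ℝ (u - q) (T (q - y)) := by
    by_contra! hneg
    have key : ∀ s ∈ Set.Icc (0 : ℝ) 1, 0 ≤ 2 * s * inner ℝ (u - q) (T (q - y)) +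
        s ^ 2 * inner ℝ (u - q) (T (u - q)) := by
      intro s hs
      have hw : ‖q + s • (u - q)‖ ≤ R := by
        have : q + s • (u - q) = (1 - s) • q + s • u := by
          rw [smul_sub, sub_smul, one_smul]
          abel
        rw [this]
        refine (norm_add_le _ _).trans ?_
        rw [norm_smul, norm_smul, Real.norm_of_nonneg hs.1, Real.norm_of_nonneg (by linarith [hs.2])]
        nlinarith [hs.1, hs.2]
      have h1 := hmin _ hw
      have h2 : q + s • (u - q) - y = (q - y) + s • (u - q) := by abel
      rw [h2, map_add, map_smul, inner_add_left, inner_add_right, inner_add_right, inner_smul_left,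
        inner_smul_right, inner_smul_left, inner_smul_right, ← hsym (q - y) (u - q),
        real_inner_comm (u - q) (T (q - y))] at h1
      simp only [RCLike.conj_to_real] at h1
      nlinarith
    set α := inner ℝ (u - q) (T (q - y))
    set β := inner ℝ (u - q) (T (u - q))
    have hβ : 0 ≤ β := hT0 _
    have hpos : 0 < β - α := by linarith
    -- With this `s` one has `s * β ≤ -α`, so `2 * α + s * β ≤ α < 0`, against `key` divided by `s`.
    have hs : (-α) / (β - α) ∈ Set.Icc (0 : ℝ) 1 :=
      ⟨div_nonneg (by linarith) hpos.le, (div_le_one hpos).2 (by linarith)⟩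
    have h3 := key _ hs
    have hsp : 0 < (-α) / (β - α) := div_pos (by linarith) hpos
    have h4 : (-α) / (β - α) * β ≤ -α := by
      rw [div_mul_eq_mul_div, div_le_iff₀ hpos]
      nlinarith
    nlinarith
  have h1 : inner ℝ (q - u) (T (q - u)) ≤ inner ℝ (y - u) (T (y - u)) := by
    have e : y - u = (q - u) - (q - y) := by abel
    have e2 : inner ℝ (q - u) (T (q - y)) = -inner ℝ (u - q) (T (q - y)) := by
      rw [← inner_neg_left, neg_sub]
    have e3 : inner ℝ ((q - u) - (q - y)) (T ((q - u) - (q - y))) = inner ℝ (q - u) (T (q - u)) -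
        2 * inner ℝ (q - u) (T (q - y)) + inner ℝ (q - y) (T (q - y)) := by
      rw [map_sub T (q - u), inner_sub_left (q - u), inner_sub_right (q - u),
        inner_sub_right (q - y), ← hsym (q - y) (q - u), real_inner_comm (q - u) (T (q - y))]
      ring
    rw [e, e3, e2]
    linarith [hT0 (q - y)]
  have e : v - u = (q - u) + (v - q) := by abel
  -- A difference of two squares in the form of `T`: `Q (a + b) - Q a = ⟪T b, a + (a + b)⟫`. Both
  -- vectors in the second slot have norm at most `2 * R`.
  have e3 : inner ℝ (v - u) (T (v - u)) =
      inner ℝ (q - u) (T (q - u)) + inner ℝ (T (v - q)) ((q - u) + (v - u)) := by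
    rw [e, map_add, inner_add_left, inner_add_right, inner_add_right, inner_add_right,
      inner_add_right, hsym (v - q) (q - u), hsym (v - q) (v - q),
      ← hsym (q - u) (v - q), real_inner_comm (v - q) (T (q - u))]
    ring
  have h2 : ‖(q - u) + (v - u)‖ ≤ 4 * R := by
    refine (norm_add_le _ _).trans ?_
    linarith [norm_sub_le q u, norm_sub_le v u]
  have h3 := real_inner_le_norm (T (v - q)) ((q - u) + (v - u))
  have h4 : ‖T (v - q)‖ ≤ b * δ := (hb _).trans (by gcongr)
  have hδ : 0 ≤ δ := (norm_nonneg _).trans hvq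
  have h5 : ‖T (v - q)‖ * ‖(q - u) + (v - u)‖ ≤ b * δ * (4 * R) := by gcongr
  linarith

end Projection

/-! ### Projection onto the ball of radius `1 / 2` by bisection -/

section Bisection

variable {d : ℕ}

theorem inner_toLp (x y : Fin d → ℝ) :
    inner ℝ (WithLp.toLp 2 x : EuclideanSpace ℝ (Fin d)) (WithLp.toLp 2 y) = x ⬝ᵥ y := by
  rw [EuclideanSpace.inner_toLp_toLp, star_trivial, dotProduct_comm]

theorem norm_toLp_sq (x : Fin d → ℝ) :
    ‖(WithLp.toLp 2 x : EuclideanSpace ℝ (Fin d))‖ ^ 2 = x ⬝ᵥ x := by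
  rw [← inner_toLp, real_inner_self_eq_norm_sq]

theorem norm_toLp (x : Fin d → ℝ) :
    ‖(WithLp.toLp 2 x : EuclideanSpace ℝ (Fin d))‖ = Real.sqrt (x ⬝ᵥ x) := by
  rw [← norm_toLp_sq, Real.sqrt_sq (norm_nonneg _)]

theorem toEuclideanLin_toLp (A : Matrix (Fin d) (Fin d) ℝ) (x : Fin d → ℝ) :
    Matrix.toEuclideanLin A (WithLp.toLp 2 x) = WithLp.toLp 2 (A.mulVec x) := rfl

theorem ofLp_toEuclideanLin (A : Matrix (Fin d) (Fin d) ℝ) (x : EuclideanSpace ℝ (Fin d)) :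
    (Matrix.toEuclideanLin A x).ofLp = A.mulVec x.ofLp := rfl

/-- The minimizer of `w ↦ (w - y)ᵀ A (w - y) + l wᵀ w`. -/
noncomputable def ridge (A : Matrix (Fin d) (Fin d) ℝ) (y : Fin d → ℝ) (l : ℝ) : Fin d → ℝ :=
  (A + l • (1 : Matrix (Fin d) (Fin d) ℝ))⁻¹.mulVec (A.mulVec y)

/-- Bisection for the multiplier of the constraint `‖w‖ ≤ 1 / 2`. -/
noncomputable def bisection (A : Matrix (Fin d) (Fin d) ℝ) (y : Fin d → ℝ) : ℕ → ℝ × ℝ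
  | 0 => (0, 2 * Real.sqrt (A.mulVec y ⬝ᵥ A.mulVec y))
  | j + 1 =>
    let b := bisection A y j
    if ridge A y ((b.1 + b.2) / 2) ⬝ᵥ ridge A y ((b.1 + b.2) / 2) ≤ 1 / 4 then
      (b.1, (b.1 + b.2) / 2) else ((b.1 + b.2) / 2, b.2)

/-- The number of bisection steps until the interval has length at most `ζ`. -/
noncomputable def bisectionLength (A : Matrix (Fin d) (Fin d) ℝ) (y : Fin d → ℝ) (ζ : ℝ) : ℕ :=
  sInf {j | (bisection A y j).2 - (bisection A y j).1 ≤ ζ}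

/-- The approximate projection. -/
noncomputable def approxProj (A : Matrix (Fin d) (Fin d) ℝ) (y : Fin d → ℝ) (ζ : ℝ) : Fin d → ℝ :=
  ridge A y (bisection A y (bisectionLength A y ζ)).2

variable {A : Matrix (Fin d) (Fin d) ℝ} {y : Fin d → ℝ} {ζ : ℝ}

theorem bisection_width (j : ℕ) : (bisection A y j).2 - (bisection A y j).1 =
    2 * Real.sqrt (A.mulVec y ⬝ᵥ A.mulVec y) / 2 ^ j := by
  induction j with
  | zero => simp [bisection]
  | succ j ih =>
    rw [pow_succ, ← div_div, ← ih, bisection]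
    split_ifs <;> ring

theorem bisection_le (j : ℕ) : (bisection A y j).1 ≤ (bisection A y j).2 := by
  rw [← sub_nonneg, bisection_width]
  positivity

theorem bisection_fst_nonneg (j : ℕ) : 0 ≤ (bisection A y j).1 := by
  induction j with
  | zero => simp [bisection]
  | succ j ih =>
    rw [bisection]
    have := bisection_le (A := A) (y := y) j
    split_ifs
    · exact ih
    · linarith

theorem bisectionLength_spec (hζ : 0 < ζ) :
    (bisection A y (bisectionLength A y ζ)).2 - (bisection A y (bisectionLength A y ζ)).1 ≤ ζ := by
  refine Nat.sInf_mem (s := {j | (bisection A y j).2 - (bisection A y j).1 ≤ ζ}) ?_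
  obtain ⟨j, hj⟩ := pow_unbounded_of_one_lt (2 * Real.sqrt (A.mulVec y ⬝ᵥ A.mulVec y) / ζ)
    (one_lt_two : (1 : ℝ) < 2)
  refine ⟨j, ?_⟩
  rw [Set.mem_ofPred_eq, bisection_width, div_le_iff₀ (by positivity)]
  rw [div_lt_iff₀ hζ] at hj
  linarith

theorem lt_of_lt_bisectionLength {j : ℕ} (hj : j < bisectionLength A y ζ) :
    ζ < (bisection A y j).2 - (bisection A y j).1 :=
  not_le.1 (Nat.notMem_of_lt_sInf hj)

theorem bisectionLength_le {j : ℕ} (h : 2 * Real.sqrt (A.mulVec y ⬝ᵥ A.mulVec y) ≤ ζ * 2 ^ j) :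
    bisectionLength A y ζ ≤ j := by
  refine Nat.sInf_le ?_
  rw [Set.mem_ofPred_eq, bisection_width, div_le_iff₀ (by positivity)]
  exact h

theorem posDef_add_smul_one (hA : A.PosDef) {l : ℝ} (hl : 0 ≤ l) :
    (A + l • (1 : Matrix (Fin d) (Fin d) ℝ)).PosDef :=
  hA.add_posSemidef (Matrix.PosSemidef.one.smul hl)

theorem ridge_eq (hA : A.PosDef) {l : ℝ} (hl : 0 ≤ l) :
    Matrix.toEuclideanLin A (WithLp.toLp 2 (ridge A y l)) + l • WithLp.toLp 2 (ridge A y l) =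
      Matrix.toEuclideanLin A (WithLp.toLp 2 y) := by
  rw [toEuclideanLin_toLp, toEuclideanLin_toLp, ← WithLp.toLp_smul,
    ← WithLp.toLp_add]
  congr 1
  have h1 : (A + l • (1 : Matrix (Fin d) (Fin d) ℝ)).mulVec (ridge A y l) = A.mulVec y := by
    rw [ridge, Matrix.mulVec_mulVec, Matrix.mul_nonsing_inv, Matrix.one_mulVec]
    exact (Matrix.isUnit_iff_isUnit_det _).1 (posDef_add_smul_one hA hl).isUnit
  rw [← h1, Matrix.add_mulVec, Matrix.smul_mulVec, Matrix.one_mulVec]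

/-- At `l = 0` the ridge solution is `y`, outside the open ball. At the initial right end `l = 2 *
‖A y‖`, coercivity bounds its norm by `‖A y‖ / (a + l)`, below `1 / 2`. Each halving keeps one end
on either side. -/
theorem bisection_invariant {a : ℝ} (ha : 0 < a) (hA : A.PosDef)
    (hAa : ∀ x : EuclideanSpace ℝ (Fin d), a * ‖x‖ ^ 2 ≤ inner ℝ x (Matrix.toEuclideanLin A x))
    (hy : 1 / 2 ≤ ‖(WithLp.toLp 2 y : EuclideanSpace ℝ (Fin d))‖) (j : ℕ) :
    1 / 2 ≤ ‖(WithLp.toLp 2 (ridge A y (bisection A y j).1) : EuclideanSpace ℝ (Fin d))‖ ∧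
      ‖(WithLp.toLp 2 (ridge A y (bisection A y j).2) : EuclideanSpace ℝ (Fin d))‖ ≤ 1 / 2 := by
  induction j with
  | zero =>
    constructor
    · have : ridge A y 0 = y := by
        rw [ridge, zero_smul, add_zero, Matrix.mulVec_mulVec, Matrix.nonsing_inv_mul,
          Matrix.one_mulVec]
        exact (Matrix.isUnit_iff_isUnit_det _).1 hA.isUnit
      simpa [bisection, this] using hy
    · simp only [bisection]
      rw [← norm_toLp, ← toEuclideanLin_toLp]
      set b := ‖Matrix.toEuclideanLin A (WithLp.toLp 2 y)‖
      have h1 := norm_le_of_coercive hAa (ridge_eq (y := y) hA (l := 2 * b) (by positivity))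
      have h2 : 0 ≤ b := norm_nonneg _
      have h3 := norm_nonneg (WithLp.toLp 2 (ridge A y (2 * b)) : EuclideanSpace ℝ (Fin d))
      by_contra! h
      have h4 : b * 1 ≤ 2 * b * ‖(WithLp.toLp 2 (ridge A y (2 * b)) : EuclideanSpace ℝ (Fin d))‖ := by
        nlinarith
      nlinarith
  | succ j ih =>
    rw [bisection]
    dsimp only
    split_ifs with h
    · refine ⟨ih.1, ?_⟩
      rw [← norm_toLp_sq] at h
      dsimp only
      nlinarith [norm_nonneg (WithLp.toLp 2 (ridge A y (((bisection A y j).1 +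
        (bisection A y j).2) / 2)) : EuclideanSpace ℝ (Fin d))]
    · refine ⟨?_, ih.2⟩
      rw [← norm_toLp_sq] at h
      dsimp only
      nlinarith [norm_nonneg (WithLp.toLp 2 (ridge A y (((bisection A y j).1 +
        (bisection A y j).2) / 2)) : EuclideanSpace ℝ (Fin d))]

/-- The right end of the interval is used because its ridge solution lies in the ball. The error is
at most `ζ * (1 / 2) / a`, which is where `1 / 2 ≤ a` enters. -/
theorem approxProj_spec {a : ℝ} (ha : 1 / 2 ≤ a) (hA : A.PosDef)
    (hAa : ∀ x : EuclideanSpace ℝ (Fin d), a * ‖x‖ ^ 2 ≤ inner ℝ x (Matrix.toEuclideanLin A x))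
    (hy : 1 / 2 ≤ ‖(WithLp.toLp 2 y : EuclideanSpace ℝ (Fin d))‖) (hζ : 0 < ζ) :
    ‖(WithLp.toLp 2 (approxProj A y ζ) : EuclideanSpace ℝ (Fin d))‖ ≤ 1 / 2 ∧
      ∃ p, IsMahalanobisProj A (1 / 2) (WithLp.toLp 2 y) p ∧
        ‖(WithLp.toLp 2 (approxProj A y ζ) : EuclideanSpace ℝ (Fin d)) - p‖ ≤ ζ := by
  have ha0 : 0 < a := by linarith
  obtain ⟨h1, h2⟩ := bisection_invariant ha0 hA hAa hy (bisectionLength A y ζ)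
  refine ⟨h2, ?_⟩
  obtain ⟨q, hq, hmin, hle⟩ := exists_projection_near ha0
    (Matrix.isSymmetric_toEuclideanLin_iff.2 hA.1) hAa
    (p := fun l => WithLp.toLp 2 (ridge A y l)) (fun l hl => ridge_eq hA hl)
    (bisection_fst_nonneg _) (bisection_le _) h1 h2
  refine ⟨q, ⟨hq, hmin⟩, ?_⟩
  have h3 := bisectionLength_spec (A := A) (y := y) hζ
  have h4 := norm_nonneg ((WithLp.toLp 2 (approxProj A y ζ) : EuclideanSpace ℝ (Fin d)) - q)
  change a * ‖(WithLp.toLp 2 (approxProj A y ζ) : EuclideanSpace ℝ (Fin d)) - q‖ ≤ _ at hle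
  nlinarith

end Bisection

end UnboundedOCO

/-! ### The running time of the approximate projection. -/

namespace RealMachine

open UnboundedOCO

/-- The data of one projection. -/
structure ProjInput where
  d : ℕ
  A : Matrix (Fin d) (Fin d) ℝ
  y : Fin d → ℝ
  ζ : ℝ
  one_le : 1 ≤ d
  posDef : A.PosDef
  pos : 0 < ζ

/-- One inversion per multiplier; the vector `A y` does not depend on the multiplier and is expected
ready-made. -/
theorem comp_ridge {ω : ℝ} (hω : 2 ≤ ω) (hM : MatMulExponent ω) {I : Type} {X : I → Data}
    {c : I → ℝ} {q : I → ProjInput} {l : I → ℝ}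
    (hd : Comp X (fun i => .real (q i).d) c) (hA : Comp X (fun i => .ofMatrix (q i).A) c)
    (hy : Comp X (fun i => .ofVec ((q i).A.mulVec (q i).y)) c) (hl : Comp X (fun i => .real (l i)) c)
    (hl0 : ∀ i, 0 ≤ l i) (hc : ∀ i, ((q i).d : ℝ) ^ ω ≤ c i) :
    Comp X (fun i => .ofVec (ridge (q i).A (q i).y (l i))) c := by
  have hd1 : ∀ i, (1 : ℝ) ≤ (q i).d := fun i => by exact_mod_cast (q i).one_le
  have hc1 : ∀ i, 1 ≤ c i := fun i => (one_le_rpow_nat (q i).one_le hω).trans (hc i)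
  have hdim : ∀ i, (((q i).d : ℝ) + 1) * ((q i).d + 1) ≤ 4 * c i := fun i => by
    nlinarith [hd1 i, hc i, sq_le_rpow_nat (q i).one_le hω]
  have hone := Comp.oneMatrix hd hc1 hdim
  have hsum := (Comp.mlin (Comp.const 1 hc1) hl hA hone hc1 hdim).congr_right
    (Z := fun i => .ofMatrix ((q i).A + l i • (1 : Matrix (Fin (q i).d) (Fin (q i).d) ℝ)))
    fun i => by rw [one_smul]
  have hinv := Comp.call (comp_inv hω hM) (fun i => ⟨⟨(q i).d, (q i).A + l i • 1⟩, (q i).one_le,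
    posDef_add_smul_one (q i).posDef (hl0 i)⟩) (hd.pair hsum) 1 zero_le_one
    fun i => by simpa using hc i
  exact Comp.mulVec hinv hy hc1 hdim

theorem comp_approxProj {ω : ℝ} (hω : 2 ≤ ω) (hM : MatMulExponent ω) :
    Comp (I := ProjInput) (fun q => .pair (.real q.d) (.pair (.ofMatrix q.A) (.pair (.ofVec q.y)
      (.real q.ζ)))) (fun q => .ofVec (approxProj q.A q.y q.ζ))
      fun q => ((bisectionLength q.A q.y q.ζ : ℝ) + 1) * (q.d : ℝ) ^ ω := by
  set c : ProjInput → ℝ := fun q => ((bisectionLength q.A q.y q.ζ : ℝ) + 1) * (q.d : ℝ) ^ ω with hcdef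
  have hdω : ∀ q : ProjInput, (1 : ℝ) ≤ (q.d : ℝ) ^ ω := fun q => one_le_rpow_nat q.one_le hω
  have hN : ∀ q : ProjInput, (0 : ℝ) ≤ bisectionLength q.A q.y q.ζ := fun q => Nat.cast_nonneg _
  have hcd : ∀ q, (q.d : ℝ) ^ ω ≤ c q := fun q => by
    simp only [hcdef]
    nlinarith [hN q, hdω q]
  have hc1 : ∀ q, 1 ≤ c q := fun q => (hdω q).trans (hcd q)
  have hd1 : ∀ q : ProjInput, (1 : ℝ) ≤ q.d := fun q => by exact_mod_cast q.one_le
  have hdim : ∀ q, ((q.d : ℝ) + 1) * (q.d + 1) ≤ 4 * c q := fun q => by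
    nlinarith [hd1 q, hcd q, sq_le_rpow_nat q.one_le hω]
  have hdim1 : ∀ q, (q.d : ℝ) + 1 ≤ 4 * c q := fun q => by
    nlinarith [hd1 q, hdim q]
  have hid := Comp.id (X := fun q : ProjInput => Data.pair (.real q.d) (.pair (.ofMatrix q.A)
    (.pair (.ofVec q.y) (.real q.ζ)))) hc1
  have hAy := Comp.mulVec hid.snd.fst hid.snd.snd.fst hc1 hdim
  have henv := hid.fst.pair (hid.snd.fst.pair (hAy.pair hid.snd.snd.snd))
  have hhi := (Comp.const 2 hc1).mul (Comp.sqrt (Comp.dot hAy hAy hc1 hdim1)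
    fun q => by rw [← norm_toLp_sq]; positivity)
  have key := Comp.loop (I := ProjInput) (c := c) (cb := fun q => (q.d : ℝ) ^ ω)
    (n := fun q => bisectionLength q.A q.y q.ζ)
    (fun q j => .pair (.pair (.real (bisection q.A q.y j).1) (.real (bisection q.A q.y j).2))
      (.pair (.real q.d) (.pair (.ofMatrix q.A) (.pair (.ofVec (q.A.mulVec q.y)) (.real q.ζ)))))
    (fun q j => (bisection q.A q.y j).2 - (bisection q.A q.y j).1 - q.ζ)
    (((Comp.const 0 hc1).pair hhi).pair henv) hdω ?_ ?_
    (fun q j hj => by linarith [lt_of_lt_bisectionLength hj])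
    (fun q => by linarith [bisectionLength_spec (A := q.A) (y := q.y) q.pos]) 1 zero_le_one
    fun q => by simp [hcdef]
  · exact comp_ridge hω hM (q := fun q => q) key.snd.fst key.snd.snd.fst key.snd.snd.snd.fst
      key.fst.snd (fun q => (bisection_fst_nonneg _).trans (bisection_le _)) hcd
  · have hid := Comp.id (X := fun r : Σ q : ProjInput, Fin (bisectionLength q.A q.y q.ζ + 1) =>
      Data.pair (.pair (.real (bisection r.1.A r.1.y r.2).1) (.real (bisection r.1.A r.1.y r.2).2))
      (.pair (.real r.1.d) (.pair (.ofMatrix r.1.A) (.pair (.ofVec (r.1.A.mulVec r.1.y))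
      (.real r.1.ζ))))) (c := fun r => (r.1.d : ℝ) ^ ω) fun r => hdω r.1
    exact (hid.fst.snd.sub hid.fst.fst).sub hid.snd.snd.snd.snd
  · have hcr : ∀ r : Σ q : ProjInput, Fin (bisectionLength q.A q.y q.ζ),
        1 ≤ (r.1.d : ℝ) ^ ω := fun r => hdω r.1
    have hid := Comp.id (X := fun r : Σ q : ProjInput, Fin (bisectionLength q.A q.y q.ζ) =>
      Data.pair (.pair (.real (bisection r.1.A r.1.y r.2).1) (.real (bisection r.1.A r.1.y r.2).2))
      (.pair (.real r.1.d) (.pair (.ofMatrix r.1.A) (.pair (.ofVec (r.1.A.mulVec r.1.y))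
      (.real r.1.ζ))))) (c := fun r => (r.1.d : ℝ) ^ ω) hcr
    have hmid := (hid.fst.fst.add hid.fst.snd).div (Comp.const 2 hcr) fun _ => two_ne_zero
    have hr := comp_ridge hω hM (q := fun r : Σ q : ProjInput,
      Fin (bisectionLength q.A q.y q.ζ) => r.1) hid.snd.fst hid.snd.snd.fst hid.snd.snd.snd.fst hmid
      (fun r => by
        have h1 := bisection_fst_nonneg (A := r.1.A) (y := r.1.y) r.2
        have h2 := bisection_le (A := r.1.A) (y := r.1.y) r.2
        linarith) fun r => le_rfl
    have hrr := Comp.dot hr hr hcr fun r => by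
      nlinarith [hd1 r.1, sq_le_rpow_nat r.1.one_le hω]
    refine Comp.ite_le hrr (Comp.const (1 / 4) hcr) hid ?_ ?_
    · refine ((hid.fst.fst.pair hmid).pair hid.snd).reindex (fun r : {r // _} => r.1)
        |>.congr_right ?_
      rintro ⟨r, h⟩
      simp only [bisection, if_pos h]
    · refine ((hmid.pair hid.fst.snd).pair hid.snd).reindex (fun r : {r // _} => r.1)
        |>.congr_right ?_
      rintro ⟨r, h⟩
      simp only [bisection, if_neg (not_le.2 h)]

end RealMachine

namespace UnboundedOCO

/-! ### Rank-one updates of positive definite matrices -/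

section RankOne

variable {d : ℕ} {P : Matrix (Fin d) (Fin d) ℝ} {z : Fin d → ℝ}

theorem posDef_rankOne (hP : P.PosDef) (z : Fin d → ℝ) : (P + Matrix.vecMulVec z z).PosDef := by
  have := Matrix.posSemidef_vecMulVec_self_star z
  rw [star_trivial] at this
  exact hP.add_posSemidef this

theorem dotProduct_inv_nonneg (hP : P.PosDef) (z : Fin d → ℝ) : 0 ≤ z ⬝ᵥ P⁻¹.mulVec z := by
  simpa using hP.inv.posSemidef.dotProduct_mulVec_nonneg z

/-- The Sherman–Morrison formula. -/
theorem inv_rankOne (hP : P.PosDef) (z : Fin d → ℝ) : (P + Matrix.vecMulVec z z)⁻¹ =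
    P⁻¹ - (1 / (1 + z ⬝ᵥ P⁻¹.mulVec z)) • Matrix.vecMulVec (P⁻¹.mulVec z) (P⁻¹.mulVec z) := by
  have hs := dotProduct_inv_nonneg hP z
  have hu : IsUnit P.det := (Matrix.isUnit_iff_isUnit_det _).1 hP.isUnit
  have hT : P⁻¹.transpose = P⁻¹ := by
    rw [← Matrix.conjTranspose_eq_transpose_of_trivial]
    exact hP.inv.1
  refine Matrix.inv_eq_right_inv ?_
  have h1 : P.mulVec (P⁻¹.mulVec z) = z := by
    rw [Matrix.mulVec_mulVec, Matrix.mul_nonsing_inv _ hu, Matrix.one_mulVec]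
  have h2 : Matrix.vecMul z P⁻¹ = P⁻¹.mulVec z := by
    rw [← hT, Matrix.vecMul_transpose, hT]
  rw [add_mul, mul_sub, mul_sub, Matrix.mul_nonsing_inv _ hu, Matrix.mul_smul, Matrix.mul_smul,
    Matrix.mul_vecMulVec, h1, Matrix.vecMulVec_mul, h2, Matrix.vecMulVec_mul_vecMulVec]
  set s := z ⬝ᵥ P⁻¹.mulVec z
  have h3 : (1 : ℝ) / (1 + s) * (1 + s) = 1 := by
    field_simp
  ext i j
  simp only [Matrix.add_apply, Matrix.sub_apply, Matrix.smul_apply, Matrix.vecMulVec_apply,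
    smul_eq_mul, Pi.smul_apply]
  linear_combination (-(z i * P⁻¹.mulVec z j)) * h3

theorem inv_rankOne_mulVec (hP : P.PosDef) (z : Fin d → ℝ) :
    (P + Matrix.vecMulVec z z)⁻¹.mulVec z =
      (1 / (1 + z ⬝ᵥ P⁻¹.mulVec z)) • P⁻¹.mulVec z := by
  have hs := dotProduct_inv_nonneg hP z
  rw [inv_rankOne hP, Matrix.sub_mulVec, Matrix.smul_mulVec, Matrix.vecMulVec_mulVec,
    dotProduct_comm (P⁻¹.mulVec z) z]
  ext i
  simp only [Pi.sub_apply, Pi.smul_apply, smul_eq_mul, MulOpposite.smul_eq_mul_unop,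
    MulOpposite.unop_op]
  field_simp
  ring

theorem det_rankOne (hP : P.PosDef) (z : Fin d → ℝ) :
    (P + Matrix.vecMulVec z z).det = P.det * (1 + z ⬝ᵥ P⁻¹.mulVec z) := by
  have hu : IsUnit P.det := (Matrix.isUnit_iff_isUnit_det _).1 hP.isUnit
  rw [Matrix.vecMulVec_eq Unit, Matrix.det_add_replicateCol_mul_replicateRow hu]
  congr 1
  simp [Matrix.det_unique, Matrix.mul_apply, dotProduct, Matrix.mulVec, mul_sum,
    sum_mul, mul_assoc]
  rw [sum_comm]

/-- The squared length of an Online Newton Step is paid for by the decrease of the trace. -/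
theorem sq_inv_rankOne_le (hP : P.PosDef) (z : Fin d → ℝ) :
    (P + Matrix.vecMulVec z z)⁻¹.mulVec z ⬝ᵥ (P + Matrix.vecMulVec z z)⁻¹.mulVec z ≤
      P⁻¹.trace - (P + Matrix.vecMulVec z z)⁻¹.trace := by
  have hs := dotProduct_inv_nonneg hP z
  rw [inv_rankOne_mulVec hP, inv_rankOne hP, Matrix.trace_sub, Matrix.trace_smul,
    Matrix.trace_vecMulVec, smul_dotProduct, dotProduct_smul]
  simp only [smul_eq_mul]
  have hb : 0 ≤ P⁻¹.mulVec z ⬝ᵥ P⁻¹.mulVec z := by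
    rw [← norm_toLp_sq]
    positivity
  -- With `b = P⁻¹ z` and `s = zᵀ b`, the claim reads `|b| ^ 2 / (1 + s) ^ 2 ≤ |b| ^ 2 / (1 + s)`.
  have h1 : 1 / (1 + z ⬝ᵥ P⁻¹.mulVec z) ≤ 1 := by
    rw [div_le_one (by linarith)]
    linarith
  have h0 : 0 ≤ 1 / (1 + z ⬝ᵥ P⁻¹.mulVec z) := by positivity
  have h2 : 1 / (1 + z ⬝ᵥ P⁻¹.mulVec z) * (P⁻¹.mulVec z ⬝ᵥ P⁻¹.mulVec z) ≤
      P⁻¹.mulVec z ⬝ᵥ P⁻¹.mulVec z := by nlinarith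
  nlinarith

/-- With `s = zᵀ P⁻¹ z` the left side is `1 - 1 / (1 + s)`, and the determinant grows by the factor
`1 + s`; this is `1 - 1 / x ≤ log x`. -/
theorem dotProduct_inv_rankOne_le (hP : P.PosDef) (z : Fin d → ℝ) :
    z ⬝ᵥ (P + Matrix.vecMulVec z z)⁻¹.mulVec z ≤
      Real.log (P + Matrix.vecMulVec z z).det - Real.log P.det := by
  have hs := dotProduct_inv_nonneg hP z
  rw [det_rankOne hP, Real.log_mul hP.det_pos.ne' (by positivity), inv_rankOne_mulVec hP,
    dotProduct_smul, smul_eq_mul]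
  have h1 := Real.one_sub_inv_le_log_of_pos (x := 1 + z ⬝ᵥ P⁻¹.mulVec z) (by positivity)
  have h2 : 1 / (1 + z ⬝ᵥ P⁻¹.mulVec z) * z ⬝ᵥ P⁻¹.mulVec z =
      1 - (1 + z ⬝ᵥ P⁻¹.mulVec z)⁻¹ := by
    field_simp
    ring
  linarith

/-- The inequality of arithmetic and geometric means for the eigenvalues, from `log x ≤ x - 1` at
each eigenvalue divided by their mean. -/
theorem log_det_le (hd : 1 ≤ d) (hP : P.PosDef) :
    Real.log P.det ≤ d * Real.log (P.trace / d) := by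
  have hd0 : (0 : ℝ) < d := by exact_mod_cast hd
  have hne : Nonempty (Fin d) := ⟨⟨0, hd⟩⟩
  have hτ : 0 < P.trace / d := div_pos hP.trace_pos hd0
  have h1 : P.det = ∏ i, hP.1.eigenvalues i := by simpa using hP.1.det_eq_prod_eigenvalues
  have h2 : P.trace = ∑ i, hP.1.eigenvalues i := by simpa using hP.1.trace_eq_sum_eigenvalues
  have hpos := fun i => hP.eigenvalues_pos i
  rw [h1, Real.log_prod fun i _ => (hpos i).ne']
  have h3 : ∀ i, Real.log (hP.1.eigenvalues i) ≤
      Real.log (P.trace / d) + (hP.1.eigenvalues i / (P.trace / d) - 1) := by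
    intro i
    have := Real.log_le_sub_one_of_pos (div_pos (hpos i) hτ)
    rw [Real.log_div (hpos i).ne' hτ.ne'] at this
    linarith
  refine (sum_le_sum fun i _ => h3 i).trans ?_
  rw [sum_add_distrib, sum_sub_distrib, ← sum_div, ← h2]
  simp only [sum_const, card_univ, Fintype.card_fin, nsmul_eq_mul, mul_one]
  have : P.trace / (P.trace / d) = d := by
    have := hP.trace_pos
    field_simp
  rw [this]
  linarith

end RankOne

/-! ### The preconditioner of the Online Newton Step -/

/-- The preconditioner after the gradients `z 0, …, z (t - 1)`. -/
noncomputable def precond {d : ℕ} (z : ℕ → EuclideanSpace ℝ (Fin d)) (t : ℕ) :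
    Matrix (Fin d) (Fin d) ℝ :=
  (d : ℝ) • (1 : Matrix (Fin d) (Fin d) ℝ) +
    ∑ s ∈ range t, Matrix.vecMulVec (fun i => z s i) (fun i => z s i)

section Precond

variable {d : ℕ} {z : ℕ → EuclideanSpace ℝ (Fin d)}

theorem precond_zero : precond z 0 = (d : ℝ) • (1 : Matrix (Fin d) (Fin d) ℝ) := by
  simp [precond]

theorem precond_succ (t : ℕ) : precond z (t + 1) =
    precond z t + Matrix.vecMulVec (fun i => z t i) (fun i => z t i) := by
  rw [precond, precond, sum_range_succ, add_assoc]

theorem precond_posDef (hd : 1 ≤ d) (t : ℕ) : (precond z t).PosDef := by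
  induction t with
  | zero =>
    rw [precond_zero]
    exact Matrix.PosDef.one.smul (by exact_mod_cast hd)
  | succ t ih =>
    rw [precond_succ]
    exact posDef_rankOne ih _

theorem inner_eq_dotProduct (x y : EuclideanSpace ℝ (Fin d)) :
    inner ℝ x y = (fun i => x i) ⬝ᵥ fun i => y i :=
  inner_toLp (d := d) (fun i => x i) (fun i => y i)

theorem toEuclideanLin_vecMulVec (x y : EuclideanSpace ℝ (Fin d)) :
    Matrix.toEuclideanLin (Matrix.vecMulVec (fun i => x i) (fun i => x i)) y =
      (inner ℝ x y : ℝ) • x := by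
  ext i
  rw [ofLp_toEuclideanLin, Matrix.vecMulVec_mulVec, inner_eq_dotProduct]
  simp [mul_comm]

theorem toEuclideanLin_precond_zero (x : EuclideanSpace ℝ (Fin d)) :
    Matrix.toEuclideanLin (precond z 0) x = (d : ℝ) • x := by
  rw [precond_zero, map_smul, LinearMap.smul_apply]
  congr 1
  ext i
  simp

theorem toEuclideanLin_precond_succ (t : ℕ) (x : EuclideanSpace ℝ (Fin d)) :
    Matrix.toEuclideanLin (precond z (t + 1)) x =
      Matrix.toEuclideanLin (precond z t) x + (inner ℝ (z t) x : ℝ) • z t := by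
  rw [precond_succ, map_add, LinearMap.add_apply, toEuclideanLin_vecMulVec]

theorem precond_symmetric (hd : 1 ≤ d) (t : ℕ) :
    (Matrix.toEuclideanLin (precond z t)).IsSymmetric :=
  Matrix.isSymmetric_toEuclideanLin_iff.2 (precond_posDef hd t).1

theorem precond_coercive (t : ℕ) (x : EuclideanSpace ℝ (Fin d)) :
    (d : ℝ) * ‖x‖ ^ 2 ≤ inner ℝ x (Matrix.toEuclideanLin (precond z t) x) := by
  induction t with
  | zero => rw [toEuclideanLin_precond_zero, inner_smul_right, real_inner_self_eq_norm_sq]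
  | succ t ih =>
    rw [toEuclideanLin_precond_succ, inner_add_right, inner_smul_right, real_inner_comm x]
    nlinarith [mul_self_nonneg (inner ℝ (z t) x : ℝ), real_inner_comm x (z t)]

theorem norm_precond_le (hz : ∀ t, ‖z t‖ ≤ 4) (t : ℕ) (x : EuclideanSpace ℝ (Fin d)) :
    ‖Matrix.toEuclideanLin (precond z t) x‖ ≤ (16 * (t : ℝ) + d) * ‖x‖ := by
  induction t with
  | zero =>
    rw [toEuclideanLin_precond_zero, norm_smul]
    simp
  | succ t ih =>
    rw [toEuclideanLin_precond_succ]
    refine (norm_add_le _ _).trans ?_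
    rw [norm_smul, Real.norm_eq_abs]
    have h1 := abs_real_inner_le_norm (z t) x
    have h2 := hz t
    have h3 := norm_nonneg (z t)
    have h4 := norm_nonneg x
    have h5 : |inner ℝ (z t) x| * ‖z t‖ ≤ 16 * ‖x‖ := by
      calc |inner ℝ (z t) x| * ‖z t‖ ≤ (‖z t‖ * ‖x‖) * ‖z t‖ := by gcongr
        _ ≤ (4 * ‖x‖) * 4 := by gcongr
        _ = _ := by ring
    push_cast
    linarith

theorem trace_precond (t : ℕ) : (precond z t).trace = (d : ℝ) ^ 2 + ∑ s ∈ range t, ‖z s‖ ^ 2 := by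
  induction t with
  | zero =>
    rw [precond_zero, Matrix.trace_smul, Matrix.trace_one]
    simp [sq]
  | succ t ih =>
    rw [precond_succ, Matrix.trace_add, ih, sum_range_succ, Matrix.trace_vecMulVec,
      ← inner_eq_dotProduct, real_inner_self_eq_norm_sq, add_assoc]

/-- The Online Newton Step direction. -/
theorem toEuclideanLin_precond_inv (hd : 1 ≤ d) (t : ℕ) (x : EuclideanSpace ℝ (Fin d)) :
    Matrix.toEuclideanLin (precond z t) (Matrix.toEuclideanLin (precond z t)⁻¹ x) = x := by
  have hu := (Matrix.isUnit_iff_isUnit_det _).1 (precond_posDef (z := z) hd t).isUnit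
  ext i
  rw [ofLp_toEuclideanLin, ofLp_toEuclideanLin, Matrix.mulVec_mulVec,
    Matrix.mul_nonsing_inv _ hu, Matrix.one_mulVec]

theorem norm_precond_inv_le (hd : 1 ≤ d) (t : ℕ) (x : EuclideanSpace ℝ (Fin d)) :
    d * ‖Matrix.toEuclideanLin (precond z t)⁻¹ x‖ ≤ ‖x‖ := by
  have := norm_le_of_coercive (precond_coercive (z := z) t) (l := 0)
    (x := Matrix.toEuclideanLin (precond z t)⁻¹ x) (b := x) (by
      rw [toEuclideanLin_precond_inv hd, zero_smul, add_zero])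
  simpa using this

/-- The trace of the inverse preconditioner telescopes from `tr (d I)⁻¹ = 1`. This bound free of `d`
is what starting from `d I` buys; it controls the number of projections. -/
theorem sum_sq_precond_inv_le (hd : 1 ≤ d) (T : ℕ) :
    ∑ t ∈ range T, ‖Matrix.toEuclideanLin (precond z (t + 1))⁻¹ (z t)‖ ^ 2 ≤ 1 := by
  have h1 : ∀ t, ‖Matrix.toEuclideanLin (precond z (t + 1))⁻¹ (z t)‖ ^ 2 ≤
      (precond z t)⁻¹.trace - (precond z (t + 1))⁻¹.trace := by
    intro t
    have := sq_inv_rankOne_le (precond_posDef (z := z) hd t) (fun i => z t i)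
    rw [← precond_succ] at this
    rw [← real_inner_self_eq_norm_sq, inner_eq_dotProduct]
    exact this
  refine (sum_le_sum fun t _ => h1 t).trans ?_
  rw [sum_range_sub' fun t => (precond z t)⁻¹.trace]
  have hd0 : (d : ℝ) ≠ 0 := by
    have : d ≠ 0 := by omega
    exact_mod_cast this
  have h2 : (precond z 0)⁻¹ = ((d : ℝ)⁻¹) • (1 : Matrix (Fin d) (Fin d) ℝ) := by
    rw [precond_zero]
    refine Matrix.inv_eq_right_inv ?_
    rw [Matrix.smul_mul, Matrix.mul_smul, Matrix.one_mul, smul_smul, mul_inv_cancel₀ hd0, one_smul]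
  have h3 : 0 ≤ (precond z T)⁻¹.trace := (precond_posDef hd T).inv.posSemidef.trace_nonneg
  rw [h2, Matrix.trace_smul, Matrix.trace_one, Fintype.card_fin, smul_eq_mul,
    inv_mul_cancel₀ hd0]
  linarith

/-- The elliptical potential argument: the terms telescope against the log determinant, which the
trace bounds from above. -/
theorem sum_inner_precond_inv_le (hd : 1 ≤ d) (T : ℕ) :
    ∑ t ∈ range T, inner ℝ (z t) (Matrix.toEuclideanLin (precond z (t + 1))⁻¹ (z t)) ≤
      d * Real.log (1 + ∑ t ∈ range T, ‖z t‖ ^ 2) := by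
  have h1 : ∀ t, inner ℝ (z t) (Matrix.toEuclideanLin (precond z (t + 1))⁻¹ (z t)) ≤
      Real.log (precond z (t + 1)).det - Real.log (precond z t).det := by
    intro t
    have := dotProduct_inv_rankOne_le (precond_posDef (z := z) hd t) (fun i => z t i)
    rw [← precond_succ] at this
    rw [inner_eq_dotProduct]
    exact this
  refine (sum_le_sum fun t _ => h1 t).trans ?_
  rw [sum_range_sub fun t => Real.log (precond z t).det]
  have hd1 : (1 : ℝ) ≤ d := by exact_mod_cast hd
  have h2 : Real.log (precond z 0).det = d * Real.log d := by
    rw [precond_zero, Matrix.det_smul, Matrix.det_one, mul_one, Fintype.card_fin, Real.log_pow]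
  have h3 := log_det_le hd (precond_posDef (z := z) hd T)
  have hsum : 0 ≤ ∑ t ∈ range T, ‖z t‖ ^ 2 := sum_nonneg fun _ _ => by positivity
  -- The trace divided by `d` is `d + (∑ ‖z t‖ ^ 2) / d`, at most `d * (1 + ∑ ‖z t‖ ^ 2)`.
  have h4 : Real.log ((precond z T).trace / d) ≤
      Real.log d + Real.log (1 + ∑ t ∈ range T, ‖z t‖ ^ 2) := by
    rw [← Real.log_mul (by positivity) (by positivity)]
    refine Real.log_le_log (div_pos ?_ (by positivity)) ?_
    · rw [trace_precond]
      positivity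
    · rw [trace_precond, div_le_iff₀ (by positivity)]
      nlinarith [mul_le_mul hd1 hd1 zero_le_one (by linarith)]
  rw [h2]
  nlinarith

end Precond

/-! ### The curvature of the logarithm -/

theorem log_seven_le : Real.log 7 ≤ 2 := by
  rw [Real.log_le_iff_le_exp (by norm_num)]
  have h := Real.exp_one_gt_d9
  have : Real.exp 2 = Real.exp 1 * Real.exp 1 := by rw [← Real.exp_add]; norm_num
  rw [this]
  nlinarith

theorem curvature_pos : 0 < curvature := by
  have := log_seven_le
  unfold curvature
  linarith

theorem curvature_lt_one : curvature < 1 := by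
  have : 0 < Real.log 7 := Real.log_pos (by norm_num)
  unfold curvature
  linarith

/-- The gap `φ` has derivative `s * (1 - γ * (1 + s)) / (1 + s)`: it falls up to `0`, rises up to `1
/ γ - 1`, and falls again up to `6`. So it suffices that it vanishes at both `0` and `6`. -/
theorem log_one_add_le {s : ℝ} (h1 : -1 < s) (h6 : s ≤ 6) :
    Real.log (1 + s) ≤ s - curvature / 2 * s ^ 2 := by
  set γ := curvature with hγ
  have hγ0 : 0 < γ := curvature_pos
  have hγ1 : γ < 1 := curvature_lt_one
  let φ : ℝ → ℝ := fun s => s - γ / 2 * s ^ 2 - Real.log (1 + s)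
  have hder : ∀ x, -1 < x → HasDerivAt φ (1 - γ * x - 1 / (1 + x)) x := by
    intro x hx
    have h1 : HasDerivAt (fun s : ℝ => 1 + s) 1 x := (hasDerivAt_id x).const_add 1
    have h2 := h1.log (by linarith : 1 + x ≠ 0)
    have h3 := ((hasDerivAt_id x).sub (((hasDerivAt_id x).pow 2).const_mul (γ / 2))).sub h2
    exact h3.congr_deriv (by simp only [id]; ring)
  have hcont : ∀ D : Set ℝ, (∀ x ∈ D, -1 < x) → ContinuousOn φ D := fun D hD x hx =>
    (hder x (hD x hx)).continuousAt.continuousWithinAt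
  have hd : ∀ x, -1 < x → deriv φ x = x * (1 - γ * (1 + x)) / (1 + x) := by
    intro x hx
    rw [(hder x hx).deriv]
    have : 1 + x ≠ 0 := by linarith
    field_simp
    ring
  have hφ0 : φ 0 = 0 := by simp [φ]
  have hm : 0 < 1 / γ - 1 := by
    rw [sub_pos, lt_div_iff₀ hγ0]
    linarith
  suffices 0 ≤ φ s by
    simp only [φ] at this
    linarith
  rcases le_or_gt s 0 with hs | hs
  · have hanti : AntitoneOn φ (Set.Ioc (-1) 0) := by
      refine antitoneOn_of_deriv_nonpos (convex_Ioc _ _) (hcont _ fun x hx => hx.1) ?_ ?_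
      · intro x hx
        rw [interior_Ioc] at hx
        exact (hder x hx.1).differentiableAt.differentiableWithinAt
      · intro x hx
        rw [interior_Ioc] at hx
        rw [hd x hx.1]
        exact div_nonpos_of_nonpos_of_nonneg
          (mul_nonpos_of_nonpos_of_nonneg hx.2.le (by nlinarith [hx.1, hx.2])) (by linarith [hx.1])
    rw [← hφ0]
    exact hanti ⟨h1, hs⟩ ⟨by norm_num, le_rfl⟩ hs
  rcases le_or_gt s (1 / γ - 1) with hs' | hs'
  · have hmono : MonotoneOn φ (Set.Icc 0 (1 / γ - 1)) := by
      refine monotoneOn_of_deriv_nonneg (convex_Icc _ _) (hcont _ fun x hx => by linarith [hx.1])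
        ?_ ?_
      · intro x hx
        rw [interior_Icc] at hx
        exact (hder x (by linarith [hx.1])).differentiableAt.differentiableWithinAt
      · intro x hx
        rw [interior_Icc] at hx
        rw [hd x (by linarith [hx.1])]
        have : γ * (1 + x) ≤ 1 := by
          have := hx.2.le
          rw [le_sub_iff_add_le, le_div_iff₀ hγ0] at this
          linarith
        exact div_nonneg (mul_nonneg hx.1.le (by linarith)) (by linarith [hx.1])
    rw [← hφ0]
    exact hmono ⟨le_rfl, hm.le⟩ ⟨hs.le, hs'⟩ hs.le
  · have hanti : AntitoneOn φ (Set.Icc (1 / γ - 1) 6) := by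
      refine antitoneOn_of_deriv_nonpos (convex_Icc _ _) (hcont _ fun x hx => by linarith [hx.1])
        ?_ ?_
      · intro x hx
        rw [interior_Icc] at hx
        exact (hder x (by linarith [hx.1])).differentiableAt.differentiableWithinAt
      · intro x hx
        rw [interior_Icc] at hx
        rw [hd x (by linarith [hx.1])]
        have : 1 ≤ γ * (1 + x) := by
          have := hx.1.le
          rw [sub_le_iff_le_add, div_le_iff₀ hγ0] at this
          linarith
        have hx0 : 0 ≤ x := by linarith [hx.1]
        exact div_nonpos_of_nonpos_of_nonneg
          (mul_nonpos_of_nonneg_of_nonpos hx0 (by linarith)) (by linarith)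
    -- This equation is what determines `γ`.
    have hφ6 : φ 6 = 0 := by
      simp only [φ, hγ, curvature]
      norm_num
      ring
    rw [← hφ6]
    exact hanti ⟨hs'.le, h6⟩ ⟨by linarith, le_rfl⟩ h6

theorem neg_sub_sq_le_log_one_sub {x : ℝ} (hx : x ≤ 1 / 2) :
    -x - 2 * x ^ 2 ≤ Real.log (1 - x) := by
  have h1 := Real.one_sub_inv_le_log_of_pos (x := 1 - x) (by linarith)
  have h2 : (1 - x)⁻¹ ≤ 1 + x + 2 * x ^ 2 := by
    rw [inv_le_iff_one_le_mul₀ (by linarith)]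
    nlinarith [mul_nonneg (sq_nonneg x) (by linarith : 0 ≤ 1 - 2 * x)]
  linarith

/-! ### The regret of LightONS.Core on logarithmic losses -/

/-- The accuracy of the projections. -/
noncomputable def accuracy (d t : ℕ) : ℝ :=
  curvature / (3 * (16 * ((t : ℝ) + 1) + d) * ((t : ℝ) + 1) ^ 2)

theorem accuracy_pos (d t : ℕ) : 0 < accuracy d t := by
  have := curvature_pos
  unfold accuracy
  positivity

/-- LightONS.Core on the logarithmic losses of a coin bettor. -/
abbrev IsBettingCore {d : ℕ} (g v : ℕ → EuclideanSpace ℝ (Fin d))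
    (A : ℕ → Matrix (Fin d) (Fin d) ℝ) : Prop :=
  IsLightONSCore curvature d (3 / 2) 1 (accuracy d)
    (fun t => (1 - inner ℝ (g t) (v t))⁻¹ • g t) v A

section Core

variable {d : ℕ} {g v : ℕ → EuclideanSpace ℝ (Fin d)} {A : ℕ → Matrix (Fin d) (Fin d) ℝ}

theorem IsBettingCore.norm_le (h : IsBettingCore g v A) (t : ℕ) : ‖v t‖ ≤ 3 / 4 := by
  induction t with
  | zero =>
    rw [h.start, norm_zero]
    norm_num
  | succ t _ =>
    rcases le_or_gt ‖v t - (1 / curvature) • Matrix.toEuclideanLin (A t)⁻¹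
      ((1 - inner ℝ (g t) (v t))⁻¹ • g t)‖ (3 / 2 * 1 / 2) with h1 | h1
    · rw [h.keep t h1]
      linarith
    · linarith [(h.project t h1).1]

theorem abs_inner_le_of_norm_le {x y : EuclideanSpace ℝ (Fin d)} {r : ℝ} (hx : ‖x‖ ≤ 1)
    (hy : ‖y‖ ≤ r) : |inner ℝ x y| ≤ r :=
  (abs_real_inner_le_norm x y).trans (by nlinarith [norm_nonneg x, norm_nonneg y])

theorem norm_logGradient_le {x y : EuclideanSpace ℝ (Fin d)} (hx : ‖x‖ ≤ 1) (hy : ‖y‖ ≤ 3 / 4) :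
    ‖(1 - inner ℝ x y)⁻¹ • x‖ ≤ 4 * ‖x‖ := by
  have h1 := abs_le.1 (abs_inner_le_of_norm_le hx hy)
  rw [norm_smul, norm_inv, Real.norm_of_nonneg (by linarith)]
  refine mul_le_mul_of_nonneg_right ?_ (norm_nonneg x)
  rw [inv_le_comm₀ (by linarith) (by norm_num)]
  linarith

/-- One round of the analysis of the Online Newton Step. -/
theorem IsBettingCore.regret_step (hd : 1 ≤ d) (h : IsBettingCore g v A) (hg : ∀ t, ‖g t‖ ≤ 1)
    {u : EuclideanSpace ℝ (Fin d)} (hu : ‖u‖ ≤ 1 / 2)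
    {z : ℕ → EuclideanSpace ℝ (Fin d)} (hz : z = fun t => (1 - inner ℝ (g t) (v t))⁻¹ • g t)
    (t : ℕ) :
    Real.log (1 - inner ℝ (g t) u) - Real.log (1 - inner ℝ (g t) (v t)) ≤
      curvature / 2 * (inner ℝ (v t - u) (Matrix.toEuclideanLin (precond z t) (v t - u)) -
        inner ℝ (v (t + 1) - u) (Matrix.toEuclideanLin (precond z (t + 1)) (v (t + 1) - u))) +
      1 / (2 * curvature) *
        inner ℝ (z t) (Matrix.toEuclideanLin (precond z (t + 1))⁻¹ (z t)) +
      curvature ^ 2 / 3 * (1 / ((t : ℝ) + 1) ^ 2) := by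
  have hγ : 0 < curvature := curvature_pos
  set γ := curvature
  have hA : A t = precond z (t + 1) := by rw [h.matrix, hz, precond]
  have hv := abs_le.1 (abs_inner_le_of_norm_le (hg t) (h.norm_le t))
  have hgu := abs_le.1 (abs_inner_le_of_norm_le (hg t) hu)
  set r := 1 - inner ℝ (g t) (v t) with hr
  have hr0 : 0 < r := by linarith
  have hzt : z t = r⁻¹ • g t := by rw [hz]
  have hz4 : ∀ s, ‖z s‖ ≤ 4 := fun s => by
    rw [hz]
    exact (norm_logGradient_le (hg s) (h.norm_le s)).trans (by linarith [hg s])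
  set σ := inner ℝ (z t) (v t - u) with hσ
  -- The difference of the two logarithmic losses is exactly `log (1 + σ)`, with `σ` the linearized
  -- regret of the round, so the curvature inequality applies.
  have h1σ : 1 + σ = (1 - inner ℝ (g t) u) / r := by
    rw [hσ, hzt, inner_smul_left, inner_sub_right, eq_div_iff hr0.ne']
    simp only [RCLike.conj_to_real]
    field_simp
    rw [hr]
    ring
  have hlog : Real.log (1 - inner ℝ (g t) u) - Real.log r ≤ σ - γ / 2 * σ ^ 2 := by
    rw [← Real.log_div (by linarith) hr0.ne', ← h1σ]
    refine log_one_add_le ?_ ?_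
    · have : 0 < (1 - inner ℝ (g t) u) / r := div_pos (by linarith) hr0
      linarith
    -- The numerator is at most `3 / 2` and `r` at least `1 / 4`.
    · have : (1 - inner ℝ (g t) u) / r ≤ 6 := by
        rw [div_le_iff₀ hr0]
        linarith
      linarith
  set P' := Matrix.toEuclideanLin (precond z (t + 1)) with hP'
  set b := Matrix.toEuclideanLin (precond z (t + 1))⁻¹ (z t) with hb
  have hPb : P' b = z t := toEuclideanLin_precond_inv hd (t + 1) (z t)
  have hq' : inner ℝ (v t - u) (P' (v t - u)) =
      inner ℝ (v t - u) (Matrix.toEuclideanLin (precond z t) (v t - u)) + σ ^ 2 := by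
    rw [hP', toEuclideanLin_precond_succ, inner_add_right, inner_smul_right,
      real_inner_comm (z t) (v t - u)]
    ring
  set y := v t - (1 / γ) • b with hy
  have hyq : inner ℝ (y - u) (P' (y - u)) = inner ℝ (v t - u) (P' (v t - u)) - 2 / γ * σ +
      1 / γ ^ 2 * inner ℝ (z t) b := by
    have e : y - u = (v t - u) - (1 / γ) • b := by rw [hy]; abel
    have hsym := precond_symmetric (z := z) hd (t + 1)
    have e2 : inner ℝ b (P' (v t - u)) = σ := by rw [← hsym, ← hP', hPb]
    rw [e, map_sub, map_smul, hPb, inner_sub_left, inner_sub_right, inner_sub_right,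
      inner_smul_left, inner_smul_left, inner_smul_right, inner_smul_right, e2,
      real_inner_comm (z t) (v t - u), real_inner_comm (z t) b]
    simp only [RCLike.conj_to_real]
    ring
  -- An inexact projection costs at most the norm bound `16 * (t + 1) + d` times the accuracy times
  -- `4 * (1 / 2)`; the accuracy is chosen to make this summable.
  have hstep : inner ℝ (v (t + 1) - u) (P' (v (t + 1) - u)) ≤
      inner ℝ (y - u) (P' (y - u)) + 2 * γ / 3 * (1 / ((t : ℝ) + 1) ^ 2) := by
    have hyA : y = v t - (1 / γ) • Matrix.toEuclideanLin (A t)⁻¹ (r⁻¹ • g t) := by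
      rw [hy, hb, hA, hzt]
    rcases le_or_gt ‖y‖ (3 / 2 * 1 / 2) with h1 | h1
    · rw [hyA] at h1
      rw [h.keep t h1, ← hyA]
      have : 0 ≤ 2 * γ / 3 * (1 / ((t : ℝ) + 1) ^ 2) := by positivity
      linarith
    · rw [hyA] at h1
      obtain ⟨hn, p, hp, hle⟩ := h.project t h1
      rw [← hyA] at hp
      have hb' := fun x => norm_precond_le hz4 (t + 1) x
      have hcoer := fun x => precond_coercive (z := z) (t + 1) x
      have h2 := quadratic_near_projection_le (precond_symmetric (z := z) hd (t + 1))
        (fun x => le_trans (by positivity) (hcoer x)) hb' (hp.1) (fun w hw => by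
          have := hp.2 w hw
          rw [hA] at this
          exact this) (hu.trans (by norm_num)) hn hle (by positivity)
      refine h2.trans (add_le_add_right (le_of_eq ?_) _)
      rw [accuracy]
      push_cast
      have h3 : (16 * ((t : ℝ) + 1) + d) ≠ 0 := by positivity
      field_simp
      ring
  -- The `σ ^ 2` added by the rank-one update cancels against the curvature gain `γ / 2 * σ ^ 2`.
  rw [hq'] at hyq
  have h5 : γ / 2 * (2 / γ * σ) = σ := by field_simp
  have h6 : γ / 2 * (1 / γ ^ 2 * inner ℝ (z t) b) = 1 / (2 * γ) * inner ℝ (z t) b := by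
    field_simp
  have h7 : γ / 2 * (2 * γ / 3 * (1 / ((t : ℝ) + 1) ^ 2)) =
      γ ^ 2 / 3 * (1 / ((t : ℝ) + 1) ^ 2) := by ring
  have h8 := mul_le_mul_of_nonneg_left hstep (by positivity : 0 ≤ γ / 2)
  rw [hyq] at h8
  nlinarith

theorem sum_inv_sq_le (T : ℕ) : ∑ t ∈ range T, 1 / ((t : ℝ) + 1) ^ 2 ≤ 2 - 1 / (T : ℝ) := by
  induction T with
  | zero => norm_num
  | succ T ih =>
    rw [sum_range_succ]
    -- The case `T = 0` is separate because there `1 / (T : ℝ)` is `0` by convention.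
    rcases T.eq_zero_or_pos with rfl | hT
    · norm_num
    · have hT0 : (0 : ℝ) < T := by exact_mod_cast hT
      have h1 : 1 / (T : ℝ) - 1 / ((T : ℝ) + 1) = 1 / ((T : ℝ) * (T + 1)) := by
        field_simp
        ring
      have h2 : 1 / ((T : ℝ) + 1) ^ 2 ≤ 1 / ((T : ℝ) * (T + 1)) :=
        one_div_le_one_div_of_le (by positivity) (by nlinarith)
      push_cast
      linarith

/-- The `16` is the square of the factor `4` in `norm_logGradient_le`; the exponent `5` works
because `(2 + G) ^ 5` begins with `32 + 80 * G`. -/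
theorem log_one_add_mul_le {G : ℝ} (hG : 0 ≤ G) :
    Real.log (1 + 16 * G) ≤ 5 * Real.log (2 + G) := by
  have h : 1 + 16 * G ≤ (2 + G) ^ 5 := by
    have e : (2 + G) ^ 5 = 32 + 80 * G + 80 * G ^ 2 + 40 * G ^ 3 + 10 * G ^ 4 + G ^ 5 := by ring
    rw [e]
    have : 0 ≤ 80 * G ^ 2 + 40 * G ^ 3 + 10 * G ^ 4 + G ^ 5 := by positivity
    linarith
  calc Real.log (1 + 16 * G) ≤ Real.log ((2 + G) ^ 5) := Real.log_le_log (by positivity) h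
    _ = 5 * Real.log (2 + G) := by rw [Real.log_pow]; norm_num

theorem half_le_log_two_add {G : ℝ} (hG : 0 ≤ G) : 1 / 2 ≤ Real.log (2 + G) := by
  have h1 := Real.log_two_gt_d9
  have h2 : Real.log 2 ≤ Real.log (2 + G) := Real.log_le_log (by norm_num) (by linarith)
  linarith

/-- Summing `regret_step`, the quadratic terms telescope to at most `d / 8`, the projection errors
sum to at most `2 / 3`, and the Newton terms give the elliptical potential. The logarithm is at
least `1 / 2`, so it absorbs the constants. -/
theorem IsBettingCore.log_regret_le (hd : 1 ≤ d) (h : IsBettingCore g v A) (hg : ∀ t, ‖g t‖ ≤ 1)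
    {u : EuclideanSpace ℝ (Fin d)} (hu : ‖u‖ ≤ 1 / 2) (T : ℕ) :
    ∑ t ∈ range T, (Real.log (1 - inner ℝ (g t) u) - Real.log (1 - inner ℝ (g t) (v t))) ≤
      (5 / (2 * curvature) + 2) * d * Real.log (2 + ∑ t ∈ range T, ‖g t‖ ^ 2) := by
  have hγ : 0 < curvature := curvature_pos
  have hγ1 : curvature < 1 := curvature_lt_one
  set z : ℕ → EuclideanSpace ℝ (Fin d) := fun t => (1 - inner ℝ (g t) (v t))⁻¹ • g t with hz
  set γ := curvature
  set G := ∑ t ∈ range T, ‖g t‖ ^ 2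
  have hG : 0 ≤ G := sum_nonneg fun _ _ => by positivity
  have hd1 : (1 : ℝ) ≤ d := by exact_mod_cast hd
  refine (sum_le_sum fun t _ => h.regret_step hd hg hu hz t).trans ?_
  rw [sum_add_distrib, sum_add_distrib, ← mul_sum, ← mul_sum, ← mul_sum, sum_range_sub' fun t =>
    inner ℝ (v t - u) (Matrix.toEuclideanLin (precond z t) (v t - u))]
  have h1 : inner ℝ (v 0 - u) (Matrix.toEuclideanLin (precond z 0) (v 0 - u)) ≤ d / 4 := by
    rw [toEuclideanLin_precond_zero, inner_smul_right, real_inner_self_eq_norm_sq, h.start, zero_sub,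
      norm_neg]
    have : ‖u‖ ^ 2 ≤ 1 / 4 := by nlinarith [norm_nonneg u]
    nlinarith
  have h2 : 0 ≤ inner ℝ (v T - u) (Matrix.toEuclideanLin (precond z T) (v T - u)) :=
    le_trans (by positivity) (precond_coercive T _)
  have h3 := sum_inner_precond_inv_le (z := z) hd T
  have h4 : ∑ t ∈ range T, ‖z t‖ ^ 2 ≤ 16 * G := by
    rw [mul_sum]
    refine sum_le_sum fun t _ => ?_
    have := norm_logGradient_le (hg t) (h.norm_le t)
    change ‖z t‖ ≤ _ at this
    nlinarith [norm_nonneg (z t)]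
  have h5 : Real.log (1 + ∑ t ∈ range T, ‖z t‖ ^ 2) ≤ 5 * Real.log (2 + G) :=
    (Real.log_le_log (add_pos_of_pos_of_nonneg one_pos (sum_nonneg fun _ _ => by positivity))
      (by linarith)).trans (log_one_add_mul_le hG)
  have h6 : ∑ t ∈ range T, 1 / ((t : ℝ) + 1) ^ 2 ≤ 2 := by
    have := sum_inv_sq_le T
    have : 0 ≤ 1 / (T : ℝ) := by positivity
    linarith
  have h7 := half_le_log_two_add hG
  set Λ := Real.log (2 + G)
  set B := ∑ t ∈ range T, inner ℝ (z t) (Matrix.toEuclideanLin (precond z (t + 1))⁻¹ (z t))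
  have h8 : B ≤ d * (5 * Λ) := h3.trans (by gcongr)
  have h9 : 1 / (2 * γ) * B ≤ 1 / (2 * γ) * (d * (5 * Λ)) := by gcongr
  have h10 : γ ^ 2 / 3 * ∑ t ∈ range T, 1 / ((t : ℝ) + 1) ^ 2 ≤ 1 / 3 * 2 := by
    have : γ ^ 2 ≤ 1 := by nlinarith
    have h0 : 0 ≤ ∑ t ∈ range T, 1 / ((t : ℝ) + 1) ^ 2 := sum_nonneg fun _ _ => by positivity
    nlinarith
  have h11 : (1 : ℝ) / 2 ≤ d * Λ := by nlinarith
  have h12 : γ / 2 * (inner ℝ (v 0 - u) (Matrix.toEuclideanLin (precond z 0) (v 0 - u)) -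
      inner ℝ (v T - u) (Matrix.toEuclideanLin (precond z T) (v T - u))) ≤ d / 8 := by
    nlinarith
  have h13 : (d : ℝ) ≤ 2 * (d * Λ) := by nlinarith
  have h14 : 1 / (2 * γ) * (d * (5 * Λ)) = 5 / (2 * γ) * d * Λ := by ring
  nlinarith

end Core

/-! ### The regret of coin betting -/

/-- The optimal constant in the duality between wealth and regret. -/
theorem mul_log_sub_le {W m ε : ℝ} (hW : 0 < W) (hm : 0 < m) (hε : 0 < ε) :
    m * Real.log (W / ε) - W ≤ m * Real.log (m / ε) := by
  have h1 := Real.log_le_sub_one_of_pos (div_pos hW hm)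
  have h2 : Real.log (W / ε) = Real.log (W / m) + Real.log (m / ε) := by
    rw [← Real.log_mul (by positivity) (by positivity)]
    congr 1
    field_simp
  have h3 : m * (W / m) = W := by field_simp
  rw [h2]
  nlinarith

section CoinBetting

variable {d : ℕ} {ε₀ : ℝ} {g v x : ℕ → EuclideanSpace ℝ (Fin d)} {W : ℕ → ℝ}
  {A : ℕ → Matrix (Fin d) (Fin d) ℝ}

theorem IsCoinBetting.wealth_succ (h : IsCoinBetting ε₀ g v x W) (t : ℕ) :
    W (t + 1) = W t * (1 - inner ℝ (g t) (v t)) := by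
  rw [h.wealth, h.bet, inner_smul_right]
  ring

theorem IsCoinBetting.wealth_eq (h : IsCoinBetting ε₀ g v x W) (T : ℕ) :
    W T = ε₀ - ∑ t ∈ range T, inner ℝ (g t) (x t) := by
  induction T with
  | zero => simp [h.start]
  | succ T ih =>
    rw [h.wealth, ih, sum_range_succ]
    ring

theorem IsCoinBetting.log_wealth (h : IsCoinBetting ε₀ g v x W) (hε : 0 < ε₀)
    (hv : ∀ t, 0 < 1 - inner ℝ (g t) (v t)) (T : ℕ) :
    0 < W T ∧ Real.log (W T) = Real.log ε₀ + ∑ t ∈ range T, Real.log (1 - inner ℝ (g t) (v t)) := by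
  induction T with
  | zero => simp [h.start, hε]
  | succ T ih =>
    rw [h.wealth_succ, sum_range_succ, Real.log_mul ih.1.ne' (hv T).ne', ih.2]
    exact ⟨mul_pos ih.1 (hv T), by ring⟩

/-- The constant of the regret bound for the logarithmic losses. -/
noncomputable def logRegretConst : ℝ := 5 / (2 * curvature) + 2

theorem logRegretConst_pos : 0 < logRegretConst := by
  have := curvature_pos
  unfold logRegretConst
  positivity

/-- The wealth competes with every constant betting fraction. -/
theorem log_wealth_ge (hd : 1 ≤ d) (hε : 0 < ε₀) (hcb : IsCoinBetting ε₀ g v x W)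
    (hcore : IsBettingCore g v A) (hg : ∀ t, ‖g t‖ ≤ 1) {w : EuclideanSpace ℝ (Fin d)}
    (hw : ‖w‖ ≤ 1 / 2) (T : ℕ) :
    0 < W T ∧ -∑ t ∈ range T, inner ℝ (g t) w - 2 * ∑ t ∈ range T, (inner ℝ (g t) w) ^ 2 -
      logRegretConst * d * Real.log (2 + ∑ t ∈ range T, ‖g t‖ ^ 2) ≤ Real.log (W T / ε₀) := by
  obtain ⟨hW, hlog⟩ := hcb.log_wealth hε (fun t => by
    have := abs_le.1 (abs_inner_le_of_norm_le (hg t) (hcore.norm_le t))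
    linarith) T
  refine ⟨hW, ?_⟩
  rw [Real.log_div hW.ne' hε.ne', hlog]
  have h1 := hcore.log_regret_le hd hg hw T
  rw [sum_sub_distrib] at h1
  have h2 : -∑ t ∈ range T, inner ℝ (g t) w - 2 * ∑ t ∈ range T, (inner ℝ (g t) w) ^ 2 ≤
      ∑ t ∈ range T, Real.log (1 - inner ℝ (g t) w) := by
    rw [mul_sum, ← sum_neg_distrib, ← sum_sub_distrib]
    refine sum_le_sum fun t _ => neg_sub_sq_le_log_one_sub ?_
    exact (abs_le.1 (abs_inner_le_of_norm_le (hg t) hw)).2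
  change _ ≤ logRegretConst * d * _ at h1
  linarith

/-- The regret bound before the choice of the betting fraction. -/
theorem linear_regret_le (hd : 1 ≤ d) (hε : 0 < ε₀) (hcb : IsCoinBetting ε₀ g v x W)
    (hcore : IsBettingCore g v A) (hg : ∀ t, ‖g t‖ ≤ 1) {u : EuclideanSpace ℝ (Fin d)}
    {β : ℝ} (hβ : 0 < β) (hβ2 : β ≤ 1 / 2) (hu : u ≠ 0) (T : ℕ) :
    ∑ t ∈ range T, inner ℝ (g t) (x t - u) ≤ ε₀ + ‖u‖ / β * (Real.log (‖u‖ / β / ε₀) +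
      logRegretConst * d * Real.log (2 + ∑ t ∈ range T, ‖g t‖ ^ 2)) +
      2 * (β / ‖u‖) * ∑ t ∈ range T, (inner ℝ (g t) u) ^ 2 := by
  have ha : 0 < ‖u‖ := norm_pos_iff.2 hu
  -- The wealth is compared with that of the fraction `u / m`, which has norm `β`.
  set m := ‖u‖ / β with hm
  have hm0 : 0 < m := div_pos ha hβ
  have hβm : β / ‖u‖ = 1 / m := by rw [hm]; field_simp
  have hw : ‖(1 / m) • u‖ ≤ 1 / 2 := by
    rw [norm_smul, Real.norm_of_nonneg (by positivity), ← hβm]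
    field_simp
    linarith
  obtain ⟨hW, h1⟩ := log_wealth_ge hd hε hcb hcore hg hw T
  have h2 := mul_log_sub_le hW hm0 hε
  have h3 : ∑ t ∈ range T, inner ℝ (g t) (x t - u) =
      ε₀ - W T - ∑ t ∈ range T, inner ℝ (g t) u := by
    rw [hcb.wealth_eq T]
    simp only [inner_sub_right, sum_sub_distrib]
    ring
  simp only [inner_smul_right, mul_pow, ← mul_sum] at h1
  rw [h3, hβm]
  set X := ∑ t ∈ range T, inner ℝ (g t) u
  set S := ∑ t ∈ range T, (inner ℝ (g t) u) ^ 2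
  set R := logRegretConst * d * Real.log (2 + ∑ t ∈ range T, ‖g t‖ ^ 2)
  -- Multiplying the log wealth bound by `m` produces the linear term `-X` that cancels against the
  -- regret.
  have h4 := mul_le_mul_of_nonneg_left h1 hm0.le
  have h5 : m * (-(1 / m * X) - 2 * ((1 / m) ^ 2 * S) - R) = -X - 2 * (1 / m) * S - m * R := by
    field_simp
  rw [h5] at h4
  linarith

theorem sum_inner_sq_le (u : EuclideanSpace ℝ (Fin d)) (T : ℕ) :
    ∑ t ∈ range T, (inner ℝ (g t) u) ^ 2 ≤ ‖u‖ ^ 2 * ∑ t ∈ range T, ‖g t‖ ^ 2 := by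
  rw [mul_sum]
  refine sum_le_sum fun t _ => ?_
  rw [← mul_pow, mul_comm ‖u‖]
  exact sq_le_sq' (by linarith [(abs_le.1 (abs_real_inner_le_norm (g t) u)).1])
    (real_inner_le_norm _ _)

/-- The best fraction size is about `‖u‖ * √(d L / S)`, but it may not exceed `1 / 2`. At the cap
one gets the term `d ‖u‖ L`, otherwise `√(d S L)`. -/
theorem regret_bound (hd : 1 ≤ d) (hε : 0 < ε₀) (hcb : IsCoinBetting ε₀ g v x W)
    (hcore : IsBettingCore g v A) (hg : ∀ t, ‖g t‖ ≤ 1) (u : EuclideanSpace ℝ (Fin d)) (T : ℕ)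
    {G S L : ℝ} (hG : G = ∑ t ∈ range T, ‖g t‖ ^ 2) (hS : S = ∑ t ∈ range T, (inner ℝ (g t) u) ^ 2)
    (hL : L = Real.log (2 + G + ‖u‖ / ε₀)) :
    ∑ t ∈ range T, inner ℝ (g t) (x t - u) ≤
      ε₀ + (2 * logRegretConst + 6) * (d * ‖u‖ * L + Real.sqrt (d * S * L)) := by
  have hK := logRegretConst_pos
  have hG0 : 0 ≤ G := by rw [hG]; exact sum_nonneg fun _ _ => by positivity
  have hS0 : 0 ≤ S := by rw [hS]; exact sum_nonneg fun _ _ => by positivity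
  have hd1 : (1 : ℝ) ≤ d := by exact_mod_cast hd
  have hΛL : Real.log (2 + G) ≤ L := by
    rw [hL]
    exact Real.log_le_log (by linarith) (by linarith [div_nonneg (norm_nonneg u) hε.le])
  have hL2 : 1 / 2 ≤ L := (half_le_log_two_add hG0).trans hΛL
  -- For `u = 0` the claim follows from the positivity of the wealth.
  rcases eq_or_ne u 0 with rfl | hu
  · have h1 := (log_wealth_ge hd hε hcb hcore hg (w := 0) (by simp) T).1
    rw [hcb.wealth_eq T] at h1
    simp only [sub_zero, norm_zero, mul_zero, zero_mul, zero_add]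
    have : 0 ≤ (2 * logRegretConst + 6) * Real.sqrt (d * S * L) := by positivity
    linarith
  have ha : 0 < ‖u‖ := norm_pos_iff.2 hu
  have haL : Real.log (‖u‖ / ε₀) ≤ L := by
    rw [hL]
    exact Real.log_le_log (by positivity) (by linarith)
  have hlog2 : Real.log 2 ≤ L := by
    refine le_trans (Real.log_le_log (by norm_num) ?_) hΛL
    linarith
  have hSG : S ≤ ‖u‖ ^ 2 * G := by rw [hS, hG]; exact sum_inner_sq_le u T
  set a := ‖u‖
  set k := logRegretConst
  have hdL : 1 / 2 ≤ d * L := by nlinarith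
  have hkd : k * d * Real.log (2 + G) ≤ k * (d * L) := by
    rw [mul_assoc]
    gcongr
  have hLd : L ≤ d * L := by nlinarith
  have hsq : Real.sqrt (d * S * L) ^ 2 = d * S * L := Real.sq_sqrt (by positivity)
  have hsq0 := Real.sqrt_nonneg (d * S * L)
  set s := Real.sqrt (d * S * L)
  -- The threshold is where `‖u‖ * √(d L / S)` equals `1 / 2`.
  rcases le_or_gt S (4 * (d * L) * a ^ 2) with hcase | hcase
  · have h := linear_regret_le hd hε hcb hcore hg (β := 1 / 2) (by norm_num) le_rfl hu T
    rw [← hS, ← hG] at h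
    have h1 : Real.log (a / (1 / 2) / ε₀) ≤ 2 * (d * L) := by
      have : a / (1 / 2) / ε₀ = 2 * (a / ε₀) := by ring
      rw [this, Real.log_mul (by norm_num) (by positivity)]
      linarith
    have h2 : S / a ≤ 2 * s := by
      rw [div_le_iff₀ ha]
      refine (sq_le_sq₀ (by positivity) (by positivity)).1 ?_
      rw [mul_pow, mul_pow, hsq]
      nlinarith
    have h3 : a / (1 / 2) * (Real.log (a / (1 / 2) / ε₀) + k * d * Real.log (2 + G)) ≤
        2 * a * (2 * (d * L) + k * (d * L)) := by
      have e : a / (1 / 2) = 2 * a := by ring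
      rw [e] at h1 ⊢
      gcongr
    have h4 : 2 * (1 / 2 / a) * S = S / a := by ring
    rw [h4] at h
    nlinarith [mul_nonneg hK.le hsq0, mul_nonneg ha.le (by linarith : 0 ≤ d * L)]
  · have hSpos : 0 < S := lt_of_le_of_lt (by positivity) hcase
    -- This `q` balances `d * L / q` against `q * S`; both are then `√(d S L)`.
    set q := Real.sqrt (d * L / S) with hq
    have hqsq : q ^ 2 = d * L / S := Real.sq_sqrt (by positivity)
    have hq0 : 0 < q := Real.sqrt_pos.2 (by positivity)
    have hβ : a * q ≤ 1 / 2 := by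
      refine (sq_le_sq₀ (by positivity) (by norm_num)).1 ?_
      rw [mul_pow, hqsq, ← mul_div_assoc, div_le_iff₀ hSpos]
      linarith
    have h := linear_regret_le hd hε hcb hcore hg (β := a * q) (by positivity) hβ hu T
    rw [← hS, ← hG] at h
    have e1 : a / (a * q) = 1 / q := by field_simp
    have e2 : a * q / a = q := by field_simp
    change _ ≤ ε₀ + a / (a * q) * _ + 2 * (a * q / a) * S at h
    rw [e1, e2] at h
    have hqS : q * S = s := by
      refine (pow_left_inj₀ (by positivity) hsq0 two_ne_zero).1 ?_
      rw [mul_pow, hqsq, hsq]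
      field_simp
    have hqdL : 1 / q * (d * L) = s := by
      rw [← hqS]
      field_simp
      rw [hqsq]
      field_simp
    have h1 : Real.log (1 / q / ε₀) ≤ 2 * (d * L) := by
      have e3 : 1 / q / ε₀ = (1 / (a * q)) * (a / ε₀) := by field_simp
      -- From `S ≤ a ^ 2 * G` and `1 / 2 ≤ d * L` one gets `1 / (a * q) ^ 2 ≤ 2 * G ≤ (2 + G) ^ 2`,
      -- so tuning adds no logarithm beyond `L`.
      have h5 : Real.log (1 / (a * q)) ≤ Real.log (2 + G) := by
        refine Real.log_le_log (by positivity) ?_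
        refine (sq_le_sq₀ (by positivity) (by positivity)).1 ?_
        rw [div_pow, mul_pow, hqsq, one_pow, div_le_iff₀ (by positivity), mul_div_assoc',
          mul_div_assoc', le_div_iff₀ hSpos]
        have h6 : a ^ 2 * (1 / 2) ≤ a ^ 2 * (d * L) := by gcongr
        nlinarith [mul_le_mul_of_nonneg_left h6 (sq_nonneg (2 + G)), sq_nonneg a,
          mul_nonneg (sq_nonneg a) (sq_nonneg G), mul_nonneg (sq_nonneg a) hG0]
      rw [e3, Real.log_mul (by positivity) (by positivity)]
      linarith
    have h3 : 1 / q * (Real.log (1 / q / ε₀) + k * d * Real.log (2 + G)) ≤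
        1 / q * (2 * (d * L) + k * (d * L)) := by gcongr
    have h4 : 1 / q * (2 * (d * L) + k * (d * L)) = (2 + k) * s := by
      rw [← hqdL]
      ring
    have h7 : 2 * q * S = 2 * s := by rw [← hqS]; ring
    have h8 : (2 * k + 6) * (d * a * L + s) =
        (2 + k) * s + 2 * s + ((k + 2) * s + (2 * k + 6) * (a * (d * L))) := by ring
    have h9 : 0 ≤ (k + 2) * s + (2 * k + 6) * (a * (d * L)) := by positivity
    rw [h8]
    linarith

end CoinBetting

/-! ### The number of projections -/

section Count

variable {d : ℕ} {g v : ℕ → EuclideanSpace ℝ (Fin d)} {A : ℕ → Matrix (Fin d) (Fin d) ℝ}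

/-- The length of the step of round `t`. -/
noncomputable def stepLength (z : ℕ → EuclideanSpace ℝ (Fin d)) (t : ℕ) : ℝ :=
  1 / curvature * ‖Matrix.toEuclideanLin (precond z (t + 1))⁻¹ (z t)‖

theorem stepLength_le (hd : 1 ≤ d) {z : ℕ → EuclideanSpace ℝ (Fin d)} (hz : ∀ t, ‖z t‖ ≤ 4)
    (t : ℕ) : d * stepLength z t ≤ 4 / curvature := by
  have hγ := curvature_pos
  have h := norm_precond_inv_le hd (z := z) (t + 1) (z t)
  rw [stepLength]
  have : d * (1 / curvature * ‖Matrix.toEuclideanLin (precond z (t + 1))⁻¹ (z t)‖) =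
      1 / curvature * (d * ‖Matrix.toEuclideanLin (precond z (t + 1))⁻¹ (z t)‖) := by ring
  have e : 4 / curvature = 1 / curvature * 4 := by ring
  rw [this, e]
  gcongr
  exact h.trans (hz t)

/-- Cauchy–Schwarz together with the trace bound `sum_sq_precond_inv_le`. -/
theorem sum_stepLength_le (hd : 1 ≤ d) (z : ℕ → EuclideanSpace ℝ (Fin d)) (T : ℕ) :
    ∑ t ∈ range T, stepLength z t ≤ 1 / curvature * Real.sqrt T := by
  have hγ := curvature_pos
  simp only [stepLength]
  rw [← mul_sum]
  gcongr
  refine Real.le_sqrt_of_sq_le ?_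
  have h := sq_sum_le_card_mul_sum_sq (s := range T)
    (f := fun t => ‖Matrix.toEuclideanLin (precond z (t + 1))⁻¹ (z t)‖)
  rw [card_range] at h
  refine h.trans ?_
  have := sum_sq_precond_inv_le (z := z) hd T
  have hT : (0 : ℝ) ≤ T := Nat.cast_nonneg T
  nlinarith

/-- Between two projections the iterate has to travel a distance of `1 / 4`. -/
theorem IsBettingCore.card_projections_le (h : IsBettingCore g v A)
    {z : ℕ → EuclideanSpace ℝ (Fin d)} (hz : z = fun t => (1 - inner ℝ (g t) (v t))⁻¹ • g t)
    {y : ℕ → EuclideanSpace ℝ (Fin d)}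
    (hy : y = fun t => v t - (1 / curvature) • Matrix.toEuclideanLin (precond z (t + 1))⁻¹ (z t))
    (T : ℕ) : (#{t ∈ range T | 3 / 4 < ‖y t‖} : ℝ) / 4 + ‖v T‖ ≤ ∑ t ∈ range T, stepLength z t := by
  have hγ := curvature_pos
  induction T with
  | zero => simp [h.start]
  | succ T ih =>
    have hA : A T = precond z (T + 1) := by rw [h.matrix, hz, precond]
    have hyT : y T = v T - (1 / curvature) • Matrix.toEuclideanLin (A T)⁻¹
        ((1 - inner ℝ (g T) (v T))⁻¹ • g T) := by rw [hy, hA, hz]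
    have hle : ‖y T‖ ≤ ‖v T‖ + stepLength z T := by
      rw [hy]
      refine (norm_sub_le _ _).trans (le_of_eq ?_)
      rw [norm_smul, stepLength, Real.norm_of_nonneg (by positivity)]
    rw [range_add_one, filter_insert, sum_insert notMem_range_self]
    split_ifs with h1
    -- A projection drops the norm from above `3 / 4` to at most `1 / 2`; this drop pays for the new
    -- `1 / 4` on the left.
    · rw [card_insert_of_notMem (by simp)]
      have h2 := h.project T (by rw [← hyT]; linarith)
      push_cast
      linarith [h2.1]
    · have h2 := h.keep T (by rw [← hyT]; linarith [not_lt.1 h1])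
      rw [← hyT] at h2
      rw [h2]
      linarith

theorem IsBettingCore.card_projections_le_sqrt (hd : 1 ≤ d) (h : IsBettingCore g v A)
    {z : ℕ → EuclideanSpace ℝ (Fin d)} (hz : z = fun t => (1 - inner ℝ (g t) (v t))⁻¹ • g t)
    {y : ℕ → EuclideanSpace ℝ (Fin d)}
    (hy : y = fun t => v t - (1 / curvature) • Matrix.toEuclideanLin (precond z (t + 1))⁻¹ (z t))
    (T : ℕ) : (#{t ∈ range T | 3 / 4 < ‖y t‖} : ℝ) ≤ 4 / curvature * Real.sqrt T := by
  have h1 := h.card_projections_le hz hy T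
  have h2 := sum_stepLength_le hd z T
  have h3 := norm_nonneg (v T)
  have : 4 / curvature * Real.sqrt T = 4 * (1 / curvature * Real.sqrt T) := by ring
  linarith

/-- The first projection cannot happen before round `Ω(d)`. -/
theorem IsBettingCore.dim_le_of_projection (hd : 1 ≤ d) (h : IsBettingCore g v A)
    (hg : ∀ t, ‖g t‖ ≤ 1)
    {z : ℕ → EuclideanSpace ℝ (Fin d)} (hz : z = fun t => (1 - inner ℝ (g t) (v t))⁻¹ • g t)
    {y : ℕ → EuclideanSpace ℝ (Fin d)}
    (hy : y = fun t => v t - (1 / curvature) • Matrix.toEuclideanLin (precond z (t + 1))⁻¹ (z t))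
    {t : ℕ} (ht : 3 / 4 < ‖y t‖) : (d : ℝ) ≤ 16 / curvature * ((t : ℝ) + 1) := by
  have hz4 : ∀ s, ‖z s‖ ≤ 4 := fun s => by
    rw [hz]
    exact (norm_logGradient_le (hg s) (h.norm_le s)).trans (by linarith [hg s])
  have h1 := h.card_projections_le hz hy (t + 1)
  have h2 : (1 : ℝ) ≤ #{s ∈ range (t + 1) | 3 / 4 < ‖y s‖} := by
    exact_mod_cast Finset.card_pos.2 ⟨t, by simp [ht]⟩
  -- A single step has length at most `4 / (γ d)`, while a projection needs a path of length `1 /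
  -- 4`.
  have h3 : d * ∑ s ∈ range (t + 1), stepLength z s ≤ ((t : ℝ) + 1) * (4 / curvature) := by
    rw [mul_sum]
    refine (sum_le_sum fun s _ => stepLength_le hd hz4 s).trans (le_of_eq ?_)
    simp
  have h4 := norm_nonneg (v (t + 1))
  have h5 : (1 : ℝ) / 4 ≤ ∑ s ∈ range (t + 1), stepLength z s := by linarith
  have hd0 : (0 : ℝ) ≤ d := Nat.cast_nonneg d
  have h6 := mul_le_mul_of_nonneg_left h5 hd0
  have : 16 / curvature * ((t : ℝ) + 1) = 4 * (((t : ℝ) + 1) * (4 / curvature)) := by ring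
  linarith

end Count

/-! ### The length of the bisection -/

/-- The ratio of the initial interval to the accuracy is polynomial in `t` and `d`, and in a
projecting round `d = O(t + 1)`. Using `t + 2` in the logarithm keeps it at least `log 2`, so that
it absorbs constants. -/
theorem exists_bisectionLength_le : ∃ C : ℝ, 0 < C ∧ ∀ (d t : ℕ) (A : Matrix (Fin d) (Fin d) ℝ)
    (y : Fin d → ℝ), (d : ℝ) ≤ 16 / curvature * ((t : ℝ) + 1) →
    Real.sqrt (A.mulVec y ⬝ᵥ A.mulVec y) ≤ (16 * ((t : ℝ) + 1) + d) * (1 + 4 / curvature) →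
    (bisectionLength A y (accuracy d t) : ℝ) + 1 ≤ C * Real.log ((t : ℝ) + 2) := by
  have hγ := curvature_pos
  set γ := curvature with hγdef
  set B : ℝ := 16 + 16 / γ with hB
  set E : ℝ := 1 + 4 / γ with hE
  -- With `M = 16 * n + d ≤ B * n`, the interval of length at most `2 * M * E` divided by the
  -- accuracy `γ / (3 * M * n ^ 2)` is at most `6 * B ^ 2 * E / γ * n ^ 4`.
  set C₀ : ℝ := 1 + 6 * B ^ 2 * E / γ with hC₀
  have hB0 : 0 < B := by positivity
  have hE0 : 0 < E := by positivity
  have hC1 : 1 ≤ C₀ := by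
    rw [hC₀]
    have : 0 ≤ 6 * B ^ 2 * E / γ := by positivity
    linarith
  have hl2 : 0 < Real.log 2 := Real.log_pos (by norm_num)
  refine ⟨(Real.log C₀ / Real.log 2 + 2) / Real.log 2 + 4 / Real.log 2, ?_, ?_⟩
  · have := Real.log_nonneg hC1
    positivity
  intro d t A y hd hy
  set n : ℝ := (t : ℝ) + 1 with hn
  have hn1 : 1 ≤ n := by
    rw [hn]
    linarith [Nat.cast_nonneg (α := ℝ) t]
  have hd0 : (0 : ℝ) ≤ d := Nat.cast_nonneg d
  set M : ℝ := 16 * n + d with hM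
  have hMB : M ≤ B * n := by
    rw [hM, hB]
    linarith
  have hM0 : 0 < M := by positivity
  set l : ℝ := Real.logb 2 (C₀ * n ^ 4) with hl
  have hCn : 1 ≤ C₀ * n ^ 4 := one_le_mul_of_one_le_of_one_le hC1 (one_le_pow₀ hn1)
  have hl0 : 0 ≤ l := Real.logb_nonneg (by norm_num) hCn
  have hlen : bisectionLength A y (accuracy d t) ≤ ⌈l⌉₊ := by
    refine bisectionLength_le ?_
    have h1 : C₀ * n ^ 4 ≤ (2 : ℝ) ^ ⌈l⌉₊ := by
      calc C₀ * n ^ 4 = 2 ^ l := (Real.rpow_logb (by norm_num) (by norm_num) (by positivity)).symm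
        _ ≤ 2 ^ ((⌈l⌉₊ : ℕ) : ℝ) :=
          Real.rpow_le_rpow_of_exponent_le (by norm_num) (Nat.le_ceil l)
        _ = 2 ^ ⌈l⌉₊ := Real.rpow_natCast 2 _
    have h2 : accuracy d t = γ / (3 * M * n ^ 2) := rfl
    rw [h2, div_mul_eq_mul_div, le_div_iff₀ (by positivity)]
    calc 2 * Real.sqrt (A.mulVec y ⬝ᵥ A.mulVec y) * (3 * M * n ^ 2)
        ≤ 2 * (M * E) * (3 * M * n ^ 2) := by gcongr
      _ = 6 * E * n ^ 2 * M ^ 2 := by ring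
      _ ≤ 6 * E * n ^ 2 * (B * n) ^ 2 := by gcongr
      _ = γ * (6 * B ^ 2 * E / γ * n ^ 4) := by field_simp
      _ ≤ γ * (C₀ * n ^ 4) := by
        gcongr
        rw [hC₀]
        linarith
      _ ≤ γ * 2 ^ ⌈l⌉₊ := by gcongr
  have h3 : (bisectionLength A y (accuracy d t) : ℝ) ≤ l + 1 :=
    le_trans (by exact_mod_cast hlen) (Nat.ceil_lt_add_one hl0).le
  have h4 : l = Real.log C₀ / Real.log 2 + 4 / Real.log 2 * Real.log n := by
    rw [hl, Real.logb, Real.log_mul (by positivity) (by positivity), Real.log_pow]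
    push_cast
    ring
  have h5 : Real.log n ≤ Real.log ((t : ℝ) + 2) := Real.log_le_log (by linarith) (by linarith)
  have h6 : Real.log 2 ≤ Real.log ((t : ℝ) + 2) :=
    Real.log_le_log (by norm_num) (by linarith)
  have h7 : Real.log C₀ / Real.log 2 + 2 ≤
      (Real.log C₀ / Real.log 2 + 2) / Real.log 2 * Real.log ((t : ℝ) + 2) := by
    have := Real.log_nonneg hC1
    rw [div_mul_eq_mul_div, le_div_iff₀ hl2]
    gcongr
  have h8 : 4 / Real.log 2 * Real.log n ≤ 4 / Real.log 2 * Real.log ((t : ℝ) + 2) := by gcongr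
  rw [add_mul]
  linarith

/-! ### One round of coin betting with LightONS.Core -/

section Round

variable {d : ℕ}

/-- The gradient of `v ↦ - log (1 - gᵀ v)`. -/
noncomputable def logGradient (g v : Fin d → ℝ) : Fin d → ℝ := (1 - g ⬝ᵥ v)⁻¹ • g

/-- The preconditioner after a round. -/
noncomputable def nextPrecond (P : Matrix (Fin d) (Fin d) ℝ) (g v : Fin d → ℝ) :
    Matrix (Fin d) (Fin d) ℝ :=
  P + Matrix.vecMulVec (logGradient g v) (logGradient g v)

/-- The Newton step of a round. -/
noncomputable def newtonPoint (P : Matrix (Fin d) (Fin d) ℝ) (g v : Fin d → ℝ) : Fin d → ℝ :=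
  v - (1 / curvature) • (nextPrecond P g v)⁻¹.mulVec (logGradient g v)

/-- The betting fraction after a round. -/
noncomputable def nextFraction (t : ℕ) (P : Matrix (Fin d) (Fin d) ℝ) (g v : Fin d → ℝ) :
    Fin d → ℝ :=
  if newtonPoint P g v ⬝ᵥ newtonPoint P g v ≤ 9 / 16 then newtonPoint P g v
  else approxProj (nextPrecond P g v) (newtonPoint P g v) (accuracy d t)

/-- The cost of the projection of a round, if there is one. -/
noncomputable def projectionCost (ω : ℝ) (t : ℕ) (P : Matrix (Fin d) (Fin d) ℝ)
    (g v : Fin d → ℝ) : ℝ :=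
  if newtonPoint P g v ⬝ᵥ newtonPoint P g v ≤ 9 / 16 then 0
  else ((bisectionLength (nextPrecond P g v) (newtonPoint P g v) (accuracy d t) : ℝ) + 1) *
    (d : ℝ) ^ ω

end Round

end UnboundedOCO

/-! ### The programs for the initialization and for one round. -/

namespace RealMachine

open UnboundedOCO

/-- The memory of the betting algorithm. -/
noncomputable def memory {d : ℕ} (t : ℕ) (W : ℝ) (v : Fin d → ℝ) (P : Matrix (Fin d) (Fin d) ℝ) :
    Data :=
  .pair (.real d) (.pair (.real t) (.pair (.real W) (.pair (.ofVec v) (.pair (.ofMatrix P)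
    (.ofMatrix P⁻¹)))))

/-- The data of one round. -/
structure RoundInput where
  d : ℕ
  t : ℕ
  W : ℝ
  g : Fin d → ℝ
  v : Fin d → ℝ
  P : Matrix (Fin d) (Fin d) ℝ
  one_le : 1 ≤ d
  posDef : P.PosDef
  ne_zero : 1 - g ⬝ᵥ v ≠ 0

/-- The inverse of `d I` is written down directly, so the initialization needs no matrix inversion.
-/
theorem comp_init : Comp (I := {d : ℕ // 1 ≤ d} × ℝ) (fun i => .pair (.real (i.1 : ℕ)) (.real i.2))
    (fun i => .pair (.ofVec (0 : Fin i.1 → ℝ))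
      (memory 0 i.2 (0 : Fin i.1 → ℝ) (((i.1 : ℕ) : ℝ) • (1 : Matrix (Fin i.1) (Fin i.1) ℝ))))
    fun i => ((i.1 : ℕ) : ℝ) ^ 2 := by
  have hd1 : ∀ i : {d : ℕ // 1 ≤ d} × ℝ, (1 : ℝ) ≤ ((i.1 : ℕ) : ℝ) := fun i => by
    exact_mod_cast i.1.2
  have hc1 : ∀ i : {d : ℕ // 1 ≤ d} × ℝ, (1 : ℝ) ≤ ((i.1 : ℕ) : ℝ) ^ 2 := fun i => by
    nlinarith [hd1 i]
  have hdim : ∀ i : {d : ℕ // 1 ≤ d} × ℝ, (((i.1 : ℕ) : ℝ) + 1) * (((i.1 : ℕ) : ℝ) + 1) ≤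
      4 * ((i.1 : ℕ) : ℝ) ^ 2 := fun i => by nlinarith [hd1 i]
  have hid := Comp.id (X := fun i : {d : ℕ // 1 ≤ d} × ℝ =>
    Data.pair (.real (i.1 : ℕ)) (.real i.2)) hc1
  have hz := Comp.zeroVec hid.fst hc1 fun i => by nlinarith [hd1 i]
  have hone := Comp.oneMatrix hid.fst hc1 hdim
  have hP := (Comp.mlin hid.fst (Comp.const 0 hc1) hone hone hc1 hdim).congr_right
    (Z := fun i => .ofMatrix (((i.1 : ℕ) : ℝ) • (1 : Matrix (Fin i.1) (Fin i.1) ℝ)))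
    fun i => by rw [zero_smul, add_zero]
  have hB := (Comp.mlin ((Comp.const 1 hc1).div hid.fst fun i => by linarith [hd1 i])
    (Comp.const 0 hc1) hone hone hc1 hdim).congr_right
    (Z := fun i => .ofMatrix (((i.1 : ℕ) : ℝ) • (1 : Matrix (Fin i.1) (Fin i.1) ℝ))⁻¹)
    fun i => by
      have h0 : ((i.1 : ℕ) : ℝ) ≠ 0 := by linarith [hd1 i]
      congr 1
      refine (Matrix.inv_eq_right_inv ?_).symm
      rw [zero_smul, add_zero, Matrix.smul_mul, Matrix.mul_smul, Matrix.one_mul, smul_smul,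
        mul_one_div_cancel h0, one_smul]
  refine hz.pair (hid.fst.pair (.pair ?_ (hid.snd.pair (hz.pair (hP.pair hB)))))
  simpa using Comp.const (X := fun i : {d : ℕ // 1 ≤ d} × ℝ =>
    Data.pair (.real (i.1 : ℕ)) (.real i.2)) 0 hc1

/-- Outside the projection branch there are only matrix-vector products and rank-one updates,
because the memory carries the inverse preconditioner. -/
theorem comp_round {ω : ℝ} (hω : 2 ≤ ω) (hM : MatMulExponent ω) : Comp (I := RoundInput)
    (fun i => .pair (.ofVec i.g) (memory i.t i.W i.v i.P))
    (fun i => .pair (.ofVec ((i.W - i.g ⬝ᵥ (i.W • i.v)) • nextFraction i.t i.P i.g i.v))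
      (memory (i.t + 1) (i.W - i.g ⬝ᵥ (i.W • i.v)) (nextFraction i.t i.P i.g i.v)
        (nextPrecond i.P i.g i.v)))
    fun i => (i.d : ℝ) ^ 2 + projectionCost ω i.t i.P i.g i.v := by
  set c : RoundInput → ℝ := fun i => (i.d : ℝ) ^ 2 + projectionCost ω i.t i.P i.g i.v with hc
  have hd1 : ∀ i : RoundInput, (1 : ℝ) ≤ i.d := fun i => by exact_mod_cast i.one_le
  have hpc : ∀ i : RoundInput, 0 ≤ projectionCost ω i.t i.P i.g i.v := fun i => by
    rw [projectionCost]
    split_ifs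
    · exact le_rfl
    · positivity
  have hdc : ∀ i, (i.d : ℝ) ^ 2 ≤ c i := fun i => by simp only [hc]; linarith [hpc i]
  have hc1 : ∀ i, 1 ≤ c i := fun i => by nlinarith [hdc i, hd1 i]
  have hdim : ∀ i, ((i.d : ℝ) + 1) * (i.d + 1) ≤ 4 * c i := fun i => by
    nlinarith [hdc i, hd1 i]
  have hdim1 : ∀ i, (i.d : ℝ) + 1 ≤ 4 * c i := fun i => by nlinarith [hdc i, hd1 i]
  have hid := Comp.id (X := fun i : RoundInput => Data.pair (.ofVec i.g) (.pair (.real i.d)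
    (.pair (.real i.t) (.pair (.real i.W) (.pair (.ofVec i.v) (.pair (.ofMatrix i.P)
    (.ofMatrix i.P⁻¹))))))) hc1
  have hg := hid.fst
  have hd := hid.snd.fst
  have ht := hid.snd.snd.fst
  have hW := hid.snd.snd.snd.fst
  have hv := hid.snd.snd.snd.snd.fst
  have hP := hid.snd.snd.snd.snd.snd.fst
  have hB := hid.snd.snd.snd.snd.snd.snd
  have one := Comp.const (X := fun i : RoundInput => Data.pair (.ofVec i.g) (.pair (.real i.d)
    (.pair (.real i.t) (.pair (.real i.W) (.pair (.ofVec i.v) (.pair (.ofMatrix i.P)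
    (.ofMatrix i.P⁻¹))))))) 1 hc1
  have smul : ∀ {X : RoundInput → Data} {a : RoundInput → ℝ} {u : ∀ i : RoundInput, Fin i.d → ℝ},
      Comp X (fun i => .real (a i)) c → Comp X (fun i => .ofVec (u i)) c →
      Comp X (fun i => .ofVec (a i • u i)) c := fun ha hu =>
    (Comp.vlin ha (Comp.const 0 hc1) hu hu hc1 hdim1).congr_right fun i => by
      rw [zero_smul, add_zero]
  have hz := (smul (one.div (one.sub (Comp.dot hg hv hc1 hdim1)) fun i => i.ne_zero)
    hg).congr_right (Z := fun i => .ofVec (logGradient i.g i.v))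
      fun i => by rw [logGradient, one_div]
  have hW' := hW.sub (Comp.dot hg (smul hW hv) hc1 hdim1)
  have hP' := (Comp.rankOne hP one hz hz hc1 hdim).congr_right
    (Z := fun i => .ofMatrix (nextPrecond i.P i.g i.v)) fun i => by rw [one_smul, nextPrecond]
  have hb := Comp.mulVec hB hz hc1 hdim
  have hs := Comp.dot hz hb hc1 hdim1
  -- Sherman–Morrison: the new inverse is a rank-one update of the stored one, and its denominator
  -- is at least `1`.
  have hB' := (Comp.rankOne hB ((Comp.const (-1) hc1).div (one.add hs) fun i => by
      have := dotProduct_inv_nonneg i.posDef (logGradient i.g i.v)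
      linarith) hb hb hc1 hdim).congr_right
      (Z := fun i => .ofMatrix (nextPrecond i.P i.g i.v)⁻¹) fun i => by
        rw [nextPrecond, inv_rankOne i.posDef, neg_div, neg_smul, sub_eq_add_neg]
  have hy := (Comp.vlin one (Comp.const (-(1 / curvature)) hc1) hv (Comp.mulVec hB' hz hc1 hdim) hc1
      hdim1).congr_right (Z := fun i => .ofVec (newtonPoint i.P i.g i.v))
    fun i => by rw [newtonPoint, one_smul, neg_smul, sub_eq_add_neg]
  have ht1 := ht.add one
  have hζ :=
    ((Comp.const curvature hc1).div (((Comp.const 3 hc1).mul (((Comp.const 16 hc1).mul ht1).add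
      hd)).mul (ht1.mul ht1)) fun i => by positivity).congr_right
      (Z := fun i => .real (accuracy i.d i.t)) fun i => by
        rw [accuracy, ← sq]
  have hv' := (hd.pair (hP'.pair (hy.pair hζ))).trans
    (Z := fun i => .ofVec (nextFraction i.t i.P i.g i.v)) (by
    have hid := Comp.id (X := fun i : RoundInput => Data.pair (.real i.d)
      (.pair (.ofMatrix (nextPrecond i.P i.g i.v)) (.pair (.ofVec (newtonPoint i.P i.g i.v))
      (.real (accuracy i.d i.t))))) hc1
    refine Comp.ite_le (Comp.dot hid.snd.snd.fst hid.snd.snd.fst hc1 hdim1)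
      (Comp.const (9 / 16) hc1) hid ?_ ?_
    · refine (hid.snd.snd.fst.reindex fun i : {i : RoundInput // _} => i.1).congr_right ?_
      rintro ⟨i, h⟩
      dsimp only
      rw [nextFraction, if_pos h]
    · have hproj := (comp_approxProj hω hM).reindex (J := {i : RoundInput // 9 / 16 <
        newtonPoint i.P i.g i.v ⬝ᵥ newtonPoint i.P i.g i.v}) fun i => ⟨i.1.d,
        nextPrecond i.1.P i.1.g i.1.v, newtonPoint i.1.P i.1.g i.1.v, accuracy i.1.d i.1.t,
        i.1.one_le, posDef_rankOne i.1.posDef _, accuracy_pos _ _⟩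
      refine (hproj.mono 1 zero_le_one ?_).congr_right ?_
      · rintro ⟨i, h⟩
        simp only [hc, one_mul, projectionCost, if_neg (not_le.2 h)]
        linarith [sq_nonneg (i.d : ℝ)]
      · rintro ⟨i, h⟩
        dsimp only
        rw [nextFraction, if_neg (not_le.2 h)])
  refine (smul hW' hv').pair (hd.pair (.pair ?_ (hW'.pair (hv'.pair (hP'.pair hB')))))
  simpa using ht1

end RealMachine

namespace UnboundedOCO

/-! ### Trajectories of the algorithm -/

/-- The state of the algorithm: the wealth, the betting fraction and the preconditioner. -/
structure State (d : ℕ) where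
  wealth : ℝ
  fraction : Fin d → ℝ
  matrix : Matrix (Fin d) (Fin d) ℝ

section Trajectory

variable {d : ℕ} (ε₀ : ℝ) (grad : ℕ → EuclideanSpace ℝ (Fin d) → EuclideanSpace ℝ (Fin d))

/-- The decision in a state. -/
noncomputable def State.decision (s : State d) : EuclideanSpace ℝ (Fin d) :=
  WithLp.toLp 2 (s.wealth • s.fraction)

/-- The state after round `t` with gradient `g`. -/
noncomputable def State.next (t : ℕ) (s : State d) (g : Fin d → ℝ) : State d where
  wealth := s.wealth - g ⬝ᵥ (s.wealth • s.fraction)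
  fraction := nextFraction t s.matrix g s.fraction
  matrix := nextPrecond s.matrix g s.fraction

/-- The states against a gradient oracle. -/
noncomputable def trajectory : ℕ → State d
  | 0 => ⟨ε₀, 0, (d : ℝ) • 1⟩
  | t + 1 => (trajectory t).next t (grad t (trajectory t).decision).ofLp

/-- The gradient observed in round `t`. -/
noncomputable def observed (t : ℕ) : EuclideanSpace ℝ (Fin d) :=
  grad t (trajectory ε₀ grad t).decision

/-- The betting fraction of round `t`. -/
noncomputable def fraction (t : ℕ) : EuclideanSpace ℝ (Fin d) :=
  WithLp.toLp 2 (trajectory ε₀ grad t).fraction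

/-- The gradient of the logarithmic loss of round `t`. -/
noncomputable def logGrad (t : ℕ) : EuclideanSpace ℝ (Fin d) :=
  (1 - inner ℝ (observed ε₀ grad t) (fraction ε₀ grad t))⁻¹ • observed ε₀ grad t

theorem inner_observed (t : ℕ) : inner ℝ (observed ε₀ grad t) (fraction ε₀ grad t) =
    (observed ε₀ grad t).ofLp ⬝ᵥ (trajectory ε₀ grad t).fraction :=
  inner_toLp _ _

theorem logGradient_trajectory (t : ℕ) :
    logGradient (observed ε₀ grad t).ofLp (trajectory ε₀ grad t).fraction =
      (logGrad ε₀ grad t).ofLp := by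
  rw [logGradient, logGrad, inner_observed, WithLp.ofLp_smul]

theorem matrix_trajectory (t : ℕ) :
    (trajectory ε₀ grad t).matrix = precond (logGrad ε₀ grad) t := by
  induction t with
  | zero => rw [precond_zero]; rfl
  | succ t ih =>
    rw [precond_succ, ← ih]
    change nextPrecond _ (observed ε₀ grad t).ofLp _ = _
    rw [nextPrecond, logGradient_trajectory]

theorem nextPrecond_trajectory (t : ℕ) :
    nextPrecond (trajectory ε₀ grad t).matrix (observed ε₀ grad t).ofLp
      (trajectory ε₀ grad t).fraction = precond (logGrad ε₀ grad) (t + 1) :=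
  matrix_trajectory ε₀ grad (t + 1)

theorem newtonPoint_trajectory (t : ℕ) :
    (WithLp.toLp 2 (newtonPoint (trajectory ε₀ grad t).matrix (observed ε₀ grad t).ofLp
      (trajectory ε₀ grad t).fraction) : EuclideanSpace ℝ (Fin d)) =
    fraction ε₀ grad t - (1 / curvature) •
      Matrix.toEuclideanLin (precond (logGrad ε₀ grad) (t + 1))⁻¹ (logGrad ε₀ grad t) := by
  rw [newtonPoint, nextPrecond_trajectory, logGradient_trajectory]
  rfl

theorem dotProduct_le_iff_norm_le (y : Fin d → ℝ) : y ⬝ᵥ y ≤ 9 / 16 ↔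
    ‖(WithLp.toLp 2 y : EuclideanSpace ℝ (Fin d))‖ ≤ 3 / 4 := by
  rw [← norm_toLp_sq, show (9 / 16 : ℝ) = (3 / 4) ^ 2 by norm_num]
  exact sq_le_sq₀ (norm_nonneg _) (by norm_num)

theorem isCoinBetting_trajectory : IsCoinBetting ε₀ (observed ε₀ grad) (fraction ε₀ grad)
    (fun t => (trajectory ε₀ grad t).decision) fun t => (trajectory ε₀ grad t).wealth where
  start := rfl
  bet _ := rfl
  wealth t := by
    change _ - _ = _
    congr 1
    exact (inner_toLp (observed ε₀ grad t).ofLp _).symm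

/-- The computed states are exact iterates except in the projection, where `approxProj_spec` applies
with coercivity constant `d`. The test of squares against `9 / 16` is the hysteresis test. -/
theorem isBettingCore_trajectory (hd : 1 ≤ d) : IsBettingCore (observed ε₀ grad)
    (fraction ε₀ grad) fun t => precond (logGrad ε₀ grad) (t + 1) where
  start := rfl
  matrix _ := rfl
  keep t ht := by
    change ‖fraction ε₀ grad t - (1 / curvature) • Matrix.toEuclideanLin
      (precond (logGrad ε₀ grad) (t + 1))⁻¹ (logGrad ε₀ grad t)‖ ≤ _ at ht
    change _ = fraction ε₀ grad t - (1 / curvature) • Matrix.toEuclideanLin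
      (precond (logGrad ε₀ grad) (t + 1))⁻¹ (logGrad ε₀ grad t)
    rw [← newtonPoint_trajectory] at ht ⊢
    have h := (dotProduct_le_iff_norm_le _).2 (ht.trans (by norm_num))
    change WithLp.toLp 2 (nextFraction t _ (observed ε₀ grad t).ofLp _) = _
    rw [nextFraction, if_pos h]
  project t ht := by
    change _ < ‖fraction ε₀ grad t - (1 / curvature) • Matrix.toEuclideanLin
      (precond (logGrad ε₀ grad) (t + 1))⁻¹ (logGrad ε₀ grad t)‖ at ht
    change _ ∧ ∃ p, IsMahalanobisProj _ _ (fraction ε₀ grad t - (1 / curvature) •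
      Matrix.toEuclideanLin (precond (logGrad ε₀ grad) (t + 1))⁻¹ (logGrad ε₀ grad t)) p ∧ _
    rw [← newtonPoint_trajectory] at ht ⊢
    have h3 : (3 / 4 : ℝ) < _ := lt_of_eq_of_lt (by norm_num) ht
    have h := mt (dotProduct_le_iff_norm_le _).1 (not_le.2 h3)
    have hv : fraction ε₀ grad (t + 1) = WithLp.toLp 2 (approxProj
        (precond (logGrad ε₀ grad) (t + 1)) (newtonPoint (trajectory ε₀ grad t).matrix
        (observed ε₀ grad t).ofLp (trajectory ε₀ grad t).fraction) (accuracy d t)) := by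
      change WithLp.toLp 2 (nextFraction t _ (observed ε₀ grad t).ofLp _) = _
      rw [nextFraction, if_neg h, nextPrecond_trajectory]
    rw [hv]
    have hd1 : (1 : ℝ) ≤ d := by exact_mod_cast hd
    exact approxProj_spec (by linarith) (precond_posDef hd _) (precond_coercive _) (by linarith)
      (accuracy_pos d t)

variable {ε₀ grad}

theorem wager_ne_zero (hd : 1 ≤ d) (hg : ∀ t y, ‖grad t y‖ ≤ 1) (t : ℕ) :
    1 - (observed ε₀ grad t).ofLp ⬝ᵥ (trajectory ε₀ grad t).fraction ≠ 0 := by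
  rw [← inner_observed]
  have h : |inner ℝ (observed ε₀ grad t) (fraction ε₀ grad t)| ≤ 3 / 4 :=
    abs_inner_le_of_norm_le (hg t _) ((isBettingCore_trajectory ε₀ grad hd).norm_le t)
  linarith [(abs_le.1 h).2]

theorem norm_logGrad_le (hd : 1 ≤ d) (hg : ∀ t y, ‖grad t y‖ ≤ 1) (t : ℕ) :
    ‖logGrad ε₀ grad t‖ ≤ 4 :=
  (norm_logGradient_le (hg t _) ((isBettingCore_trajectory ε₀ grad hd).norm_le t)).trans
    (by linarith [hg t (trajectory ε₀ grad t).decision])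

/-- The total cost of the projections. -/
theorem exists_sum_projectionCost_le (ω : ℝ) : ∃ C : ℝ, 0 ≤ C ∧ ∀ (d : ℕ), 1 ≤ d → ∀ (ε₀ : ℝ)
    (grad : ℕ → EuclideanSpace ℝ (Fin d) → EuclideanSpace ℝ (Fin d)),
    (∀ t y, ‖grad t y‖ ≤ 1) → ∀ T : ℕ,
    ∑ t ∈ range T, projectionCost ω t (trajectory ε₀ grad t).matrix (observed ε₀ grad t).ofLp
      (trajectory ε₀ grad t).fraction ≤
      C * ((d : ℝ) ^ ω * Real.sqrt T * Real.log (T + 1)) := by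
  obtain ⟨C, hC, hlen⟩ := exists_bisectionLength_le
  have hγ := curvature_pos
  refine ⟨C * (4 / curvature), by positivity, fun d hd ε₀ grad hg T => ?_⟩
  have hd1 : (1 : ℝ) ≤ d := by exact_mod_cast hd
  have hcore := isBettingCore_trajectory ε₀ grad hd
  have hz : logGrad ε₀ grad = fun t => (1 - inner ℝ (observed ε₀ grad t)
    (fraction ε₀ grad t))⁻¹ • observed ε₀ grad t := rfl
  obtain ⟨y, hy⟩ : ∃ y : ℕ → EuclideanSpace ℝ (Fin d), y = fun t => fraction ε₀ grad t -
    (1 / curvature) • Matrix.toEuclideanLin (precond (logGrad ε₀ grad) (t + 1))⁻¹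
      (logGrad ε₀ grad t) := ⟨_, rfl⟩
  have hyn : ∀ t, (y t).ofLp = newtonPoint (trajectory ε₀ grad t).matrix
      (observed ε₀ grad t).ofLp (trajectory ε₀ grad t).fraction := fun t => by
    rw [hy]
    dsimp only
    rw [← newtonPoint_trajectory]
  have hcard := hcore.card_projections_le_sqrt hd hz hy T
  -- Only projecting rounds contribute, each at most `C * log (T + 1) * d ^ ω`; the sum is thus a
  -- count of projections.
  have hstep : ∀ t ∈ range T, projectionCost ω t (trajectory ε₀ grad t).matrix
      (observed ε₀ grad t).ofLp (trajectory ε₀ grad t).fraction ≤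
      if 3 / 4 < ‖y t‖ then C * Real.log (T + 1) * (d : ℝ) ^ ω else 0 := fun t ht => by
    rw [projectionCost, ← hyn, nextPrecond_trajectory]
    have hiff : (y t).ofLp ⬝ᵥ (y t).ofLp ≤ 9 / 16 ↔ ‖y t‖ ≤ 3 / 4 :=
      dotProduct_le_iff_norm_le _
    rcases le_or_gt ‖y t‖ (3 / 4) with h | h
    · rw [if_pos (hiff.2 h), if_neg (not_lt.2 h)]
    · rw [if_neg (mt hiff.1 (not_le.2 h)), if_pos h]
      refine mul_le_mul_of_nonneg_right ?_ (by positivity)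
      refine (hlen d t _ _ (hcore.dim_le_of_projection hd (fun t => hg t _) hz hy h) ?_).trans ?_
      · rw [← norm_toLp, ← ofLp_toEuclideanLin]
        have h1 := norm_precond_le (norm_logGrad_le (ε₀ := ε₀) hd hg) (t + 1) (y t)
        -- The fraction has norm at most `3 / 4`, and the Newton direction at most `4`, as the
        -- preconditioner dominates the identity.
        have h2 : ‖y t‖ ≤ 1 + 4 / curvature := by
          have h3 := norm_precond_inv_le hd (z := logGrad ε₀ grad) (t + 1) (logGrad ε₀ grad t)
          have h4 := norm_logGrad_le (ε₀ := ε₀) hd hg t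
          have h5 := hcore.norm_le t
          have h6 : ‖Matrix.toEuclideanLin (precond (logGrad ε₀ grad) (t + 1))⁻¹
              (logGrad ε₀ grad t)‖ ≤ 4 := by
            nlinarith [norm_nonneg (Matrix.toEuclideanLin (precond (logGrad ε₀ grad) (t + 1))⁻¹
              (logGrad ε₀ grad t))]
          rw [hy]
          refine (norm_sub_le _ _).trans ?_
          rw [norm_smul, Real.norm_of_nonneg (by positivity)]
          have h7 := mul_le_mul_of_nonneg_left h6 (one_div_pos.2 hγ).le
          have e : 1 / curvature * 4 = 4 / curvature := by ring
          linarith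
        push_cast at h1
        exact h1.trans (by gcongr)
      · have h1 : (t : ℝ) + 1 ≤ T := by exact_mod_cast mem_range.1 ht
        gcongr C * Real.log ?_
        linarith
  refine (sum_le_sum hstep).trans ?_
  rw [← sum_filter, sum_const, nsmul_eq_mul]
  have h0 : 0 ≤ C * Real.log (T + 1) * (d : ℝ) ^ ω := by
    have := Real.log_nonneg (show (1 : ℝ) ≤ T + 1 by linarith [Nat.cast_nonneg (α := ℝ) T])
    positivity
  refine (mul_le_mul_of_nonneg_right hcard h0).trans (le_of_eq ?_)
  ring

end Trajectory

/-! ### Reduction from convex Lipschitz losses to linear ones. -/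

theorem IsSubgradient.norm_le {d : ℕ} {f : EuclideanSpace ℝ (Fin d) → ℝ}
    {x g : EuclideanSpace ℝ (Fin d)} (h : IsSubgradient f x g) (hf : LipschitzWith 1 f) :
    ‖g‖ ≤ 1 := by
  -- At the point `x + g` the subgradient and Lipschitz inequalities give `‖g‖ ^ 2 ≤ ‖g‖`.
  have h1 := h (x + g)
  rw [add_sub_cancel_left, real_inner_self_eq_norm_sq] at h1
  have h2 := hf.dist_le_mul (x + g) x
  rw [dist_self_add_left, NNReal.coe_one, one_mul, Real.dist_eq] at h2
  have h3 := (abs_le.1 h2).2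
  nlinarith [norm_nonneg g]

theorem regret_le_sum_inner {d : ℕ} {f : ℕ → EuclideanSpace ℝ (Fin d) → ℝ}
    {x g : ℕ → EuclideanSpace ℝ (Fin d)} (h : ∀ t, IsSubgradient (f t) (x t) (g t)) (T : ℕ)
    (u : EuclideanSpace ℝ (Fin d)) :
    regret f x T u ≤ ∑ t ∈ range T, inner ℝ (g t) (x t - u) := by
  rw [regret, ← sum_sub_distrib]
  refine sum_le_sum fun t _ => ?_
  have := h t u
  rw [← neg_sub, inner_neg_right] at this
  linarith

end UnboundedOCO

/-! ### The online algorithm and its total running time. -/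

namespace RealMachine

open UnboundedOCO

/-- The algorithm and its running time. -/
theorem exists_run {ω : ℝ} (hω : 2 ≤ ω) (hM : MatMulExponent ω) :
    ∃ (P : OnlineAlgorithm) (C : ℝ), 0 < C ∧ ∀ (d : ℕ), 1 ≤ d → ∀ (ε₀ : ℝ)
      (grad : ℕ → EuclideanSpace ℝ (Fin d) → EuclideanSpace ℝ (Fin d)),
      (∀ t y, ‖grad t y‖ ≤ 1) → ∃ (mem : ℕ → Data) (cost : ℕ → ℕ),
      P.Run (.pair (.real d) (.real ε₀)) (observed ε₀ grad)
        (fun t => (trajectory ε₀ grad t).decision) mem cost ∧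
      ∀ T : ℕ, 1 ≤ T → ((∑ t ∈ range (T + 1), cost t : ℕ) : ℝ) ≤
        C * ((d : ℝ) ^ 2 * T + (d : ℝ) ^ ω * Real.sqrt T * Real.log (T + 1)) := by
  obtain ⟨p, C₁, hC₁, hinit⟩ := comp_init
  obtain ⟨q, C₂, hC₂, hround⟩ := comp_round hω hM
  obtain ⟨C₃, hC₃, hproj⟩ := exists_sum_projectionCost_le ω
  refine ⟨⟨p, q⟩, C₁ + C₂ + C₂ * C₃ + 1, by positivity, fun d hd ε₀ grad hg => ?_⟩
  obtain ⟨k₀, hk₀, hc₀⟩ := hinit (⟨d, hd⟩, ε₀)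
  choose k hk hc using fun t => hround ⟨d, t, (trajectory ε₀ grad t).wealth,
    (observed ε₀ grad t).ofLp, (trajectory ε₀ grad t).fraction, (trajectory ε₀ grad t).matrix,
    hd, by rw [matrix_trajectory]; exact precond_posDef hd t, wager_ne_zero hd hg t⟩
  -- Index `0` is the initialization and index `t + 1` the update after round `t`, so `range (T +
  -- 1)` covers exactly the initialization and `T` updates.
  obtain ⟨cost, h0, hs⟩ : ∃ cost : ℕ → ℕ, cost 0 = k₀ ∧ ∀ t, cost (t + 1) = k t :=
    ⟨fun t => Nat.rec k₀ (fun t _ => k t) t, rfl, fun _ => rfl⟩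
  refine ⟨fun t => memory t (trajectory ε₀ grad t).wealth (trajectory ε₀ grad t).fraction
    (trajectory ε₀ grad t).matrix, cost, ⟨?_, fun t => ?_⟩,
    fun T hT => ?_⟩
  -- The first fraction is zero, so the zero vector printed by the initialization is the first
  -- decision.
  · have : (fun i => (trajectory ε₀ grad 0).decision i) = (0 : Fin d → ℝ) := by
      funext i
      exact mul_zero _
    rw [this, h0]
    exact hk₀
  · rw [hs]
    exact hk t
  · simp only [sum_range_succ', hs, h0]
    push_cast
    have hT1 : (1 : ℝ) ≤ T := by exact_mod_cast hT
    have h1 : ∑ t ∈ range T, (k t : ℝ) ≤ C₂ * (T * (d : ℝ) ^ 2 +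
        C₃ * ((d : ℝ) ^ ω * Real.sqrt T * Real.log (T + 1))) := by
      refine (sum_le_sum fun t _ => hc t).trans ?_
      dsimp only
      rw [← mul_sum, sum_add_distrib, sum_const, card_range, nsmul_eq_mul]
      have := hproj d hd ε₀ grad hg T
      gcongr
    have hX : 0 ≤ (d : ℝ) ^ ω * Real.sqrt T * Real.log (T + 1) := by
      have := Real.log_nonneg (show (1 : ℝ) ≤ T + 1 by linarith)
      positivity
    have h2 : (k₀ : ℝ) ≤ C₁ * ((d : ℝ) ^ 2 * T) :=
      hc₀.trans (mul_le_mul_of_nonneg_left (le_mul_of_one_le_right (by positivity) hT1) hC₁)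
    have hY : 0 ≤ (d : ℝ) ^ 2 * T := by positivity
    have := mul_nonneg hC₁ hX
    have := mul_nonneg hC₂ hX
    have := mul_nonneg (mul_nonneg hC₂ hC₃) hY
    refine (add_le_add h1 h2).trans ?_
    nlinarith

end RealMachine

/-! ### The main theorem. -/

theorem mainTheorem9 :
    ∃ K : ℝ, 0 < K ∧
    ∀ ω : ℝ, 2 ≤ ω → RealMachine.MatMulExponent ω →
    ∃ (P : RealMachine.OnlineAlgorithm) (C : ℝ), 0 < C ∧
    ∀ (d : ℕ), 1 ≤ d → ∀ ε₀ : ℝ, 0 < ε₀ →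
    ∀ (f : ℕ → EuclideanSpace ℝ (Fin d) → ℝ)
      (grad : ℕ → EuclideanSpace ℝ (Fin d) → EuclideanSpace ℝ (Fin d)),
      (∀ t, ConvexOn ℝ Set.univ (f t)) →
      (∀ t, LipschitzWith 1 (f t)) →
      (∀ t y, UnboundedOCO.IsSubgradient (f t) y (grad t y)) →
    ∃ (x : ℕ → EuclideanSpace ℝ (Fin d)) (mem : ℕ → RealMachine.Data) (cost : ℕ → ℕ),
      P.Run (RealMachine.Data.pair (RealMachine.Data.real (d : ℝ)) (RealMachine.Data.real ε₀))
        (fun t => grad t (x t)) x mem cost ∧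
      UnboundedOCO.IsCoinBettingLightONS ε₀ (fun t => grad t (x t)) x ∧
      ∀ T : ℕ, 1 ≤ T →
        ((∑ t ∈ Finset.range (T + 1), cost t : ℕ) : ℝ) ≤
          C * ((d : ℝ) ^ 2 * T + (d : ℝ) ^ ω * Real.sqrt T * Real.log (T + 1)) ∧
        ∀ u : EuclideanSpace ℝ (Fin d),
          let G : ℝ := ∑ t ∈ Finset.range T, ‖grad t (x t)‖ ^ 2
          let S : ℝ := ∑ t ∈ Finset.range T, (inner ℝ (grad t (x t)) u) ^ 2
          let L : ℝ := Real.log (2 + G + ‖u‖ / ε₀)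
          UnboundedOCO.regret f x T u ≤ ε₀ + K * (d * ‖u‖ * L + Real.sqrt (d * S * L)) ∧
          ε₀ + K * (d * ‖u‖ * L + Real.sqrt (d * S * L)) ≤
            ε₀ + K * (d * ‖u‖ * L + ‖u‖ * Real.sqrt (d * G * L)) := by
  have hK := UnboundedOCO.logRegretConst_pos
  refine ⟨2 * UnboundedOCO.logRegretConst + 6, by positivity, fun ω hω hM => ?_⟩
  obtain ⟨P, C, hC, hP⟩ := RealMachine.exists_run hω hM
  refine ⟨P, C, hC, fun d hd ε₀ hε f grad _ hf hgrad => ?_⟩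
  have hg : ∀ t y, ‖grad t y‖ ≤ 1 := fun t y => (hgrad t y).norm_le (hf t)
  obtain ⟨mem, cost, hrun, hcost⟩ := hP d hd ε₀ grad hg
  have hcb := UnboundedOCO.isCoinBetting_trajectory ε₀ grad
  have hcore := UnboundedOCO.isBettingCore_trajectory ε₀ grad hd
  -- All witnesses come from the trajectory; `observed` is by definition the gradient at the
  -- decision, and `accuracy` unfolds to the prescribed precision.
  refine ⟨_, mem, cost, hrun, ⟨_, _, _, hcb, hcore⟩, fun T hT => ⟨hcost T hT, fun u => ?_⟩⟩
  intro G S L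
  refine ⟨(UnboundedOCO.regret_le_sum_inner (fun t => hgrad t _) T u).trans
    (UnboundedOCO.regret_bound hd hε hcb hcore (fun t => hg t _) u T rfl rfl rfl), ?_⟩
  have hG : 0 ≤ G := sum_nonneg fun _ _ => by positivity
  have hL : 0 ≤ L := Real.log_nonneg (by linarith [div_nonneg (norm_nonneg u) hε.le])
  have hS : S ≤ ‖u‖ ^ 2 * G := UnboundedOCO.sum_inner_sq_le u T
  -- Cauchy–Schwarz in each round gives `S ≤ ‖u‖ ^ 2 * G`.
  have : Real.sqrt (d * S * L) ≤ ‖u‖ * Real.sqrt (d * G * L) := by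
    rw [← Real.sqrt_sq (norm_nonneg u), ← Real.sqrt_mul (by positivity)]
    refine Real.sqrt_le_sqrt ?_
    calc d * S * L ≤ d * (‖u‖ ^ 2 * G) * L := by gcongr
      _ = _ := by ring
  gcongr
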